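/- Let $n\ge 1$ and let $B\subset\mathbb R^n$ be a nonempty bounded open set with smooth boundary; put $H=\sup_{x\in B}|x|$. *Space kernel.* Let $k:\mathbb R^n\to\mathbb R$ be positive on $\mathbb R^n\setminus\{0\}$ with $\min\{|x|^2,1\}k(x)\in L^1(\mathbb R^n)$, and suppose that there are $\theta>0$ and $0<\beta<1$ with $k(x)\ge\theta|x|^{-(n+2\beta)}$ for all $x\in[-2H,2H]^n\setminus\{0\}$. *Time kernel.* Let $g$ be continuous on $(0,\infty)$, with Laplace transform $\hat g(s)=\int_0^\infty e^{-ts}g(t)\,dt$ absolutely convergent for all $s>0$. Suppose that $\hat g$ is a Stieltjes function, i.e. $\hat g(s)=\frac as+b+\int_{[0,\infty)}\frac{\sigma(dr)}{s+r}$ for $s>0$, with $a,b\ge0$ and a Borel measure $\sigma$ on $[0,\infty)$ such that $\int(1+r)^{-1}\sigma(dr)<\infty$. Suppose also that $\hat g(s)\to0$, $s\hat g(s)\to\infty$ as $s\to\infty$, and $\hat g(s)\to\infty$, $s\hat g(s)\to0$ as $s\to0^+$. Write $$\mathscr D_{(g)}v(t)=\frac{d}{dt}\int_0^tg(t-\tau)v(\tau)\,d\tau-g(t)v(0),$$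 where for $L^2(B)$-valued $v$ the integral and the derivative are taken in $L^2(B)$. *Operator.* Extend $u\in L^2(B)$ (real-valued) by zero to $\mathbb R^n$; this encodes the exterior condition $u=0$ on $B^C=\mathbb R^n\setminus B$. Let $X_0(B)$ be the set of all $u\in L^2(B)$ with $(u(x)-u(y))\sqrt{k(x-y)}\in L^2\big((\mathbb R^n\times\mathbb R^n)\setminus(B^C\times B^C)\big)$. Let $A=-\mathscr L_{(k)}$ be the Friedrichs extension of minus the general Laplacian: $u\in D(A)$ and $Au=w$ iff $u\in X_0(B)$, $w\in L^2(B)$ and $$\iint_{\mathbb R^n\times\mathbb R^n}(u(x)-u(y))(v(x)-v(y))k(x-y)\,dx\,dy=\int_Bw\,v\,dx\quad\text{for all }v\in X_0(B).$$ Then $A$ extends the operator $\varphi\mapsto-\mathscr L_{(k)}\varphi$, $\mathscr L_{(k)}\varphi(x)=\int_{\mathbb R^n}(\varphi(x+y)+\varphi(x-y)-2\varphi(x))k(y)\,dy$, defined on $C_0^\infty(B)$. There is a complete orthonormal system $(\psi_j)_{j\ge0}$ of $L^2(B)$ with $A\psi_j=\lambda_j\psi_j$ and $0<\lambda_0\le\lambda_1\le\cdots\to\infty$.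 For every such system, $D(A)=\{u\in L^2(B):\sum_j|\lambda_j\langle\psi_j,u\rangle|^2<\infty\}$; give $D(A)$ the norm $\|u\|_{D(A)}=\big(\sum_j|\lambda_j\langle\psi_j,u\rangle|^2\big)^{1/2}$. Let $f\in D(A)$. Then there is one and only one $p\in C([0,\infty);D(A))$ with $$\mathscr D_{(g)}p(t)=-Ap(t)\ \text{ in }L^2(B)\text{ for all }t>0,\qquad p(0)=f.$$ It is given by $p(t)=\sum_j\omega_j(t)\psi_j$ in $L^2(B)$ for $t\ge0$, where each $\omega_j\in C[0,\infty)$ satisfies $\mathscr D_{(g)}\omega_j(t)=-\lambda_j\omega_j(t)$ for $t>0$ and $\omega_j(0)=\langle\psi_j,f\rangle$. Moreover: 1. $\|p(t)\|_{L^2(B)}\le\|f\|_{L^2(B)}$ and $\|p(t)\|_{D(A)}\le\|f\|_{D(A)}$ for $t\ge0$; 2. $\|\mathscr D_{(g)}p(t)\|_{L^2(B)}\le\|f\|_{D(A)}$ for $t>0$; 3. $p$ is infinitely differentiable on $(0,\infty)$, both as an $L^2(B)$-valued and as a $D(A)$-valued function, and for all $t>0$ and $m=0,1,2,\dots$ (with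 $0^0=1$) $$\|\partial_t^mp(t)\|_{L^2(B)}\le\Big(\frac m{et}\Big)^m\|f\|_{L^2(B)},\qquad\|\partial_t^mp(t)\|_{D(A)}\le\Big(\frac m{et}\Big)^m\|f\|_{D(A)};$$ 4. $\|p(t)-f\|_{D(A)}\to0$ as $t\to0^+$ and $\|p(t)\|_{D(A)}\to0$ as $t\to\infty$. -/

import Mathlib

open Set Filter Topology MeasureTheory
open scoped ContDiff NNReal

noncomputable section

namespace GenDiff

/-! ### The time kernel and the general Caputo-type derivative -/

/-- The Laplace transform `∫₀^∞ e^{-ts} g(t) dt`. -/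
def laplaceTransform (g : ℝ → ℝ) (s : ℝ) : ℝ :=
  ∫ t in Ioi (0 : ℝ), Real.exp (-(t * s)) * g t

/-- Stieltjes functions on `(0, ∞)`: `v(s) = a / s + b + ∫ 1 / (s + r) σ(dr)` with `a, b ≥ 0` and
a Borel measure `σ` on `[0, ∞)` such that `∫ 1 / (1 + r) σ(dr) < ∞`. -/
def IsStieltjes (v : ℝ → ℝ) : Prop :=
  ∃ (a b : ℝ) (σ : Measure ℝ≥0), 0 ≤ a ∧ 0 ≤ b ∧
    Integrable (fun r : ℝ≥0 => 1 / (1 + (r : ℝ))) σ ∧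
    ∀ s : ℝ, 0 < s → v s = a / s + b + ∫ r : ℝ≥0, 1 / (s + (r : ℝ)) ∂σ

/-- The standing conditions on the memory kernel `g`. Its Laplace transform determines `g` only
almost everywhere on `(0, ∞)`; `continuousOn` selects the continuous (in fact completely monotone)
representative. -/
structure IsMemoryKernel (g : ℝ → ℝ) : Prop where
  continuousOn : ContinuousOn g (Ioi 0)
  laplace_exists : ∀ s : ℝ, 0 < s →
    IntegrableOn (fun t => Real.exp (-(t * s)) * g t) (Ioi 0)
  stieltjes : IsStieltjes (laplaceTransform g)
  tendsto_atTop : Tendsto (laplaceTransform g) atTop (𝓝 0)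
  mul_tendsto_atTop : Tendsto (fun s => s * laplaceTransform g s) atTop atTop
  tendsto_zero : Tendsto (laplaceTransform g) (𝓝[>] 0) atTop
  mul_tendsto_zero : Tendsto (fun s => s * laplaceTransform g s) (𝓝[>] 0) (𝓝 0)

/-- The general Caputo-type derivative
`(D_g v)(t) = d/dt ∫₀ᵗ g(t - τ) v(τ) dτ - g(t) v(0)` exists at `t` and equals `w`. -/
def HasGenCaputoDeriv {F : Type*} [NormedAddCommGroup F] [NormedSpace ℝ F]
    (g : ℝ → ℝ) (v : ℝ → F) (w : F) (t : ℝ) : Prop :=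
  HasDerivAt (fun s => ∫ τ in (0 : ℝ)..s, g (s - τ) • v τ) (w + g t • v 0) t

/-! ### The domain and the jump kernel -/

/-- `B` has a smooth boundary: near each boundary point, `B` is the sublevel set of a smooth
function with nonvanishing differential at that point. -/
def HasSmoothBoundary {n : ℕ} (B : Set (EuclideanSpace ℝ (Fin n))) : Prop :=
  ∀ x₀ ∈ frontier B, ∃ U ∈ 𝓝 x₀, ∃ ρ : EuclideanSpace ℝ (Fin n) → ℝ,
    ContDiff ℝ ∞ ρ ∧ fderiv ℝ ρ x₀ ≠ 0 ∧ ∀ x ∈ U, (x ∈ B ↔ ρ x < 0)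

/-- Positive kernels with `min {|x|², 1} k(x) ∈ L¹(ℝⁿ)`. -/
structure IsJumpKernel {n : ℕ} (k : EuclideanSpace ℝ (Fin n) → ℝ) : Prop where
  pos : ∀ x, x ≠ 0 → 0 < k x
  integrable : Integrable (fun x => min (‖x‖ ^ 2) 1 * k x)

/-- With `H = sup {|x| : x ∈ B}`: there are `θ > 0` and `0 < β < 1` with
`k(x) ≥ θ |x|^{-(n + 2β)}` for all `x ∈ [-2H, 2H]ⁿ \ {0}`. -/
def LowerBound {n : ℕ} (B : Set (EuclideanSpace ℝ (Fin n)))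
    (k : EuclideanSpace ℝ (Fin n) → ℝ) : Prop :=
  ∃ θ β : ℝ, 0 < θ ∧ 0 < β ∧ β < 1 ∧
    ∀ x : EuclideanSpace ℝ (Fin n), x ≠ 0 →
      (∀ i, |x i| ≤ 2 * sSup ((fun y => ‖y‖) '' B)) →
        θ * ‖x‖ ^ (-((n : ℝ) + 2 * β)) ≤ k x

/-! ### The general Laplacian and its Friedrichs extension -/

/-- The general Laplacian `∫ (v(x + y) + v(x - y) - 2 v(x)) k(y) dy`. -/
def genLaplacian {n : ℕ} (k v : EuclideanSpace ℝ (Fin n) → ℝ)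
    (x : EuclideanSpace ℝ (Fin n)) : ℝ :=
  ∫ y, (v (x + y) + v (x - y) - 2 * v x) * k y

/-- The real Hilbert space `L²(B)`. -/
abbrev L2 {n : ℕ} (B : Set (EuclideanSpace ℝ (Fin n))) : Type :=
  Lp ℝ 2 (volume.restrict B)

/-- Extension by zero to `ℝⁿ`: this carries the exterior condition `u = 0` on `Bᶜ`. -/
def zeroExt {n : ℕ} (B : Set (EuclideanSpace ℝ (Fin n))) (u : L2 B) :
    EuclideanSpace ℝ (Fin n) → ℝ :=
  B.indicator (u : EuclideanSpace ℝ (Fin n) → ℝ)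

/-- The energy space `X₀(B)`: `u ∈ L²(B)`, extended by zero, such that
`(u(x) - u(y)) √k(x - y)` is in `L²(Q)`, `Q = (ℝⁿ × ℝⁿ) \ (Bᶜ × Bᶜ)`. -/
def MemX0 {n : ℕ} (B : Set (EuclideanSpace ℝ (Fin n)))
    (k : EuclideanSpace ℝ (Fin n) → ℝ) (u : L2 B) : Prop :=
  MemLp (fun z : EuclideanSpace ℝ (Fin n) × EuclideanSpace ℝ (Fin n) =>
      (zeroExt B u z.1 - zeroExt B u z.2) * √(k (z.1 - z.2))) 2
    ((volume.prod volume).restrict (Bᶜ ×ˢ Bᶜ)ᶜ)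

/-- The energy form `∫∫ (u(x) - u(y)) (v(x) - v(y)) k(x - y) dx dy` over `ℝⁿ × ℝⁿ`. -/
def energyForm {n : ℕ} (B : Set (EuclideanSpace ℝ (Fin n)))
    (k : EuclideanSpace ℝ (Fin n) → ℝ) (u v : L2 B) : ℝ :=
  ∫ z : EuclideanSpace ℝ (Fin n) × EuclideanSpace ℝ (Fin n),
    (zeroExt B u z.1 - zeroExt B u z.2) * (zeroExt B v z.1 - zeroExt B v z.2) * k (z.1 - z.2)
    ∂(volume.prod volume)

/-- The graph of the Friedrichs extension `A` of minus the general Laplacian: `u ∈ D(A)` and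
`A u = w`, that is, `u ∈ X₀(B)`, `w ∈ L²(B)` and `energyForm u v = ∫_B w v` for all `v ∈ X₀(B)`. -/
def FriedrichsGraph {n : ℕ} (B : Set (EuclideanSpace ℝ (Fin n)))
    (k : EuclideanSpace ℝ (Fin n) → ℝ) (u w : L2 B) : Prop :=
  MemX0 B k u ∧ ∀ v : L2 B, MemX0 B k v → energyForm B k u v = inner ℝ w v

/-- The domain `D(A)` of the Friedrichs extension. -/
def friedrichsDomain {n : ℕ} (B : Set (EuclideanSpace ℝ (Fin n)))
    (k : EuclideanSpace ℝ (Fin n) → ℝ) : Set (L2 B) :=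
  {u | ∃ w, FriedrichsGraph B k u w}

/-- A complete orthonormal system of eigenfunctions `A ψ_j = λ_j ψ_j` with
`0 < λ_0 ≤ λ_1 ≤ ⋯ → ∞`. -/
structure IsEigensystem {n : ℕ} (B : Set (EuclideanSpace ℝ (Fin n)))
    (k : EuclideanSpace ℝ (Fin n) → ℝ) (ψ : HilbertBasis ℕ ℝ (L2 B)) (ev : ℕ → ℝ) : Prop where
  eigen : ∀ j, FriedrichsGraph B k (ψ j) (ev j • ψ j)
  pos : ∀ j, 0 < ev j
  mono : Monotone ev
  tendsto : Tendsto ev atTop atTop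

/-- The norm `(∑ |λ_j ⟨ψ_j, u⟩|²)^{1/2}` of `D(A)`. -/
def domNorm {n : ℕ} {B : Set (EuclideanSpace ℝ (Fin n))}
    (ψ : HilbertBasis ℕ ℝ (L2 B)) (ev : ℕ → ℝ) (u : L2 B) : ℝ :=
  √(∑' j, (ev j * inner ℝ (ψ j) u) ^ 2)

/-- `p` restricted to `[0, ∞)` is in `C([0, ∞); D(A))` and solves `D_g p(t) = -A p(t)` for `t > 0`,
`p(0) = f`. -/
structure IsSolution {n : ℕ} (B : Set (EuclideanSpace ℝ (Fin n)))
    (k : EuclideanSpace ℝ (Fin n) → ℝ) (g : ℝ → ℝ) (ψ : HilbertBasis ℕ ℝ (L2 B)) (ev : ℕ → ℝ)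
    (f : L2 B) (p : ℝ → L2 B) : Prop where
  mem : ∀ t, 0 ≤ t → p t ∈ friedrichsDomain B k
  cont : ∀ t₀, 0 ≤ t₀ → Tendsto (fun t => domNorm ψ ev (p t - p t₀)) (𝓝[Ici 0] t₀) (𝓝 0)
  eqn : ∀ t, 0 < t → ∃ w, FriedrichsGraph B k (p t) w ∧ HasGenCaputoDeriv g p (-w) t
  init : p 0 = f

end GenDiff

end

section SpectralTheory

namespace GenDiff

variable {H K : Type*} [NormedAddCommGroup H] [InnerProductSpace ℝ H]
  [NormedAddCommGroup K] [InnerProductSpace ℝ K] {X : Submodule ℝ H}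

/-- The quadratic form `u ↦ ‖J u‖²` with form domain `X` is lower semicontinuous on `H`. -/
def IsClosedForm (J : X →ₗ[ℝ] K) : Prop :=
  ∀ (u : ℕ → X) (x : H) (C : ℝ), Tendsto (fun n => (u n : H)) atTop (𝓝 x) →
    (∀ n, ‖J (u n)‖ ≤ C) → ∃ hx : x ∈ X, ‖J ⟨x, hx⟩‖ ≤ C

/-- Up to finitely many functionals, the norm is dominated by small multiples of the form. -/
def IsCompactForm (J : X →ₗ[ℝ] K) : Prop :=
  ∀ η : ℝ, 0 < η → ∃ (N : ℕ) (l : Fin N → H →L[ℝ] ℝ),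
    ∀ u : X, ‖(u : H)‖ ^ 2 ≤ η * ‖J u‖ ^ 2 + ∑ i, (l i u) ^ 2

theorem IsCompactForm.totallyBounded {J : X →ₗ[ℝ] K} (hJ : IsCompactForm J) (C : ℝ) :
    TotallyBounded {x : H | ∃ u : X, (u : H) = x ∧ ‖(u : H)‖ ≤ 1 ∧ ‖J u‖ ≤ C} := by
  apply Metric.totallyBounded_of_finite_discretization
  intro ε hε
  obtain ⟨N, l, hl⟩ := hJ (ε ^ 2 / (2 * (4 * C ^ 2 + 1))) (by positivity)
  set L : H →L[ℝ] (Fin N → ℝ) := ContinuousLinearMap.pi l with hL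
  have hb : TotallyBounded (L '' Metric.closedBall 0 1) := by
    have h : Bornology.IsBounded (L '' Metric.closedBall 0 1) :=
      L.lipschitz.isBounded_image Metric.isBounded_closedBall
    exact h.isCompact_closure.totallyBounded.subset subset_closure
  set δ : ℝ := ε / (2 * (2 * (N + 1))) with hδ
  have hδpos : 0 < δ := by positivity
  obtain ⟨t, htfin, ht⟩ := Metric.totallyBounded_iff.1 hb δ hδpos
  have hch : ∀ x : {x : H | ∃ u : X, (u : H) = x ∧ ‖(u : H)‖ ≤ 1 ∧ ‖J u‖ ≤ C},
      ∃ c : t, dist (L x) c < δ := by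
    rintro ⟨x, u, rfl, hu, hu'⟩
    have := ht (mem_image_of_mem L (show (u : H) ∈ Metric.closedBall 0 1 by simpa using hu))
    simp only [mem_iUnion, Metric.mem_ball] at this
    obtain ⟨c, hc, hc'⟩ := this
    exact ⟨⟨c, hc⟩, hc'⟩
  choose F hF using hch
  have := htfin.fintype
  refine ⟨ULift t, inferInstance, fun x => ⟨F x⟩, ?_⟩
  rintro ⟨x, u, rfl, hu, hu'⟩ ⟨y, v, rfl, hv, hv'⟩ hxy
  replace hxy : F ⟨u, u, rfl, hu, hu'⟩ = F ⟨v, v, rfl, hv, hv'⟩ := congrArg ULift.down hxy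
  have h1 := hF ⟨u, u, rfl, hu, hu'⟩
  have h2 := hF ⟨v, v, rfl, hv, hv'⟩
  rw [← hxy] at h2
  have h3 : dist (L u) (L v) < 2 * δ := by
    have := dist_triangle_right (L u) (L v) (F ⟨u, u, rfl, hu, hu'⟩ : Fin N → ℝ)
    simp only at h1 h2
    linarith
  have h4 : ∀ i, (l i ((u - v : X) : H)) ^ 2 ≤ (2 * δ) ^ 2 := by
    intro i
    have := (dist_le_pi_dist (L u) (L v) i).trans h3.le
    rw [Real.dist_eq] at this
    rw [sq_le_sq, abs_of_pos (by positivity : 0 < 2 * δ)]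
    simpa [hL] using this
  have h5 := hl (u - v)
  have h6 : ‖J (u - v)‖ ^ 2 ≤ 4 * C ^ 2 := by
    have : ‖J (u - v)‖ ≤ 2 * C := by
      rw [map_sub]; linarith [norm_sub_le (J u) (J v)]
    nlinarith [norm_nonneg (J (u - v))]
  have h7 : ∑ i, (l i ((u - v : X) : H)) ^ 2 ≤ ε ^ 2 / 4 := by
    calc _ ≤ ∑ _i : Fin N, (2 * δ) ^ 2 := Finset.sum_le_sum fun i _ => h4 i
      _ = N * (2 * δ) ^ 2 := by simp
      _ = ε ^ 2 / 4 * (N / (N + 1) ^ 2) := by rw [hδ]; field_simp; norm_num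
      _ ≤ ε ^ 2 / 4 * 1 := by
        gcongr
        rw [div_le_one (by positivity)]
        nlinarith [(Nat.cast_nonneg N : (0 : ℝ) ≤ N)]
      _ = _ := mul_one _
  have h8 : ε ^ 2 / (2 * (4 * C ^ 2 + 1)) * ‖J (u - v)‖ ^ 2 ≤ ε ^ 2 / 2 := by
    calc _ ≤ ε ^ 2 / (2 * (4 * C ^ 2 + 1)) * (4 * C ^ 2 + 1) := by gcongr; linarith
      _ = ε ^ 2 / 2 := by field_simp
  have h9 : ‖((u - v : X) : H)‖ ^ 2 < ε ^ 2 := by nlinarith [pow_pos hε 2]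
  have := lt_of_pow_lt_pow_left₀ 2 hε.le h9
  simpa [Subtype.dist_eq, dist_eq_norm] using this

theorem IsCompactForm.exists_subseq [CompleteSpace H] {J : X →ₗ[ℝ] K} (hJ : IsCompactForm J)
    {C : ℝ} {u : ℕ → X} (hu : ∀ n, ‖(u n : H)‖ ≤ 1) (hu' : ∀ n, ‖J (u n)‖ ≤ C) :
    ∃ (x : H) (φ : ℕ → ℕ), StrictMono φ ∧ Tendsto (fun n => (u (φ n) : H)) atTop (𝓝 x) := by
  have hc : IsCompact (closure {x : H | ∃ u : X, (u : H) = x ∧ ‖(u : H)‖ ≤ 1 ∧ ‖J u‖ ≤ C}) :=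
    (hJ.totallyBounded C).closure.isCompact_of_isClosed isClosed_closure
  obtain ⟨x, -, φ, hφ, h⟩ := hc.tendsto_subseq (x := fun n => (u n : H))
    (fun n => subset_closure ⟨u n, rfl, hu n, hu' n⟩)
  exact ⟨x, φ, hφ, h⟩

theorem exists_ne_zero_orthogonal (hX : Dense (X : Set H)) (hH : ¬ FiniteDimensional ℝ H)
    (S : Finset H) : ∃ v : X, v ≠ 0 ∧ ∀ s ∈ S, inner ℝ s (v : H) = 0 := by
  by_contra! hcon
  let T : X →ₗ[ℝ] (S → ℝ) := LinearMap.pi fun s => (innerₛₗ ℝ (s : H)).comp X.subtype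
  have hT : Function.Injective T := by
    rw [← LinearMap.ker_eq_bot, LinearMap.ker_eq_bot']
    intro v hv
    by_contra hne
    obtain ⟨s, hs, h⟩ := hcon v hne
    exact h (by simpa [T] using congrFun hv ⟨s, hs⟩)
  have : FiniteDimensional ℝ X := FiniteDimensional.of_injective T hT
  have hcl : IsClosed (X : Set H) := X.closed_of_finiteDimensional
  have htop : X = ⊤ := by
    rw [← SetLike.coe_set_eq, Submodule.top_coe, ← hcl.closure_eq, hX.closure_eq]
  subst htop
  exact hH (Module.Finite.equiv (Submodule.topEquiv (R := ℝ) (M := H)))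

/-- The Rayleigh quotient attains its minimum on the orthogonal complement of a finite set. -/
theorem exists_minimizer [CompleteSpace H] {J : X →ₗ[ℝ] K} (hcl : IsClosedForm J)
    (hcp : IsCompactForm J) (hX : Dense (X : Set H)) (hH : ¬ FiniteDimensional ℝ H)
    (S : Finset H) : ∃ u : X, ‖(u : H)‖ = 1 ∧ (∀ s ∈ S, inner ℝ s (u : H) = 0) ∧
      ∀ v : X, (∀ s ∈ S, inner ℝ s (v : H) = 0) →
        ‖J u‖ ^ 2 * ‖(v : H)‖ ^ 2 ≤ ‖J v‖ ^ 2 := by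
  set A : Set ℝ := {r | ∃ v : X, ‖(v : H)‖ = 1 ∧ (∀ s ∈ S, inner ℝ s (v : H) = 0) ∧ ‖J v‖ ^ 2 = r}
    with hA
  have hscale : ∀ v : X, v ≠ 0 → (∀ s ∈ S, inner ℝ s (v : H) = 0) →
      ‖J v‖ ^ 2 / ‖(v : H)‖ ^ 2 ∈ A := by
    intro v hv hvS
    have hv0 : ‖(v : H)‖ ≠ 0 := by simpa using hv
    refine ⟨‖(v : H)‖⁻¹ • v, ?_, ?_, ?_⟩
    · rw [Submodule.coe_smul, norm_smul, norm_inv, norm_norm, inv_mul_cancel₀ hv0]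
    · intro s hs
      rw [Submodule.coe_smul, inner_smul_right, hvS s hs, mul_zero]
    · rw [map_smul, norm_smul, norm_inv, norm_norm]
      field_simp
  have hne : A.Nonempty := by
    obtain ⟨v, hv, hvS⟩ := exists_ne_zero_orthogonal hX hH S
    exact ⟨_, hscale v hv hvS⟩
  have hbdd : BddBelow A := ⟨0, by rintro r ⟨v, -, -, rfl⟩; positivity⟩
  obtain ⟨r, hr, hlim, hmem⟩ := exists_seq_tendsto_sInf hne hbdd
  choose v hv1 hvS hvr using hmem
  have hanti : ∀ {m n}, m ≤ n → ‖J (v n)‖ ≤ ‖J (v m)‖ := by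
    intro m n hmn
    have := hr hmn
    rw [← hvr, ← hvr] at this
    exact le_of_sq_le_sq this (norm_nonneg _)
  obtain ⟨x, φ, hφ, hx⟩ := hcp.exists_subseq (C := ‖J (v 0)‖) (fun n => (hv1 n).le)
    (fun n => hanti (Nat.zero_le n))
  have hxm : ∀ m, ∃ hx : x ∈ X, ‖J ⟨x, hx⟩‖ ≤ ‖J (v m)‖ := by
    intro m
    exact hcl (fun n => v (φ (n + m))) x _ (hx.comp (tendsto_add_atTop_nat m))
      fun n => hanti ((Nat.le_add_left m n).trans (hφ.id_le _))
  obtain ⟨hxX, -⟩ := hxm 0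
  refine ⟨⟨x, hxX⟩, ?_, ?_, ?_⟩
  · have h1 := hx.norm
    simp only [hv1] at h1
    exact tendsto_nhds_unique h1 tendsto_const_nhds |>.symm ▸ rfl
  · intro s hs
    have h1 : Tendsto (fun n => inner ℝ s (v (φ n) : H)) atTop (𝓝 (inner ℝ s x)) :=
      tendsto_const_nhds.inner hx
    simp only [hvS _ s hs] at h1
    exact tendsto_nhds_unique h1 tendsto_const_nhds
  · intro w hwS
    by_cases hw : w = 0
    · simp [hw]
    have h1 : ‖J ⟨x, hxX⟩‖ ^ 2 ≤ sInf A := by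
      refine ge_of_tendsto' hlim fun m => ?_
      rw [← hvr]
      gcongr
      exact (hxm m).2
    have h2 := h1.trans (csInf_le hbdd (hscale w hw hwS))
    have : 0 < ‖(w : H)‖ ^ 2 := by
      have : ‖(w : H)‖ ≠ 0 := by simpa using hw
      positivity
    rwa [le_div_iff₀ this] at h2

/-- The Euler-Lagrange equation for a minimizer of the Rayleigh quotient. -/
theorem inner_eq_of_minimizer {J : X →ₗ[ℝ] K} {u : X} (hu : ‖(u : H)‖ = 1) {v : X}
    (h : ∀ t : ℝ, ‖J u‖ ^ 2 * ‖((u + t • v : X) : H)‖ ^ 2 ≤ ‖J (u + t • v)‖ ^ 2) :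
    inner ℝ (J u) (J v) = ‖J u‖ ^ 2 * inner ℝ (u : H) v := by
  set b : ℝ := inner ℝ (J u) (J v) - ‖J u‖ ^ 2 * inner ℝ (u : H) v with hb
  set c : ℝ := ‖J v‖ ^ 2 - ‖J u‖ ^ 2 * ‖(v : H)‖ ^ 2 with hc
  have key : ∀ t : ℝ, 0 ≤ 2 * t * b + t ^ 2 * c := by
    intro t
    have h1 := h t
    rw [map_add, map_smul, Submodule.coe_add, Submodule.coe_smul, norm_add_sq_real,
      norm_add_sq_real, hu, inner_smul_right, inner_smul_right, norm_smul, norm_smul, mul_pow,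
      mul_pow, Real.norm_eq_abs, sq_abs] at h1
    rw [hb, hc]
    linarith
  have hb0 : b = 0 := by
    by_contra hne
    have h1 := key (-b / (|c| + 1))
    have hpos : 0 < |c| + 1 := by positivity
    have h2 : 2 * (-b / (|c| + 1)) * b + (-b / (|c| + 1)) ^ 2 * c
        = b ^ 2 / (|c| + 1) ^ 2 * (c - 2 * (|c| + 1)) := by
      field_simp; ring
    rw [h2] at h1
    have h3 : 0 < b ^ 2 / (|c| + 1) ^ 2 := by positivity
    nlinarith [le_abs_self c, abs_nonneg c]
  linarith

/-- A sequence of minimizers of the Rayleigh quotient on successive orthogonal complements. -/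
theorem exists_minimizer_seq [CompleteSpace H] {J : X →ₗ[ℝ] K} (hcl : IsClosedForm J)
    (hcp : IsCompactForm J) (hX : Dense (X : Set H)) (hH : ¬ FiniteDimensional ℝ H) :
    ∃ u : ℕ → X, ∀ n, ‖(u n : H)‖ = 1 ∧ (∀ i < n, inner ℝ (u i : H) (u n : H) = 0) ∧
      ∀ v : X, (∀ i < n, inner ℝ (u i : H) (v : H) = 0) →
        ‖J (u n)‖ ^ 2 * ‖(v : H)‖ ^ 2 ≤ ‖J v‖ ^ 2 := by
  classical
  choose ψ h1 h2 h3 using exists_minimizer hcl hcp hX hH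
  let S : ℕ → Finset H := fun n => Nat.rec ∅ (fun _ s => insert (ψ s : H) s) n
  have hS : ∀ n x, x ∈ S n ↔ ∃ i < n, x = (ψ (S i) : H) := by
    intro n x
    induction n with
    | zero => simp [S]
    | succ n ih =>
      change x ∈ insert (ψ (S n) : H) (S n) ↔ _
      rw [Finset.mem_insert, ih]
      constructor
      · rintro (rfl | ⟨i, hi, rfl⟩)
        · exact ⟨n, n.lt_succ_self, rfl⟩
        · exact ⟨i, hi.trans n.lt_succ_self, rfl⟩
      · rintro ⟨i, hi, rfl⟩
        rcases Nat.lt_succ_iff_lt_or_eq.1 hi with h | rfl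
        · exact Or.inr ⟨i, h, rfl⟩
        · exact Or.inl rfl
  refine ⟨fun n => ψ (S n), fun n => ⟨h1 _, fun i hi => h2 _ _ ((hS _ _).2 ⟨i, hi, rfl⟩), ?_⟩⟩
  intro v hv
  refine h3 _ v fun s hs => ?_
  obtain ⟨i, hi, rfl⟩ := (hS _ _).1 hs
  exact hv i hi

/-- Spectral theorem for closed positive forms with compact form domain. -/
theorem exists_hilbertBasis_eigen [CompleteSpace H] {J : X →ₗ[ℝ] K} (hcl : IsClosedForm J)
    (hcp : IsCompactForm J) (hX : Dense (X : Set H)) (hH : ¬ FiniteDimensional ℝ H)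
    (hinj : ∀ u : X, J u = 0 → u = 0) :
    ∃ (ψ : HilbertBasis ℕ ℝ H) (ev : ℕ → ℝ), (∀ j, ∃ hj : ψ j ∈ X,
        ∀ v : X, inner ℝ (J ⟨ψ j, hj⟩) (J v) = ev j * inner ℝ (ψ j) (v : H)) ∧
      (∀ j, 0 < ev j) ∧ Monotone ev ∧ Tendsto ev atTop atTop := by
  obtain ⟨u, hu⟩ := exists_minimizer_seq hcl hcp hX hH
  have hon : Orthonormal ℝ (fun n => (u n : H)) := by
    refine ⟨fun n => (hu n).1, fun i j hij => ?_⟩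
    rcases lt_or_gt_of_ne hij with h | h
    · exact (hu j).2.1 i h
    · rw [real_inner_comm]; exact (hu i).2.1 j h
  set ev : ℕ → ℝ := fun n => ‖J (u n)‖ ^ 2 with hev
  -- the projection onto the complement of the first eigenvectors
  let Q : ℕ → X → X := fun n v => v - ∑ i ∈ Finset.range n, (inner ℝ (u i : H) (v : H)) • u i
  have hQorth : ∀ n v i, i < n → inner ℝ (u i : H) (Q n v : H) = 0 := by
    intro n v i hi
    simp only [Q, Submodule.coe_sub, inner_sub_right, Submodule.coe_sum, Submodule.coe_smul]
    rw [hon.inner_right_sum _ (Finset.mem_range.2 hi), sub_self]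
  have hEL : ∀ n, ∀ v : X, inner ℝ (J (u n)) (J v) = ev n * inner ℝ (u n : H) (v : H) := by
    intro n
    induction n using Nat.strong_induction_on with
    | _ n ih =>
    intro v
    have h1 : inner ℝ (J (u n)) (J (Q n v)) = ev n * inner ℝ (u n : H) (Q n v : H) := by
      refine inner_eq_of_minimizer (hu n).1 fun t => (hu n).2.2 _ fun i hi => ?_
      rw [Submodule.coe_add, Submodule.coe_smul, inner_add_right, inner_smul_right,
        hQorth n v i hi, (hu n).2.1 i hi, mul_zero, add_zero]
    simp only [Q, map_sub, map_sum, map_smul, Submodule.coe_sub, Submodule.coe_sum,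
      Submodule.coe_smul, inner_sub_right, inner_sum, inner_smul_right] at h1
    rw [Finset.sum_eq_zero, Finset.sum_eq_zero, sub_zero, sub_zero] at h1
    · exact h1
    · intro i hi
      rw [real_inner_comm (u i : H) (u n : H), (hu n).2.1 i (Finset.mem_range.1 hi), mul_zero]
    · intro i hi
      rw [real_inner_comm (J (u i)), ih i (Finset.mem_range.1 hi), (hu n).2.1 i (Finset.mem_range.1 hi),
        mul_zero, mul_zero]
  have hmono : Monotone ev := by
    refine monotone_nat_of_le_succ fun n => ?_
    have := (hu n).2.2 (u (n + 1)) fun i hi => (hu (n + 1)).2.1 i (hi.trans n.lt_succ_self)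
    rwa [(hu (n + 1)).1, one_pow, mul_one] at this
  have htend : Tendsto ev atTop atTop := by
    refine tendsto_atTop_atTop_of_monotone hmono fun b => ?_
    by_contra! hb
    obtain ⟨x, φ, hφ, hx⟩ := hcp.exists_subseq (u := u) (C := √b) (fun n => (hu n).1.le)
      (fun n => Real.le_sqrt_of_sq_le (hb n).le)
    have h1 : Tendsto (fun n => ‖(u (φ n) : H) - u (φ (n + 1))‖ ^ 2) atTop (𝓝 (‖x - x‖ ^ 2)) :=
      ((hx.sub (hx.comp (tendsto_add_atTop_nat 1))).norm).pow 2
    have h2 : ∀ n, ‖(u (φ n) : H) - u (φ (n + 1))‖ ^ 2 = 2 := by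
      intro n
      rw [norm_sub_sq_real, (hu _).1, (hu _).1, hon.2 (hφ n.lt_succ_self).ne]
      norm_num
    simp only [h2, sub_self, norm_zero] at h1
    have := tendsto_nhds_unique h1 tendsto_const_nhds
    norm_num at this
  have hpos : ∀ j, 0 < ev j := by
    intro j
    have : J (u j) ≠ 0 := fun h => by
      have h0 := hinj _ h
      have := (hu j).1
      simp [h0] at this
    have := norm_pos_iff.2 this
    simp only [hev]
    positivity
  have hsp : ⊤ ≤ (Submodule.span ℝ (range fun n => (u n : H))).topologicalClosure := by
    have hXle : (X : Set H) ⊆ closure (Submodule.span ℝ (range fun n => (u n : H)) : Set H) := by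
      intro v hv
      refine mem_closure_of_tendsto (b := atTop)
        (f := fun n => ((v : H) - (Q n ⟨v, hv⟩ : H))) ?_ (Eventually.of_forall fun n => ?_)
      · rw [show 𝓝 v = 𝓝 (v - 0) by rw [sub_zero]]
        refine tendsto_const_nhds.sub ?_
        rw [tendsto_zero_iff_norm_tendsto_zero]
        have hb : ∀ n, ‖(Q n ⟨v, hv⟩ : H)‖ ^ 2 ≤ ‖J ⟨v, hv⟩‖ ^ 2 / ev n := by
          intro n
          rw [le_div_iff₀ (hpos n), mul_comm]
          refine ((hu n).2.2 _ (hQorth n _)).trans ?_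
          have hsplit : J ⟨v, hv⟩ = J (Q n ⟨v, hv⟩)
              + ∑ i ∈ Finset.range n, (inner ℝ (u i : H) v) • J (u i) := by
            simp [Q, map_sub, map_sum, map_smul]
          have horth : inner ℝ (J (Q n ⟨v, hv⟩))
              (∑ i ∈ Finset.range n, (inner ℝ (u i : H) v) • J (u i)) = 0 := by
            rw [inner_sum]
            refine Finset.sum_eq_zero fun i hi => ?_
            rw [inner_smul_right, real_inner_comm (J (u i)), hEL, hQorth n _ i (Finset.mem_range.1 hi),
              mul_zero, mul_zero]
          rw [hsplit, norm_add_sq_real, horth]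
          nlinarith [sq_nonneg ‖∑ i ∈ Finset.range n, (inner ℝ (u i : H) v) • J (u i)‖]
        have h0 : Tendsto (fun n => √(‖J ⟨v, hv⟩‖ ^ 2 / ev n)) atTop (𝓝 0) := by
          rw [← Real.sqrt_zero]
          exact (htend.const_div_atTop _).sqrt
        exact squeeze_zero (fun n => norm_nonneg _) (fun n => Real.le_sqrt_of_sq_le (hb n)) h0
      · simp only [Q, Submodule.coe_sub, Submodule.coe_sum, Submodule.coe_smul, sub_sub_cancel]
        exact Submodule.sum_mem _ fun i _ =>
          Submodule.smul_mem _ _ (Submodule.subset_span ⟨i, rfl⟩)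
    intro x _
    have h1 : x ∈ closure (X : Set H) := hX x
    exact closure_minimal hXle isClosed_closure h1
  refine ⟨HilbertBasis.mk hon hsp, ev, fun j => ?_, hpos, hmono, htend⟩
  simp only [HilbertBasis.coe_mk]
  exact ⟨(u j).2, hEL j⟩

end GenDiff
end SpectralTheory

section SpectralDomain

namespace GenDiff

variable {H K : Type*} [NormedAddCommGroup H] [InnerProductSpace ℝ H]
  [NormedAddCommGroup K] [InnerProductSpace ℝ K] {X : Submodule ℝ H}

theorem hasSum_inner_sq (ψ : HilbertBasis ℕ ℝ H) (u : H) :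
    HasSum (fun j => (inner ℝ (ψ j) u) ^ 2) (‖u‖ ^ 2) := by
  have h := ψ.hasSum_inner_mul_inner u u
  rw [real_inner_self_eq_norm_sq] at h
  simpa only [real_inner_comm, ← sq] using h

theorem exists_of_summable_coeff [CompleteSpace H] (ψ : HilbertBasis ℕ ℝ H) {c : ℕ → ℝ}
    (hc : Summable fun j => c j ^ 2) : ∃ w : H, ∀ j, inner ℝ (ψ j) w = c j := by
  have hm : Memℓp c 2 := by
    refine memℓp_gen ?_
    simpa using hc
  refine ⟨ψ.repr.symm ⟨c, hm⟩, fun j => ?_⟩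
  rw [← ψ.repr_apply_apply, LinearIsometryEquiv.apply_symm_apply]

theorem coeff_of_form_eq {J : X →ₗ[ℝ] K} {ψ : HilbertBasis ℕ ℝ H} {ev : ℕ → ℝ}
    (hψ : ∀ j, ∃ hj : ψ j ∈ X, ∀ v : X, inner ℝ (J ⟨ψ j, hj⟩) (J v) = ev j * inner ℝ (ψ j) (v : H))
    {u : X} {w : H} (h : ∀ v : X, inner ℝ (J u) (J v) = inner ℝ w (v : H)) (j : ℕ) :
    inner ℝ (ψ j) w = ev j * inner ℝ (ψ j) (u : H) := by
  obtain ⟨hj, hj'⟩ := hψ j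
  exact (real_inner_comm _ _).trans
    ((h ⟨ψ j, hj⟩).symm.trans ((real_inner_comm _ _).trans (hj' u)))

theorem form_eq_of_summable [CompleteSpace H] {J : X →ₗ[ℝ] K} (hcl : IsClosedForm J)
    {ψ : HilbertBasis ℕ ℝ H} {ev : ℕ → ℝ} (hpos : ∀ j, 0 < ev j)
    (hψ : ∀ j, ∃ hj : ψ j ∈ X, ∀ v : X, inner ℝ (J ⟨ψ j, hj⟩) (J v) = ev j * inner ℝ (ψ j) (v : H))
    {u w : H} (hw : ∀ j, inner ℝ (ψ j) w = ev j * inner ℝ (ψ j) u) :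
    ∃ hu : u ∈ X, ∀ v : X, inner ℝ (J ⟨u, hu⟩) (J v) = inner ℝ w (v : H) := by
  choose hψX hψJ using hψ
  set a : ℕ → ℝ := fun j => inner ℝ (ψ j) u with ha
  have hsum : Summable fun j => ev j * a j ^ 2 := by
    refine Summable.of_nonneg_of_le (fun j => mul_nonneg (hpos j).le (sq_nonneg _)) (fun j => ?_)
      ((hasSum_inner_sq ψ u).summable.add (hasSum_inner_sq ψ w).summable)
    rw [hw]
    nlinarith [sq_nonneg (a j), sq_nonneg ((ev j - 1) * a j), hpos j, sq_nonneg (ev j * a j)]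
  let U : Finset ℕ → X := fun s => ∑ i ∈ s, a i • (⟨ψ i, hψX i⟩ : X)
  have hUJ : ∀ s (v : X), inner ℝ (J (U s)) (J v) = ∑ i ∈ s, a i * ev i * inner ℝ (ψ i) (v : H) := by
    intro s v
    simp only [U, map_sum, map_smul, sum_inner, inner_smul_left, hψJ]
    exact Finset.sum_congr rfl fun i _ => by simp [mul_assoc]
  have hUnorm : ∀ s, ‖J (U s)‖ ^ 2 = ∑ i ∈ s, ev i * a i ^ 2 := by
    intro s
    rw [← real_inner_self_eq_norm_sq, hUJ]
    refine Finset.sum_congr rfl fun i hi => ?_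
    simp only [U, Submodule.coe_sum, Submodule.coe_smul]
    rw [ψ.orthonormal.inner_right_sum _ hi]
    ring
  have hUlim : Tendsto (fun N => (U (Finset.range N) : H)) atTop (𝓝 u) := by
    have := (ψ.hasSum_repr u).tendsto_sum_nat
    simpa [U, ha, ψ.repr_apply_apply] using this
  set T : ℕ → ℝ := fun N => ∑' j, ev (j + N) * a (j + N) ^ 2 with hT
  have hT0 : Tendsto (fun N => √(T N)) atTop (𝓝 0) := by
    rw [← Real.sqrt_zero]
    exact (tendsto_sum_nat_add fun j => ev j * a j ^ 2).sqrt
  have hdiff : ∀ N, ∃ hx : u - U (Finset.range N) ∈ X,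
      ‖J ⟨u - U (Finset.range N), hx⟩‖ ≤ √(T N) := by
    intro N
    refine hcl (fun M => U (Finset.range (M + N)) - U (Finset.range N)) _ _ ?_ fun M => ?_
    · simp only [Submodule.coe_sub]
      exact (hUlim.comp (tendsto_add_atTop_nat N)).sub_const _
    · have : U (Finset.range (M + N)) - U (Finset.range N)
          = U (Finset.Ico N (M + N)) := by
        simp only [U]
        rw [Finset.sum_Ico_eq_sub _ (Nat.le_add_left N M)]
      rw [this]
      refine Real.le_sqrt_of_sq_le ?_
      rw [hUnorm, Finset.sum_Ico_eq_sum_range, Nat.add_sub_cancel]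
      simp only [add_comm N]
      exact ((summable_nat_add_iff N).2 hsum).sum_le_tsum _
        fun j _ => mul_nonneg (hpos _).le (sq_nonneg _)
  have huX : u ∈ X := by
    obtain ⟨hx, -⟩ := hdiff 0
    simpa using X.add_mem hx (U (Finset.range 0)).2
  refine ⟨huX, fun v => ?_⟩
  have h1 : Tendsto (fun N => inner ℝ (J (U (Finset.range N))) (J v)) atTop
      (𝓝 (inner ℝ (J ⟨u, huX⟩) (J v))) := by
    refine Tendsto.inner ?_ tendsto_const_nhds
    rw [tendsto_iff_norm_sub_tendsto_zero]
    refine squeeze_zero (fun _ => norm_nonneg _) (fun N => ?_) hT0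
    rw [norm_sub_rev, ← map_sub]
    exact (hdiff N).2
  have h2 : Tendsto (fun N => inner ℝ (J (U (Finset.range N))) (J v)) atTop
      (𝓝 (inner ℝ w (v : H))) := by
    have := (ψ.hasSum_inner_mul_inner w (v : H)).tendsto_sum_nat
    refine this.congr fun N => ?_
    rw [hUJ]
    refine Finset.sum_congr rfl fun i _ => ?_
    rw [real_inner_comm, hw]
    ring
  exact tendsto_nhds_unique h1 h2

end GenDiff
end SpectralDomain

section Laplace

namespace GenDiff

/-- A function that is continuous on `(0, ∞)` is determined by its Laplace transform. -/
theorem eq_zero_of_laplace_eq_zero {f : ℝ → ℝ} (hf : ContinuousOn f (Ioi 0))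
    (hint : ∀ s : ℝ, 0 < s → IntegrableOn (fun t => Real.exp (-(t * s)) * f t) (Ioi 0))
    (h0 : ∀ s : ℝ, 0 < s → laplaceTransform f s = 0) : ∀ t, 0 < t → f t = 0 := by
  set h : ℝ → ℝ := fun t => Real.exp (-(t * 1)) * f t with hh
  have hhint : IntegrableOn h (Ioi 0) := hint 1 one_pos
  -- integrals against polynomials in `e^{-t}` vanish
  have hpoly : ∀ P : Polynomial ℝ,
      IntegrableOn (fun t => P.eval (Real.exp (-t)) * h t) (Ioi 0) ∧
        ∫ t in Ioi 0, P.eval (Real.exp (-t)) * h t = 0 := by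
    intro P
    induction P using Polynomial.induction_on' with
    | add p q hp hq =>
      simp only [Polynomial.eval_add, add_mul]
      exact ⟨hp.1.add hq.1, by rw [integral_add hp.1 hq.1, hp.2, hq.2, add_zero]⟩
    | monomial n a =>
      have hn : (0 : ℝ) < n + 1 := by positivity
      have : (fun t => (Polynomial.monomial n a).eval (Real.exp (-t)) * h t)
          = fun t => a * (Real.exp (-(t * (n + 1))) * f t) := by
        ext t
        rw [Polynomial.eval_monomial, hh, ← Real.exp_nat_mul]
        have : Real.exp (-(t * (n + 1))) = Real.exp (n * -t) * Real.exp (-(t * 1)) := by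
          rw [← Real.exp_add]; ring_nf
        rw [this]; ring
      rw [this]
      refine ⟨(hint _ hn).const_mul a, ?_⟩
      have h1 := h0 _ hn
      rw [laplaceTransform] at h1
      rw [integral_const_mul, h1, mul_zero]
  have hcont : ∀ φ : ℝ → ℝ, ContinuousOn φ (Icc 0 1) →
      ∫ t in Ioi 0, φ (Real.exp (-t)) * h t = 0 := by
    intro φ hφ
    have hexp : ∀ t ∈ Ioi (0 : ℝ), Real.exp (-t) ∈ Icc (0 : ℝ) 1 := fun t ht =>
      ⟨(Real.exp_pos _).le, Real.exp_le_one_iff.2 (by simpa using (mem_Ioi.1 ht).le)⟩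
    have hφm : AEStronglyMeasurable (fun t => φ (Real.exp (-t))) (volume.restrict (Ioi 0)) := by
      refine ContinuousOn.aestronglyMeasurable ?_ measurableSet_Ioi
      exact hφ.comp (by fun_prop) hexp
    obtain ⟨M, hM⟩ := isCompact_Icc.exists_bound_of_continuousOn hφ
    have hφint : IntegrableOn (fun t => φ (Real.exp (-t)) * h t) (Ioi 0) := by
      refine Integrable.bdd_mul (c := M) hhint hφm ?_
      exact (ae_restrict_iff' measurableSet_Ioi).2 (.of_forall fun t ht => hM _ (hexp t ht))
    have hle : ∀ ε > 0, |∫ t in Ioi 0, φ (Real.exp (-t)) * h t| ≤ ε * ∫ t in Ioi 0, |h t| := by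
      intro ε hε
      obtain ⟨P, hP⟩ := exists_polynomial_near_of_continuousOn 0 1 φ hφ ε hε
      have h1 := integral_sub hφint (hpoly P).1
      rw [(hpoly P).2, sub_zero] at h1
      rw [← h1, ← integral_const_mul]
      refine (abs_integral_le_integral_abs).trans ?_
      refine setIntegral_mono_on (hφint.sub (hpoly P).1).abs (hhint.abs.const_mul ε)
        measurableSet_Ioi fun t ht => ?_
      rw [← sub_mul, abs_mul]
      gcongr
      rw [abs_sub_comm]
      exact (hP _ (hexp t ht)).le
    by_contra hne
    have hpos : 0 < |∫ t in Ioi 0, φ (Real.exp (-t)) * h t| := abs_pos.2 hne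
    have hI : 0 ≤ ∫ t in Ioi 0, |h t| := integral_nonneg fun _ => abs_nonneg _
    have := hle (|∫ t in Ioi 0, φ (Real.exp (-t)) * h t| / (2 * ((∫ t in Ioi 0, |h t|) + 1)))
      (by positivity)
    rw [div_mul_eq_mul_div, le_div_iff₀ (by positivity)] at this
    nlinarith
  have hae : ∀ᵐ t, t ∈ Ioi (0 : ℝ) → h t = 0 := by
    refine isOpen_Ioi.ae_eq_zero_of_integral_contDiff_smul_eq_zero
      hhint.locallyIntegrableOn fun ψ hψ hψc hψs => ?_
    have hψ0 : ∀ t, t ≤ 0 → ψ t = 0 := fun t ht => by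
      by_contra hne
      exact absurd (hψs (subset_tsupport _ hne)) (notMem_Ioi.2 ht)
    have hc : Continuous fun x => ψ (-Real.log x) := by
      rw [continuous_iff_continuousAt]
      intro x
      by_cases hx : x = 0
      · subst hx
        rw [continuousAt_iff_punctured_nhds]
        have h1 : Tendsto (fun x => -Real.log x) (𝓝[≠] 0) (cocompact ℝ) :=
          (tendsto_neg_atBot_atTop.comp Real.tendsto_log_nhdsNE_zero).mono_right
            atTop_le_cocompact
        have h2 := hψc.is_zero_at_infty.comp h1
        simpa [hψ0 0 le_rfl, Function.comp_def] using h2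
      · exact hψ.continuous.continuousAt.comp (Real.continuousAt_log hx).neg
    have h1 := hcont _ hc.continuousOn
    simp only [Real.log_exp, neg_neg] at h1
    rw [← integral_indicator measurableSet_Ioi] at h1
    rw [← h1]
    congr 1
    ext t
    by_cases ht : t ∈ Ioi (0 : ℝ)
    · rw [indicator_of_mem ht, smul_eq_mul]
    · rw [indicator_of_notMem ht, hψ0 t (not_lt.1 ht), zero_smul]
  have hhc : ContinuousOn h (Ioi 0) := by
    have : ContinuousOn (fun t : ℝ => Real.exp (-(t * 1))) (Ioi 0) := by fun_prop
    exact this.mul hf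
  have heq : EqOn h 0 (Ioi 0) :=
    Measure.eqOn_open_of_ae_eq ((ae_restrict_iff' measurableSet_Ioi).2 hae) isOpen_Ioi hhc
      continuousOn_const
  intro t ht
  have := heq ht
  simpa [hh, (Real.exp_pos _).ne'] using this

theorem integrableOn_exp_neg_mul {c : ℝ} (hc : 0 < c) :
    IntegrableOn (fun t => Real.exp (-(t * c))) (Ioi 0) := by
  simpa [mul_comm] using exp_neg_integrableOn_Ioi 0 hc

theorem integral_exp_neg_mul {c : ℝ} (hc : 0 < c) :
    ∫ t in Ioi (0 : ℝ), Real.exp (-(t * c)) = 1 / c := by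
  have := integral_exp_mul_Ioi (a := -c) (by linarith) 0
  simpa [mul_comm, neg_div_neg_eq] using this

section Mixture

variable {ρ : Measure ℝ≥0} [IsFiniteMeasure ρ] {h : ℝ≥0 → ℝ}

theorem mul_exp_neg_le {r t : ℝ} (ht : 0 < t) : r * Real.exp (-(r * t)) ≤ 1 / t := by
  rw [le_div_iff₀ ht, mul_right_comm, Real.exp_neg, ← div_eq_mul_inv,
    div_le_one (Real.exp_pos _)]
  linarith [Real.add_one_le_exp (r * t)]

theorem abs_mul_exp_neg_le (hb : ∀ r, |h r| ≤ 1 + r) {t₀ t : ℝ} (h0 : 0 < t₀) (ht : t₀ ≤ t)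
    (r : ℝ≥0) : |h r * Real.exp (-(r * t))| ≤ 1 + 1 / t₀ := by
  rw [abs_mul, abs_of_pos (Real.exp_pos _)]
  have h1 : Real.exp (-(r * t)) ≤ Real.exp (-(r * t₀)) :=
    Real.exp_le_exp.2 (by have := r.2; nlinarith [r.coe_nonneg])
  calc |h r| * Real.exp (-(r * t)) ≤ (1 + r) * Real.exp (-(r * t₀)) := by
        gcongr
        exact hb r
    _ = Real.exp (-(r * t₀)) + r * Real.exp (-(r * t₀)) := by ring
    _ ≤ 1 + 1 / t₀ := by
      gcongr
      · exact Real.exp_le_one_iff.2 (by have := r.coe_nonneg; nlinarith)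
      · exact mul_exp_neg_le h0

theorem continuousOn_mixture (hm : Measurable h) (hb : ∀ r, |h r| ≤ 1 + r) :
    ContinuousOn (fun t => ∫ r : ℝ≥0, h r * Real.exp (-(r * t)) ∂ρ) (Ioi 0) := by
  intro t ht
  refine ContinuousAt.continuousWithinAt ?_
  have ht' : 0 < t / 2 := half_pos ht
  refine continuousAt_of_dominated (bound := fun _ => 1 + 1 / (t / 2)) ?_ ?_
    (integrable_const _) ?_
  · exact .of_forall fun x => by fun_prop
  · filter_upwards [lt_mem_nhds (half_lt_self ht)] with x hx
    exact .of_forall fun r => abs_mul_exp_neg_le hb ht' hx.le r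
  · exact .of_forall fun r => by fun_prop

theorem integrable_prod_mixture (hm : Measurable h) (hb : ∀ r, |h r| ≤ 1 + r) {s : ℝ}
    (hs : 0 < s) :
    Integrable (fun z : ℝ≥0 × ℝ => Real.exp (-(z.2 * s)) * (h z.1 * Real.exp (-(z.1 * z.2))))
      (ρ.prod (volume.restrict (Ioi 0))) := by
  have heq : ∀ (r : ℝ≥0) (t : ℝ), Real.exp (-(t * s)) * (h r * Real.exp (-(r * t)))
      = h r * Real.exp (-(t * (s + r))) := fun r t => by
    rw [mul_left_comm, ← Real.exp_add]; ring_nf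
  have hpos : ∀ r : ℝ≥0, 0 < s + r := fun r => add_pos_of_pos_of_nonneg hs r.2
  rw [integrable_prod_iff (by fun_prop)]
  constructor
  · refine .of_forall fun r => ?_
    simp only [heq]
    exact (integrableOn_exp_neg_mul (hpos r)).const_mul _
  · simp only [heq, norm_mul, Real.norm_eq_abs, Real.abs_exp]
    simp only [integral_const_mul, integral_exp_neg_mul (hpos _), mul_one_div]
    refine Integrable.of_bound (C := 1 + 1 / s)
      (Measurable.aestronglyMeasurable (by fun_prop)) (.of_forall fun r => ?_)
    rw [Real.norm_eq_abs, abs_div, abs_abs, abs_of_pos (hpos r), div_le_iff₀ (hpos r)]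
    refine (hb r).trans ?_
    have : 0 ≤ (r : ℝ) / s := by positivity
    have h2 : (1 + 1 / s) * (s + r) = 1 + s + r + r / s := by field_simp; ring
    rw [h2]; linarith

theorem integrableOn_laplace_mixture (hm : Measurable h) (hb : ∀ r, |h r| ≤ 1 + r) {s : ℝ}
    (hs : 0 < s) :
    IntegrableOn (fun t => Real.exp (-(t * s)) * ∫ r : ℝ≥0, h r * Real.exp (-(r * t)) ∂ρ)
      (Ioi 0) := by
  have := (integrable_prod_mixture (ρ := ρ) hm hb hs).integral_prod_right
  simpa only [integral_const_mul, IntegrableOn] using this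

theorem laplaceTransform_mixture (hm : Measurable h) (hb : ∀ r, |h r| ≤ 1 + r) {s : ℝ}
    (hs : 0 < s) :
    laplaceTransform (fun t => ∫ r : ℝ≥0, h r * Real.exp (-(r * t)) ∂ρ) s
      = ∫ r : ℝ≥0, h r / (s + r) ∂ρ := by
  have hswap := integral_integral_swap
    (f := fun (r : ℝ≥0) (t : ℝ) => Real.exp (-(t * s)) * (h r * Real.exp (-(r * t))))
    (integrable_prod_mixture (ρ := ρ) hm hb hs)
  simp only [integral_const_mul] at hswap
  rw [laplaceTransform, ← hswap]
  refine integral_congr_ae (.of_forall fun r => ?_)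
  have hpos : 0 < s + r := add_pos_of_pos_of_nonneg hs r.2
  have heq : ∀ t : ℝ, Real.exp (-(t * s)) * (h r * Real.exp (-(r * t)))
      = h r * Real.exp (-(t * (s + r))) := fun t => by
    rw [mul_left_comm, ← Real.exp_add]; ring_nf
  simp only [heq, integral_const_mul, integral_exp_neg_mul hpos, mul_one_div]

end Mixture

end GenDiff
end Laplace

section Memory

namespace GenDiff

/-- A memory kernel is a mixture of exponentials. -/
theorem IsMemoryKernel.exists_measure {g : ℝ → ℝ} (hg : IsMemoryKernel g) :
    ∃ ρ : Measure ℝ≥0, IsFiniteMeasure ρ ∧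
      (∀ s : ℝ, 0 < s → laplaceTransform g s = ∫ r : ℝ≥0, (1 + r) / (s + r) ∂ρ) ∧
      ∀ t : ℝ, 0 < t → g t = ∫ r : ℝ≥0, (1 + r) * Real.exp (-(r * t)) ∂ρ := by
  obtain ⟨a, b, σ, ha, hb, hσ, hrep⟩ := hg.stieltjes
  have hd : Measurable fun r : ℝ≥0 => (1 + r)⁻¹ := by fun_prop
  set ρ : Measure ℝ≥0 := σ.withDensity fun r => ((1 + r)⁻¹ : ℝ≥0) with hρ
  have hfin : IsFiniteMeasure ρ := by
    refine isFiniteMeasure_withDensity ?_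
    have := hσ.2
    rw [hasFiniteIntegral_iff_enorm] at this
    refine ne_of_lt (lt_of_eq_of_lt (lintegral_congr fun r => ?_) this)
    rw [one_div, ← NNReal.coe_one, ← NNReal.coe_add, ← NNReal.coe_inv, enorm_eq_nnnorm,
      NNReal.nnnorm_eq]
  have hint : ∀ s : ℝ, ∫ r : ℝ≥0, 1 / (s + (r : ℝ)) ∂σ = ∫ r : ℝ≥0, (1 + r) / (s + r) ∂ρ := by
    intro s
    rw [hρ, integral_withDensity_eq_integral_smul hd]
    refine integral_congr_ae (.of_forall fun r => ?_)
    simp only [NNReal.smul_def, smul_eq_mul, NNReal.coe_inv, NNReal.coe_add, NNReal.coe_one]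
    have : (1 + r : ℝ) ≠ 0 := by positivity
    rw [← mul_div_assoc, inv_mul_cancel₀ this]
  have hnn : ∀ s : ℝ, 0 < s → 0 ≤ ∫ r : ℝ≥0, 1 / (s + (r : ℝ)) ∂σ := fun s hs =>
    integral_nonneg fun r => by positivity
  have hb0 : b = 0 := by
    refine le_antisymm (ge_of_tendsto hg.tendsto_atTop ?_) hb
    filter_upwards [eventually_gt_atTop 0] with s hs
    rw [hrep s hs]
    have := hnn s hs
    have : 0 ≤ a / s := by positivity
    linarith
  have ha0 : a = 0 := by
    refine le_antisymm (ge_of_tendsto hg.mul_tendsto_zero ?_) ha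
    filter_upwards [self_mem_nhdsWithin] with s hs
    rw [hrep s hs, mul_add, mul_add, mul_div_cancel₀ _ (ne_of_gt hs)]
    have := mul_nonneg (le_of_lt hs) (hnn s hs)
    have := mul_nonneg (le_of_lt hs) hb
    linarith
  have hlap : ∀ s : ℝ, 0 < s → laplaceTransform g s = ∫ r : ℝ≥0, (1 + r) / (s + r) ∂ρ := by
    intro s hs
    rw [hrep s hs, ha0, hb0, hint, zero_div, add_zero, zero_add]
  refine ⟨ρ, hfin, hlap, ?_⟩
  have hm : Measurable fun r : ℝ≥0 => (1 + r : ℝ) := by fun_prop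
  have hbd : ∀ r : ℝ≥0, |(1 + r : ℝ)| ≤ 1 + r := fun r => (abs_of_nonneg (by positivity)).le
  have key := eq_zero_of_laplace_eq_zero
    (f := fun t => g t - ∫ r : ℝ≥0, (1 + r) * Real.exp (-(r * t)) ∂ρ)
    (hg.continuousOn.sub (continuousOn_mixture hm hbd)) (fun s hs => ?_) (fun s hs => ?_)
  · intro t ht
    exact sub_eq_zero.1 (key t ht)
  · simp only [mul_sub]
    exact (hg.laplace_exists s hs).sub (integrableOn_laplace_mixture hm hbd hs)
  · have h1 := integral_sub (hg.laplace_exists s hs)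
      (integrableOn_laplace_mixture (ρ := ρ) hm hbd hs)
    have h2 := laplaceTransform_mixture (ρ := ρ) hm hbd hs
    rw [laplaceTransform] at h2 ⊢
    simp only [mul_sub]
    rw [h1, h2, ← hlap s hs, laplaceTransform, sub_self]

end GenDiff
end Memory

section SpectralMeasure

namespace GenDiff

open scoped CompactlySupported InnerProductSpace

variable {H : Type*} [NormedAddCommGroup H] [InnerProductSpace ℂ H]

theorem re_inner_nonneg_of_nonneg {T : H →L[ℂ] H} (hT : 0 ≤ T) (e : H) :
    0 ≤ (inner ℂ e (T e)).re := by
  have := (ContinuousLinearMap.nonneg_iff_isPositive T).1 hT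
  exact this.re_inner_nonneg_right e

variable [CompleteSpace H]

/-- The spectral measure at `e` of a positive contraction `T`, on `[0, 1]`. -/
theorem exists_spectral_measure {T : H →L[ℂ] H} (h0 : 0 ≤ T) (h1 : T ≤ 1) (e : H) :
    ∃ ν : Measure (Icc (0 : ℝ) 1), IsFiniteMeasure ν ∧
      ∀ f : C(ℝ, ℝ), (inner ℂ e (cfc f T e)).re = ∫ p : Icc (0 : ℝ) 1, f p ∂ν := by
  have hsa : IsSelfAdjoint T := IsSelfAdjoint.of_nonneg h0
  have hspec : spectrum ℝ T ⊆ Icc 0 1 := fun x hx =>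
    ⟨spectrum_nonneg_of_nonneg h0 hx, (CFC.le_one_iff T hsa).1 h1 x hx⟩
  let ext : C_c(Icc (0 : ℝ) 1, ℝ) → ℝ → ℝ := fun f x => f (projIcc 0 1 zero_le_one x)
  have hext : ∀ f, Continuous (ext f) := fun f => f.continuous.comp continuous_projIcc
  let L : C_c(Icc (0 : ℝ) 1, ℝ) →ₗ[ℝ] ℝ :=
    { toFun := fun f => (inner ℂ e (cfc (ext f) T e)).re
      map_add' := fun f g => by
        have : cfc (ext (f + g)) T = cfc (ext f) T + cfc (ext g) T :=
          cfc_add T (ext f) (ext g) (hext f).continuousOn (hext g).continuousOn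
        rw [this, add_apply, inner_add_right, Complex.add_re]
      map_smul' := fun c f => by
        have : cfc (ext (c • f)) T = c • cfc (ext f) T :=
          cfc_smul c (ext f) T (hext f).continuousOn
        rw [this, smul_apply, inner_smul_right_eq_smul, Complex.smul_re]
        rfl }
  let Λ : C_c(Icc (0 : ℝ) 1, ℝ) →ₚ[ℝ] ℝ := PositiveLinearMap.mk₀ L fun f hf =>
    re_inner_nonneg_of_nonneg (cfc_nonneg (f := ext f) (a := T) fun x _ => hf _) e
  refine ⟨RealRMK.rieszMeasure Λ, inferInstance, fun f => ?_⟩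
  let F : C_c(Icc (0 : ℝ) 1, ℝ) :=
    ⟨⟨fun p => f p, by fun_prop⟩, HasCompactSupport.of_compactSpace _⟩
  have h := RealRMK.integral_rieszMeasure Λ F
  have h2 : Λ F = (inner ℂ e (cfc f T e)).re := by
    change (inner ℂ e (cfc (ext F) T e)).re = _
    congr 3
    refine cfc_congr fun x hx => ?_
    simp only [ext, F]
    change f (projIcc 0 1 zero_le_one x : ℝ) = f x
    rw [projIcc_of_mem zero_le_one (hspec hx)]
  rw [← h2, ← h]
  rfl

/-- Resolvent form of the spectral measure. -/
theorem exists_spectral_measure_resolvent {T : H →L[ℂ] H} (h0 : 0 ≤ T) (h1 : T ≤ 1) (e : H) :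
    ∃ ν : Measure (Icc (0 : ℝ) 1), IsFiniteMeasure ν ∧
      ∀ (s : ℝ) (x : H), 0 < s → (s : ℂ) • T x + (x - T x) = e →
        (inner ℂ e x).re = ∫ p : Icc (0 : ℝ) 1, 1 / (s * p + (1 - p)) ∂ν := by
  obtain ⟨ν, hν, h⟩ := exists_spectral_measure h0 h1 e
  refine ⟨ν, hν, fun s x hs hx => ?_⟩
  have hsa : IsSelfAdjoint T := IsSelfAdjoint.of_nonneg h0
  have hspec : spectrum ℝ T ⊆ Icc 0 1 := fun x hx =>
    ⟨spectrum_nonneg_of_nonneg h0 hx, (CFC.le_one_iff T hsa).1 h1 x hx⟩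
  have hpos : ∀ p ∈ Icc (0 : ℝ) 1, 0 < s * p + (1 - p) := by
    rintro p ⟨hp0, hp1⟩
    rcases hp0.eq_or_lt with rfl | hp
    · norm_num
    · have := mul_pos hs hp; linarith
  have hc0 : 0 < min s 1 := lt_min hs one_pos
  have hmin : ∀ p ∈ Icc (0 : ℝ) 1, min s 1 ≤ s * p + (1 - p) := by
    rintro p ⟨hp0, hp1⟩
    nlinarith [min_le_left s 1, min_le_right s 1]
  let f : C(ℝ, ℝ) := ⟨fun p => 1 / max (min s 1) (s * p + (1 - p)), by
    refine continuous_const.div (by fun_prop) fun p => ?_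
    exact (lt_max_of_lt_left hc0).ne'⟩
  have hf : ∀ p ∈ Icc (0 : ℝ) 1, f p = 1 / (s * p + (1 - p)) := fun p hp => by
    change 1 / max (min s 1) (s * p + (1 - p)) = _
    rw [max_eq_right (hmin p hp)]
  have hinv : cfc f T * ((s : ℂ) • T + (1 - T)) = 1 := by
    have hlin : (s : ℂ) • T + (1 - T) = cfc (fun p : ℝ => s * p + (1 - p)) T := by
      rw [cfc_add (a := T) (fun p : ℝ => s * p) (fun p : ℝ => 1 - p) (by fun_prop) (by fun_prop),
        cfc_const_mul s (fun p : ℝ => p) T (by fun_prop), cfc_sub (a := T) (fun _ : ℝ => 1)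
        (fun p : ℝ => p) (by fun_prop) (by fun_prop), cfc_const_one ℝ T, cfc_id' ℝ T,
        Complex.coe_smul]
    rw [hlin, ← cfc_mul f (fun p : ℝ => s * p + (1 - p)) T f.continuous.continuousOn
      (by fun_prop), ← cfc_const_one ℝ T]
    refine cfc_congr fun p hp => ?_
    rw [hf p (hspec hp), one_div_mul_cancel (hpos p (hspec hp)).ne']
  have hxe : x = cfc f T e := by
    have := congrArg (fun A : H →L[ℂ] H => A x) hinv
    simp only [mul_apply_eq_comp, add_apply,
      smul_apply, sub_apply,
      one_apply_eq_self] at this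
    rw [hx] at this
    exact this.symm
  rw [hxe, h f]
  exact integral_congr_ae (.of_forall fun p => hf p p.2)

end GenDiff
end SpectralMeasure

section Relaxation

namespace GenDiff

section Multiplication

variable (ρ : Measure ℝ≥0)

theorem memLp_inv_one_add : MemLp (fun r : ℝ≥0 => (((1 + r)⁻¹ : ℝ) : ℂ)) ⊤ ρ := by
  refine memLp_top_of_bound (Measurable.aestronglyMeasurable (by fun_prop)) 1
    (.of_forall fun r => ?_)
  rw [Complex.norm_real, Real.norm_eq_abs, abs_of_pos (by positivity)]
  exact inv_le_one_of_one_le₀ (by simp)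

/-- Multiplication by `1 / (1 + r)` on `L²(ρ)`. -/
noncomputable def mulInvOneAdd : Lp ℂ 2 ρ →L[ℂ] Lp ℂ 2 ρ :=
  (ContinuousLinearMap.mul ℂ ℂ).holderL ρ ⊤ 2 2 (memLp_inv_one_add ρ).toLp

theorem mulInvOneAdd_coeFn (f : Lp ℂ 2 ρ) :
    mulInvOneAdd ρ f =ᵐ[ρ] fun r => (((1 + r)⁻¹ : ℝ) : ℂ) * f r := by
  have h := (ContinuousLinearMap.mul ℂ ℂ).coeFn_holder (r := 2) (memLp_inv_one_add ρ).toLp f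
  filter_upwards [h, (memLp_inv_one_add ρ).coeFn_toLp] with r hr hr'
  rw [← hr']
  exact hr

theorem inner_mulInvOneAdd (f g : Lp ℂ 2 ρ) :
    inner ℂ (mulInvOneAdd ρ f) g = ∫ r, (((1 + r)⁻¹ : ℝ) : ℂ) * inner ℂ (f r) (g r) ∂ρ := by
  rw [MeasureTheory.L2.inner_def]
  refine integral_congr_ae ?_
  filter_upwards [mulInvOneAdd_coeFn ρ f] with r hr
  rw [hr]
  simp only [RCLike.inner_apply, map_mul, Complex.conj_ofReal]
  ring

theorem mulInvOneAdd_isSymmetric : (mulInvOneAdd ρ : Lp ℂ 2 ρ →ₗ[ℂ] Lp ℂ 2 ρ).IsSymmetric := by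
  intro f g
  change inner ℂ (mulInvOneAdd ρ f) g = inner ℂ f (mulInvOneAdd ρ g)
  rw [← inner_conj_symm f, inner_mulInvOneAdd, inner_mulInvOneAdd, ← integral_conj]
  refine integral_congr_ae (.of_forall fun r => ?_)
  simp only [map_mul, Complex.conj_ofReal, inner_conj_symm]

theorem integrable_inv_one_add_mul_inner (f : Lp ℂ 2 ρ) :
    Integrable (fun r : ℝ≥0 => (((1 + r)⁻¹ : ℝ) : ℂ) * inner ℂ (f r) (f r)) ρ := by
  refine (L2.integrable_inner f f).bdd_mul (c := 1)
    (Measurable.aestronglyMeasurable (by fun_prop)) (.of_forall fun r => ?_)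
  rw [Complex.norm_real, Real.norm_eq_abs, abs_of_pos (by positivity)]
  exact inv_le_one_of_one_le₀ (by simp)

theorem re_inner_mulInvOneAdd (f : Lp ℂ 2 ρ) :
    (inner ℂ (mulInvOneAdd ρ f) f).re = ∫ r, (1 + r : ℝ)⁻¹ * ‖f r‖ ^ 2 ∂ρ := by
  rw [inner_mulInvOneAdd]
  have := integral_re (integrable_inv_one_add_mul_inner ρ f)
  simp only [RCLike.re_to_complex] at this
  rw [← this]
  refine integral_congr_ae (.of_forall fun r => ?_)
  simp only [Complex.re_ofReal_mul]
  congr 1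
  exact inner_self_eq_norm_sq (𝕜 := ℂ) (f r)

theorem mulInvOneAdd_nonneg : 0 ≤ mulInvOneAdd ρ := by
  rw [ContinuousLinearMap.nonneg_iff_isPositive]
  refine ⟨mulInvOneAdd_isSymmetric ρ, fun f => ?_⟩
  rw [ContinuousLinearMap.reApplyInnerSelf]
  change 0 ≤ (inner ℂ (mulInvOneAdd ρ f) f).re
  rw [re_inner_mulInvOneAdd]
  exact integral_nonneg fun r => by positivity

theorem mulInvOneAdd_le_one : mulInvOneAdd ρ ≤ 1 := by
  rw [← sub_nonneg, ContinuousLinearMap.nonneg_iff_isPositive]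
  refine ⟨?_, fun f => ?_⟩
  · intro f g
    change inner ℂ (f - mulInvOneAdd ρ f) g = inner ℂ f (g - mulInvOneAdd ρ g)
    rw [inner_sub_left, inner_sub_right]
    congr 1
    exact mulInvOneAdd_isSymmetric ρ f g
  · rw [ContinuousLinearMap.reApplyInnerSelf]
    change 0 ≤ (inner ℂ (f - mulInvOneAdd ρ f) f).re
    rw [inner_sub_left, Complex.sub_re, re_inner_mulInvOneAdd, sub_nonneg]
    have h1 : (inner ℂ f f : ℂ).re = ∫ r, ‖f r‖ ^ 2 ∂ρ := by
      rw [L2.inner_def]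
      have := integral_re (L2.integrable_inner (𝕜 := ℂ) f f)
      simp only [RCLike.re_to_complex] at this
      rw [← this]
      refine integral_congr_ae (.of_forall fun r => ?_)
      exact inner_self_eq_norm_sq (𝕜 := ℂ) (f r)
    rw [h1]
    have hi : Integrable (fun r => ‖f r‖ ^ 2) ρ := (Lp.memLp f).integrable_norm_pow two_ne_zero
    refine integral_mono_of_nonneg (.of_forall fun r => by positivity) hi (.of_forall fun r => ?_)
    refine mul_le_of_le_one_left (by positivity) (inv_le_one_of_one_le₀ (by simp))

variable [IsFiniteMeasure ρ]

/-- The orthogonal rank-one operator `f ↦ ⟨1, f⟩ 1` on `L²(ρ)`. -/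
noncomputable def rankOneConst : Lp ℂ 2 ρ →L[ℂ] Lp ℂ 2 ρ :=
  InnerProductSpace.rankOne ℂ (Lp.const 2 ρ (1 : ℂ)) (Lp.const 2 ρ (1 : ℂ))

theorem inner_const_left (f : Lp ℂ 2 ρ) : inner ℂ (Lp.const 2 ρ (1 : ℂ)) f = ∫ r, f r ∂ρ := by
  rw [L2.inner_def]
  refine integral_congr_ae ?_
  filter_upwards [Lp.coeFn_const (p := 2) (μ := ρ) (1 : ℂ)] with r hr
  rw [hr]
  simp

theorem rankOneConst_apply (f : Lp ℂ 2 ρ) :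
    rankOneConst ρ f = (∫ r, f r ∂ρ) • Lp.const 2 ρ (1 : ℂ) := by
  rw [rankOneConst, InnerProductSpace.rankOne_apply, inner_const_left]

theorem rankOneConst_const :
    rankOneConst ρ (Lp.const 2 ρ (1 : ℂ)) = (ρ.real univ : ℂ) • Lp.const 2 ρ (1 : ℂ) := by
  rw [rankOneConst_apply, integral_congr_ae (Lp.coeFn_const (p := 2) (μ := ρ) (1 : ℂ))]
  simp [integral_const]

theorem rankOneConst_mul_self :
    rankOneConst ρ * rankOneConst ρ = (ρ.real univ : ℂ) • rankOneConst ρ := by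
  ext1 f
  rw [mul_apply_eq_comp, rankOneConst_apply ρ f, map_smul, rankOneConst_const, smul_apply,
    rankOneConst_apply, smul_comm]

theorem rankOneConst_nonneg : 0 ≤ rankOneConst ρ := by
  rw [ContinuousLinearMap.nonneg_iff_isPositive]
  exact InnerProductSpace.isPositive_rankOne_self _

end Multiplication

end GenDiff
end Relaxation

section RelaxationMeasure

namespace GenDiff

open scoped ComplexOrder in
/-- For a finite measure `ρ ≠ 0` put `φ(s) = ∫ (1 + r) / (s + r) ρ(dr)`. Then
`φ(s) / (1 + s φ(s) / lam)` is a resolvent-type integral over `[0, 1]`. -/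
theorem exists_measure_resolvent (ρ : Measure ℝ≥0) [IsFiniteMeasure ρ] (hρ : 0 < ρ.real univ)
    {lam : ℝ} (hl : 0 < lam) :
    ∃ ν : Measure (Icc (0 : ℝ) 1), IsFiniteMeasure ν ∧ ∀ s : ℝ, 0 < s →
      (∫ r : ℝ≥0, (1 + r) / (s + r) ∂ρ) / (1 + s * (∫ r : ℝ≥0, (1 + r) / (s + r) ∂ρ) / lam)
        = ∫ p : Icc (0 : ℝ) 1, 1 / (s * p + (1 - p)) ∂ν := by
  set m : ℝ := ρ.real univ with hm
  set κ : ℝ := (√(1 + m / lam))⁻¹ with hκ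
  set γ : ℝ := (1 - κ) / m with hγ
  have hκ2 : κ ^ 2 * (1 + m / lam) = 1 := by
    rw [hκ, inv_pow, Real.sq_sqrt (by positivity), inv_mul_cancel₀ (by positivity)]
  have hγeq : 1 / lam - 2 * γ + γ ^ 2 * m - 2 * γ * m / lam + γ ^ 2 * m ^ 2 / lam = 0 := by
    have hκγ : κ = 1 - γ * m := by rw [hγ]; field_simp; ring
    rw [hκγ] at hκ2
    have hm0 : m ≠ 0 := hρ.ne'
    have : m * (1 / lam - 2 * γ + γ ^ 2 * m - 2 * γ * m / lam + γ ^ 2 * m ^ 2 / lam)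
        = (1 - γ * m) ^ 2 * (1 + m / lam) - 1 := by field_simp; ring
    rw [hκ2, sub_self] at this
    exact (mul_eq_zero.1 this).resolve_left hm0
  have hγeqC : (1 / lam - 2 * γ + γ ^ 2 * m - 2 * γ * m / lam + γ ^ 2 * m ^ 2 / lam : ℂ) = 0 := by
    exact_mod_cast hγeq
  set one : Lp ℂ 2 ρ := Lp.const 2 ρ (1 : ℂ) with hone
  set E := rankOneConst ρ with hE
  set Y := mulInvOneAdd ρ with hY
  have hEE : E * E = (m : ℂ) • E := rankOneConst_mul_self ρ
  have hEpos : 0 ≤ E := rankOneConst_nonneg ρ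
  set S : Lp ℂ 2 ρ →L[ℂ] Lp ℂ 2 ρ := 1 + (1 / lam : ℂ) • E with hS
  set R : Lp ℂ 2 ρ →L[ℂ] Lp ℂ 2 ρ := 1 - (γ : ℂ) • E with hR
  set P : Lp ℂ 2 ρ →L[ℂ] Lp ℂ 2 ρ := Y + (1 / lam : ℂ) • E with hP
  have hRS : R * S = S * R := by
    simp only [hR, hS, mul_add, add_mul, sub_mul, mul_sub, smul_mul_assoc, mul_smul_comm, hEE,
      smul_smul, one_mul, mul_one]
    module
  have hRSR : R * S * R = 1 := by
    simp only [hR, hS, mul_add, add_mul, sub_mul, mul_sub, smul_mul_assoc, mul_smul_comm, hEE,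
      smul_smul, one_mul, mul_one]
    have : (1 : Lp ℂ 2 ρ →L[ℂ] Lp ℂ 2 ρ) = 1
        + (1 / lam - 2 * γ + γ ^ 2 * m - 2 * γ * m / lam + γ ^ 2 * m ^ 2 / lam : ℂ) • E := by
      rw [hγeqC, zero_smul, add_zero]
    conv_rhs => rw [this]
    module
  have hRsa : IsSelfAdjoint R := by
    refine (IsSelfAdjoint.one _).sub (IsSelfAdjoint.smul ?_ (IsSelfAdjoint.of_nonneg hEpos))
    exact Complex.conj_ofReal γ
  have hPpos : 0 ≤ P := by
    refine add_nonneg (mulInvOneAdd_nonneg ρ) ?_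
    rw [ContinuousLinearMap.nonneg_iff_isPositive] at hEpos ⊢
    refine hEpos.smul_of_nonneg ?_
    have : (0 : ℂ) ≤ ((1 / lam : ℝ) : ℂ) := Complex.zero_le_real.2 (by positivity)
    simpa using this
  set T := R * P * R with hT
  have hT0 : 0 ≤ T := hRsa.conjugate_nonneg hPpos
  have hT1 : T ≤ 1 := by
    rw [← sub_nonneg]
    have : 1 - T = R * (1 - Y) * R := by
      have hSP : 1 - Y = S - P := by rw [hS, hP]; abel
      rw [hSP, mul_sub R S P, sub_mul (R * S), hRSR]
    rw [this]
    exact hRsa.conjugate_nonneg (sub_nonneg.2 (mulInvOneAdd_le_one ρ))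
  obtain ⟨ν, hν, h⟩ := exists_spectral_measure_resolvent hT0 hT1 (R one)
  refine ⟨ν, hν, fun s hs => ?_⟩
  set φ : ℝ := ∫ r : ℝ≥0, (1 + r) / (s + r) ∂ρ with hφ
  have hφ0 : 0 ≤ φ := integral_nonneg fun r => by positivity
  set α : ℝ := (1 + s * φ / lam)⁻¹ with hα
  have hα1 : α * (1 + s * φ / lam) = 1 := inv_mul_cancel₀ (by positivity)
  have hzm : MemLp (fun r : ℝ≥0 => ((α * ((1 + r) / (s + r)) : ℝ) : ℂ)) 2 ρ := by
    refine MemLp.of_bound (Measurable.aestronglyMeasurable (by fun_prop)) (|α| * (1 + 1 / s))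
      (.of_forall fun r => ?_)
    have hr := r.coe_nonneg
    rw [Complex.norm_real, Real.norm_eq_abs, abs_mul]
    gcongr
    rw [abs_of_nonneg (by positivity), div_le_iff₀ (by positivity)]
    have : 0 ≤ (r : ℝ) / s := by positivity
    have h2 : (1 + 1 / s) * (s + r) = 1 + s + r + r / s := by field_simp; ring
    rw [h2]; linarith
  set z : Lp ℂ 2 ρ := hzm.toLp with hz
  have hzint : ∫ r, z r ∂ρ = ((α * φ : ℝ) : ℂ) := by
    rw [integral_congr_ae hzm.coeFn_toLp, integral_complex_ofReal, integral_const_mul]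
  have hEz : E z = ((α * φ : ℝ) : ℂ) • one := by
    rw [hE, rankOneConst_apply, hzint]
  have hYz : (s : ℂ) • Y z + (z - Y z) = (α : ℂ) • one := by
    refine Lp.ext ?_
    filter_upwards [Lp.coeFn_add ((s : ℂ) • Y z) (z - Y z), Lp.coeFn_smul (s : ℂ) (Y z),
      Lp.coeFn_sub z (Y z), Lp.coeFn_smul (α : ℂ) one, mulInvOneAdd_coeFn ρ z,
      Lp.coeFn_const (p := 2) (μ := ρ) (1 : ℂ), hzm.coeFn_toLp] with r h1 h2 h3 h4 h5 h6 h7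
    rw [h1, Pi.add_apply, h2, h3, h4, Pi.smul_apply, Pi.sub_apply, Pi.smul_apply, h5, h7, h6]
    simp only [smul_eq_mul, Function.const_apply, mul_one]
    norm_cast
    push_cast
    have hr := r.coe_nonneg
    have h1 : (s + r : ℝ) ≠ 0 := by positivity
    have h2 : (1 + r : ℝ) ≠ 0 := by positivity
    field_simp
    ring
  have hPz : (s : ℂ) • P z + (S z - P z) = one := by
    have : (s : ℂ) • P z + (S z - P z)
        = ((s : ℂ) • Y z + (z - Y z)) + (s / lam : ℂ) • E z := by
      simp only [hP, hS, add_apply, smul_apply, one_apply_eq_self]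
      module
    rw [this, hYz, hEz, smul_smul, ← add_smul]
    have : (α : ℂ) + s / lam * ((α * φ : ℝ) : ℂ) = 1 := by
      rw [← Complex.ofReal_one, ← hα1]
      push_cast
      ring
    rw [this, one_smul]
  have hTx : T (S (R z)) = R (P z) := by
    have : T * (S * R) = R * P := by
      rw [hT, mul_assoc (R * P) R, ← mul_assoc R S R, hRSR, mul_one]
    exact congrArg (fun A : Lp ℂ 2 ρ →L[ℂ] Lp ℂ 2 ρ => A z) this
  have hSR : S (R z) = R (S z) := by
    exact congrArg (fun A : Lp ℂ 2 ρ →L[ℂ] Lp ℂ 2 ρ => A z) hRS.symm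
  rw [← h s (S (R z)) hs (by rw [hTx, hSR, ← map_smul, ← map_sub, ← map_add, hPz])]
  have hinner : inner ℂ (R one) (S (R z)) = inner ℂ one z := by
    rw [← ContinuousLinearMap.adjoint_inner_right, ← ContinuousLinearMap.star_eq_adjoint,
      hRsa.star_eq]
    congr 1
    have : R * (S * R) = 1 := by rw [← mul_assoc, hRSR]
    exact congrArg (fun A : Lp ℂ 2 ρ →L[ℂ] Lp ℂ 2 ρ => A z) this
  rw [hinner, inner_const_left, hzint, Complex.ofReal_re, hα]
  field_simp

end GenDiff
end RelaxationMeasure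

section RelaxationProbability

namespace GenDiff

/-- For a kernel `g` with Laplace transform `ĝ`, the function `ĝ / (lam + s ĝ)` is the Stieltjes
transform of a probability measure on `(0, ∞)`. -/
theorem IsMemoryKernel.exists_relaxation_measure {g : ℝ → ℝ} (hg : IsMemoryKernel g) {lam : ℝ}
    (hl : 0 < lam) :
    ∃ μ : Measure ℝ≥0, IsProbabilityMeasure μ ∧ μ {0} = 0 ∧ ∀ s : ℝ, 0 < s →
      ∫ r : ℝ≥0, 1 / (s + r) ∂μ = laplaceTransform g s / (lam + s * laplaceTransform g s) := by
  obtain ⟨ρ, hρfin, hlap, -⟩ := hg.exists_measure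
  have hρ : 0 < ρ.real univ := by
    rw [measureReal_def]
    refine ENNReal.toReal_pos (fun h0 => ?_) (measure_ne_top _ _)
    have h1 : ρ = 0 := Measure.measure_univ_eq_zero.1 h0
    obtain ⟨s, hs, hs'⟩ := ((hg.mul_tendsto_atTop.eventually_gt_atTop 0).and
      (eventually_gt_atTop 0)).exists
    simp only [hlap s hs', h1, integral_zero_measure, mul_zero, lt_irrefl] at hs
  obtain ⟨ν, hν, hres⟩ := exists_measure_resolvent ρ hρ hl
  set G : ℝ → ℝ := laplaceTransform g with hG
  have hG0 : ∀ s, 0 < s → 0 ≤ G s := fun s hs => by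
    rw [hlap s hs]; exact integral_nonneg fun r => by positivity
  set k : ℝ → Icc (0 : ℝ) 1 → ℝ := fun s p => 1 / (s * p + (1 - p)) with hk
  have hkpos : ∀ s, 0 < s → ∀ p : Icc (0 : ℝ) 1, 0 < s * (p : ℝ) + (1 - p) := by
    rintro s hs ⟨p, hp0, hp1⟩
    rcases hp0.eq_or_lt with rfl | hp
    · norm_num
    · have := mul_pos hs hp; simp only; linarith
  have hkm : ∀ s, Measurable (k s) := fun s => by simp only [hk]; fun_prop
  have hkint : ∀ s, 0 < s → Integrable (k s) ν := by
    intro s hs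
    have hc0 : 0 < min s 1 := lt_min hs one_pos
    refine Integrable.of_bound (C := 1 / min s 1) (hkm s).aestronglyMeasurable
      (.of_forall fun p => ?_)
    rw [Real.norm_eq_abs, abs_of_pos (one_div_pos.2 (hkpos s hs p))]
    refine one_div_le_one_div_of_le hc0 ?_
    obtain ⟨p, hp0, hp1⟩ := p
    simp only
    nlinarith [min_le_left s 1, min_le_right s 1]
  have hK : ∀ s, 0 < s → ∫ p, k s p ∂ν = G s / (1 + s * G s / lam) := by
    intro s hs
    rw [hlap s hs]
    exact (hres s hs).symm
  have hKle : ∀ s, 0 < s → ∫ p, k s p ∂ν ≤ G s := by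
    intro s hs
    rw [hK s hs]
    have := hG0 s hs
    refine div_le_self this ?_
    have : 0 ≤ s * G s / lam := by positivity
    linarith
  have hKle' : ∀ s, 0 < s → ∫ p, s * k s p ∂ν ≤ lam := by
    intro s hs
    rw [integral_const_mul, hK s hs]
    have := hG0 s hs
    have h2 : 0 ≤ s * G s / lam := by positivity
    rw [← mul_div_assoc, div_le_iff₀ (by linarith), mul_add, mul_div_cancel₀ _ hl.ne']
    linarith
  -- no atom at `p = 0`
  have hzero : ∀ᵐ p : Icc (0 : ℝ) 1 ∂ν, (0 : ℝ) < p := by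
    have h1 : ν.real {p : Icc (0 : ℝ) 1 | (p : ℝ) = 0} ≤ 0 := by
      refine ge_of_tendsto hg.tendsto_atTop ?_
      filter_upwards [eventually_gt_atTop 0] with s hs
      refine le_trans ?_ (hKle s hs)
      have hms : MeasurableSet {p : Icc (0 : ℝ) 1 | (p : ℝ) = 0} :=
        measurableSet_eq_fun (by fun_prop) (by fun_prop)
      rw [← integral_indicator_one hms]
      refine integral_mono ((integrable_const (1 : ℝ)).indicator hms) (hkint s hs) fun p => ?_
      by_cases hp : (p : ℝ) = 0
      · rw [indicator_of_mem (show p ∈ {p : Icc (0 : ℝ) 1 | (p : ℝ) = 0} from hp)]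
        simp [hk, hp]
      · rw [indicator_of_notMem (show p ∉ {p : Icc (0 : ℝ) 1 | (p : ℝ) = 0} from hp)]
        exact (one_div_pos.2 (hkpos s hs p)).le
    have h2 : ν {p : Icc (0 : ℝ) 1 | (p : ℝ) = 0} = 0 := by
      rw [← measureReal_eq_zero_iff]
      exact le_antisymm h1 measureReal_nonneg
    rw [ae_iff]
    refine measure_mono_null (fun p hp => ?_) h2
    exact le_antisymm (not_lt.1 hp) p.2.1
  have hinv : ∫⁻ p : Icc (0 : ℝ) 1, ENNReal.ofReal (1 / (p : ℝ)) ∂ν ≤ ENNReal.ofReal lam := by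
    have hF := lintegral_liminf_le (μ := ν) (u := atTop)
      (f := fun (n : ℕ) p => ENNReal.ofReal (((n : ℝ) + 1) * k ((n : ℝ) + 1) p))
      fun n => ((hkm _).const_mul _).ennreal_ofReal
    refine le_trans (lintegral_mono_ae ?_) (hF.trans ?_)
    · filter_upwards [hzero] with p hp
      have h1 : Tendsto (fun n : ℕ => ENNReal.ofReal (((n : ℝ) + 1) * k ((n : ℝ) + 1) p)) atTop
          (𝓝 (ENNReal.ofReal (1 / (p : ℝ)))) := by
        refine ENNReal.tendsto_ofReal ?_
        have h2 : Tendsto (fun n : ℕ => 1 / ((p : ℝ) + (1 - p) * (1 / ((n : ℝ) + 1)))) atTop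
            (𝓝 (1 / ((p : ℝ) + (1 - p) * 0))) := by
          refine tendsto_const_nhds.div (tendsto_const_nhds.add
            (tendsto_one_div_add_atTop_nhds_zero_nat.const_mul _)) ?_
          simpa using hp.ne'
        simp only [mul_zero, add_zero] at h2
        refine h2.congr fun n => ?_
        have hn : (0 : ℝ) < n + 1 := by positivity
        have h3 := (hkpos _ hn p).ne'
        simp only [hk]
        field_simp
      exact h1.liminf_eq.ge
    · refine Filter.liminf_le_of_frequently_le' (Frequently.of_forall fun n => ?_)
      have hn : (0 : ℝ) < n + 1 := by positivity
      rw [← ofReal_integral_eq_lintegral_ofReal ((hkint _ hn).const_mul _)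
        (.of_forall fun p => mul_nonneg hn.le (one_div_pos.2 (hkpos _ hn p)).le)]
      exact ENNReal.ofReal_le_ofReal (hKle' _ hn)
  set d : Icc (0 : ℝ) 1 → ℝ≥0 := fun p => (1 / (lam * p) : ℝ).toNNReal with hd
  have hdm : Measurable d := by simp only [hd]; fun_prop
  set R : Icc (0 : ℝ) 1 → ℝ≥0 := fun p => ((1 - p) / p : ℝ).toNNReal with hR
  have hRm : Measurable R := by simp only [hR]; fun_prop
  set μ : Measure ℝ≥0 := (ν.withDensity fun p => (d p : ENNReal)).map R with hμ
  have hfin' : IsFiniteMeasure (ν.withDensity fun p => (d p : ENNReal)) := by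
    refine isFiniteMeasure_withDensity (ne_of_lt ?_)
    have h1 : ∀ p, (d p : ENNReal) = ENNReal.ofReal (1 / lam) * ENNReal.ofReal (1 / (p : ℝ)) := by
      intro p
      rw [← ENNReal.ofReal_mul (by positivity), one_div_mul_one_div]
      rfl
    simp only [h1]
    rw [lintegral_const_mul _ (by fun_prop)]
    exact ENNReal.mul_lt_top ENNReal.ofReal_lt_top (hinv.trans_lt ENNReal.ofReal_lt_top)
  have hfin : IsFiniteMeasure μ := by rw [hμ]; infer_instance
  have hst : ∀ s : ℝ, 0 < s → ∫ r : ℝ≥0, 1 / (s + r) ∂μ = G s / (lam + s * G s) := by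
    intro s hs
    rw [hμ, integral_map hRm.aemeasurable (Measurable.aestronglyMeasurable (by fun_prop)),
      integral_withDensity_eq_integral_smul hdm]
    have h1 : ∫ p, d p • (1 / (s + (R p : ℝ))) ∂ν = ∫ p, 1 / lam * k s p ∂ν := by
      refine integral_congr_ae ?_
      filter_upwards [hzero] with p hp
      have hp1 : (0 : ℝ) ≤ 1 - p := by linarith [p.2.2]
      simp only [hd, hR, hk, NNReal.smul_def, smul_eq_mul]
      rw [Real.coe_toNNReal _ (by positivity), Real.coe_toNNReal _ (by positivity)]
      have := (hkpos s hs p).ne'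
      have h2 : s + (1 - (p : ℝ)) / p = (s * p + (1 - p)) / p := by field_simp
      rw [h2]
      field_simp
    rw [h1, integral_const_mul, hK s hs]
    have := hG0 s hs
    have h2 : (0 : ℝ) < 1 + s * G s / lam := by positivity
    have h3 : (0 : ℝ) < lam + s * G s := by positivity
    field_simp
  have hint1 : ∀ s : ℝ, 0 < s → ∀ r : ℝ≥0, ‖s * (1 / (s + r))‖ ≤ (1 : ℝ) := by
    intro s hs r
    rw [Real.norm_eq_abs, abs_of_nonneg (by positivity), mul_one_div, div_le_one (by positivity)]
    exact le_add_of_nonneg_right r.coe_nonneg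
  refine ⟨μ, ?_, ?_, hst⟩
  · have h1 : Tendsto (fun s : ℝ => ∫ r : ℝ≥0, s * (1 / (s + r)) ∂μ) atTop
        (𝓝 (∫ _r : ℝ≥0, (1 : ℝ) ∂μ)) := by
      refine tendsto_integral_filter_of_dominated_convergence (fun _ => 1) ?_ ?_
        (integrable_const _) (.of_forall fun r => ?_)
      · exact .of_forall fun s => Measurable.aestronglyMeasurable (by fun_prop)
      · filter_upwards [eventually_gt_atTop 0] with s hs
        exact .of_forall (hint1 s hs)
      · have h2 : Tendsto (fun s : ℝ => 1 - r * (s + r)⁻¹) atTop (𝓝 (1 - r * 0)) :=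
          tendsto_const_nhds.sub ((tendsto_inv_atTop_zero.comp
            (tendsto_atTop_add_const_right _ _ tendsto_id)).const_mul _)
        rw [mul_zero, sub_zero] at h2
        refine h2.congr' ?_
        filter_upwards [eventually_gt_atTop 0] with s hs
        have : s + (r : ℝ) ≠ 0 := by positivity
        field_simp
        ring
    have h2 : Tendsto (fun s : ℝ => ∫ r : ℝ≥0, s * (1 / (s + r)) ∂μ) atTop (𝓝 1) := by
      have h3 : Tendsto (fun s : ℝ => 1 - lam * (lam + s * G s)⁻¹) atTop (𝓝 (1 - lam * 0)) :=
        tendsto_const_nhds.sub ((tendsto_inv_atTop_zero.comp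
          (tendsto_atTop_add_const_left _ _ hg.mul_tendsto_atTop)).const_mul _)
      rw [mul_zero, sub_zero] at h3
      refine h3.congr' ?_
      filter_upwards [eventually_gt_atTop 0] with s hs
      rw [integral_const_mul, hst s hs]
      have := hG0 s hs
      have : lam + s * G s ≠ 0 := by positivity
      field_simp
      ring
    have h3 := tendsto_nhds_unique h1 h2
    rw [integral_const, smul_eq_mul, mul_one] at h3
    exact ⟨by rw [measureReal_def] at h3; rw [← ENNReal.toReal_eq_one_iff]; exact h3⟩
  · have h1 : μ.real {0} ≤ 0 := by
      have h2 : Tendsto (fun s : ℝ => s * G s / lam) (𝓝[>] 0) (𝓝 0) := by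
        simpa using hg.mul_tendsto_zero.div_const lam
      refine ge_of_tendsto h2 ?_
      filter_upwards [self_mem_nhdsWithin] with s hs
      have hs : 0 < s := hs
      have h3 : s * G s / (lam + s * G s) ≤ s * G s / lam := by
        have := hG0 s hs
        gcongr
        exact le_add_of_nonneg_right (by positivity)
      refine le_trans ?_ h3
      rw [mul_div_assoc, ← hst s hs, ← integral_const_mul,
        ← integral_indicator_one (measurableSet_singleton 0)]
      refine integral_mono ((integrable_const (1 : ℝ)).indicator (measurableSet_singleton 0))
        (Integrable.of_bound (C := 1) (Measurable.aestronglyMeasurable (by fun_prop))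
          (.of_forall (hint1 s hs))) fun r => ?_
      by_cases hr : r = 0
      · subst hr; simp [hs.ne']
      · rw [indicator_of_notMem (by simpa using hr)]
        positivity
    rw [← measureReal_eq_zero_iff]
    exact le_antisymm h1 measureReal_nonneg

end GenDiff
end RelaxationProbability

section CausalConvolution

namespace GenDiff

variable {F : Type*} [NormedAddCommGroup F] [NormedSpace ℝ F]

/-- The causal convolution `∫₀ᵗ a(t - τ) v(τ) dτ`. -/
noncomputable def causalConv (a : ℝ → ℝ) (v : ℝ → F) (t : ℝ) : F :=
  ∫ τ in (0 : ℝ)..t, a (t - τ) • v τ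

theorem causalConv_congr {a : ℝ → ℝ} {v w : ℝ → F} {t : ℝ} (h : EqOn v w (Icc 0 t)) (ht : 0 ≤ t) :
    causalConv a v t = causalConv a w t := by
  refine intervalIntegral.integral_congr fun τ hτ => ?_
  rw [uIcc_of_le ht] at hτ
  simp only [h hτ]

theorem causalConv_eq_setIntegral (a : ℝ → ℝ) (v : ℝ → F) {t T : ℝ} (ht : 0 ≤ t) (htT : t ≤ T) :
    causalConv a v t = ∫ u in Ioc 0 T, (Ioc 0 t).indicator (fun u => a u • v (t - u)) u := by
  have h1 : causalConv a v t = ∫ u in (0 : ℝ)..t, a u • v (t - u) := by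
    have := intervalIntegral.integral_comp_sub_left (a := 0) (b := t)
      (fun u => a u • v (t - u)) t
    simp only [sub_sub_cancel, sub_self, sub_zero] at this
    exact this
  rw [h1, intervalIntegral.integral_of_le ht, setIntegral_indicator measurableSet_Ioc,
    inter_eq_right.2 (Ioc_subset_Ioc_right htT)]

theorem integrable_indicator_smul_comp_sub {a : ℝ → ℝ} {v : ℝ → F}
    (ha : ∀ T, IntegrableOn a (Ioc 0 T)) (hv : ContinuousOn v (Ici 0)) (t T : ℝ) :
    Integrable ((Ioc 0 t).indicator fun u => a u • v (t - u)) (volume.restrict (Ioc 0 T)) := by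
  refine Integrable.integrableOn ?_
  rw [integrable_indicator_iff measurableSet_Ioc]
  have hc : ContinuousOn (fun u => v (t - u)) (Icc 0 t) :=
    hv.comp (by fun_prop) fun u hu => sub_nonneg.2 hu.2
  exact (((integrableOn_Icc_iff_integrableOn_Ioc).2 (ha t)).smul_continuousOn hc
    isCompact_Icc).mono_set Ioc_subset_Icc_self

theorem intervalIntegrable_causalConv {a : ℝ → ℝ} {v : ℝ → F}
    (ha : ∀ T, IntegrableOn a (Ioc 0 T)) (hv : ContinuousOn v (Ici 0)) {t : ℝ} (ht : 0 ≤ t) :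
    IntervalIntegrable (fun τ => a (t - τ) • v τ) volume 0 t := by
  have h1 := integrable_indicator_smul_comp_sub ha hv t t
  have h2 : IntervalIntegrable (fun u => a u • v (t - u)) volume 0 t := by
    rw [intervalIntegrable_iff_integrableOn_Ioc_of_le ht]
    exact h1.congr ((ae_restrict_iff' measurableSet_Ioc).2 (.of_forall fun u hu => by
      rw [indicator_of_mem hu]))
  have h3 := (h2.comp_sub_left t).symm
  simpa using h3

theorem continuousOn_causalConv {a : ℝ → ℝ} {v : ℝ → F} (ha : ∀ T, IntegrableOn a (Ioc 0 T))
    (hv : ContinuousOn v (Ici 0)) : ContinuousOn (causalConv a v) (Ici 0) := by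
  intro t₀ ht₀
  have ht₀ : 0 ≤ t₀ := ht₀
  set T := t₀ + 1 with hT
  obtain ⟨M, hM⟩ := isCompact_Icc.exists_bound_of_continuousOn
    (hv.mono (Icc_subset_Ici_self : Icc 0 T ⊆ Ici 0))
  have hev : ∀ᶠ t in 𝓝[Ici 0] t₀, 0 ≤ t ∧ t < T := by
    filter_upwards [self_mem_nhdsWithin, mem_nhdsWithin_of_mem_nhds
      (Iio_mem_nhds (lt_add_one t₀))] with t h1 h2
    exact ⟨h1, h2⟩
  have key : Tendsto (fun t => ∫ u in Ioc 0 T, (Ioc 0 t).indicator (fun u => a u • v (t - u)) u)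
      (𝓝[Ici 0] t₀)
      (𝓝 (∫ u in Ioc 0 T, (Ioc 0 t₀).indicator (fun u => a u • v (t₀ - u)) u)) := by
    refine tendsto_integral_filter_of_dominated_convergence (fun u => |a u| * M) ?_ ?_
      ((ha T).abs.mul_const M) ?_
    · exact .of_forall fun t => (integrable_indicator_smul_comp_sub ha hv t T).aestronglyMeasurable
    · filter_upwards [hev] with t ht
      refine .of_forall fun u => ?_
      have hM0 : 0 ≤ M := (norm_nonneg _).trans (hM 0 ⟨le_rfl, by linarith⟩)
      by_cases hu : u ∈ Ioc 0 t
      · rw [indicator_of_mem hu, norm_smul, Real.norm_eq_abs]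
        gcongr
        exact hM _ ⟨sub_nonneg.2 hu.2, by linarith [hu.1, ht.2]⟩
      · rw [indicator_of_notMem hu, norm_zero]
        positivity
    · have hne : ∀ᵐ u ∂(volume.restrict (Ioc 0 T)), u ≠ t₀ :=
        ae_restrict_of_ae (Measure.ae_ne volume t₀)
      filter_upwards [hne, ae_restrict_mem measurableSet_Ioc] with u hu hu'
      rcases lt_or_gt_of_ne hu with hlt | hgt
      · have h1 : Tendsto (fun t => a u • v (t - u)) (𝓝[Ici 0] t₀) (𝓝 (a u • v (t₀ - u))) := by
          have hvc : ContinuousAt v (t₀ - u) :=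
            hv.continuousAt (Ici_mem_nhds (sub_pos.2 hlt))
          have : Tendsto (fun t => v (t - u)) (𝓝 t₀) (𝓝 (v (t₀ - u))) :=
            hvc.tendsto.comp (tendsto_id.sub_const u)
          exact (this.const_smul (a u)).mono_left nhdsWithin_le_nhds
        rw [indicator_of_mem (show u ∈ Ioc 0 t₀ from ⟨hu'.1, hlt.le⟩)]
        refine h1.congr' ?_
        filter_upwards [mem_nhdsWithin_of_mem_nhds (Ioi_mem_nhds hlt)] with t ht
        rw [indicator_of_mem (show u ∈ Ioc 0 t from ⟨hu'.1, le_of_lt ht⟩)]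
      · rw [indicator_of_notMem (fun h => not_le.2 hgt h.2)]
        refine tendsto_const_nhds.congr' ?_
        filter_upwards [mem_nhdsWithin_of_mem_nhds (Iio_mem_nhds hgt)] with t ht
        rw [indicator_of_notMem (fun h => not_le.2 ht h.2)]
  rw [ContinuousWithinAt, causalConv_eq_setIntegral a v ht₀ (lt_add_one t₀).le]
  refine key.congr' ?_
  filter_upwards [hev] with t ht
  rw [causalConv_eq_setIntegral a v ht.1 ht.2.le]

theorem causalConv_zero (a : ℝ → ℝ) (v : ℝ → F) : causalConv a v 0 = 0 := by
  simp [causalConv]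

theorem causalConv_one_left (v : ℝ → F) (t : ℝ) :
    causalConv (fun _ => 1) v t = ∫ τ in (0 : ℝ)..t, v τ := by
  simp [causalConv]

theorem causalConv_one_right (a : ℝ → ℝ) (t : ℝ) :
    causalConv a (fun _ => (1 : ℝ)) t = ∫ τ in (0 : ℝ)..t, a τ := by
  simp [causalConv]

/-- The functions whose Laplace transform converges absolutely on `(0, ∞)`. -/
def LaplaceIntegrable (a : ℝ → ℝ) : Prop :=
  ∀ s : ℝ, 0 < s → IntegrableOn (fun t => Real.exp (-(t * s)) * a t) (Ioi 0)

theorem exp_mul_causalConv (a b : ℝ → ℝ) (s t : ℝ) :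
    Real.exp (-(t * s)) * causalConv a b t = ∫ τ in (0 : ℝ)..t,
      ContinuousLinearMap.mul ℝ ℝ (Real.exp (-(τ * s)) * b τ)
        (Real.exp (-((t - τ) * s)) * a (t - τ)) := by
  rw [causalConv, ← intervalIntegral.integral_const_mul]
  congr 1
  ext τ
  rw [ContinuousLinearMap.mul_apply',
    show -(t * s) = -(τ * s) + -((t - τ) * s) by ring, Real.exp_add, smul_eq_mul]
  ring

theorem LaplaceIntegrable.causalConv {a b : ℝ → ℝ} (ha : LaplaceIntegrable a)
    (hb : LaplaceIntegrable b) : LaplaceIntegrable (causalConv a b) := by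
  intro s hs
  have := integrable_posConvolution (hb s hs) (ha s hs) (ContinuousLinearMap.mul ℝ ℝ)
  rw [posConvolution, integrable_indicator_iff measurableSet_Ioi] at this
  simpa only [exp_mul_causalConv] using this

theorem laplaceTransform_causalConv {a b : ℝ → ℝ} (ha : LaplaceIntegrable a)
    (hb : LaplaceIntegrable b) {s : ℝ} (hs : 0 < s) :
    laplaceTransform (causalConv a b) s = laplaceTransform a s * laplaceTransform b s := by
  have := integral_posConvolution (hb s hs) (ha s hs) (ContinuousLinearMap.mul ℝ ℝ)
  rw [laplaceTransform]
  simp only [exp_mul_causalConv]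
  rw [this, ContinuousLinearMap.mul_apply', mul_comm]
  rfl

theorem LaplaceIntegrable.integrableOn_Ioc {a : ℝ → ℝ} (ha : LaplaceIntegrable a) (T : ℝ) :
    IntegrableOn a (Ioc 0 T) := by
  have h1 : IntegrableOn (fun t => Real.exp (-(t * 1)) * a t) (Icc 0 T) :=
    (integrableOn_Icc_iff_integrableOn_Ioc).2 ((ha 1 one_pos).mono_set Ioc_subset_Ioi_self)
  have h2 := h1.continuousOn_mul (g := fun t => Real.exp t) (by fun_prop) isCompact_Icc
  refine (h2.mono_set Ioc_subset_Icc_self).congr (.of_forall fun t => ?_)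
  simp only [mul_one, ← mul_assoc, ← Real.exp_add, add_neg_cancel, Real.exp_zero, one_mul]

theorem laplaceIntegrable_of_bounded {v : ℝ → ℝ} {C : ℝ} (hv : ContinuousOn v (Ioi 0))
    (hC : ∀ t, 0 < t → |v t| ≤ C) : LaplaceIntegrable v := by
  intro s hs
  refine Integrable.mul_bdd (c := C) (integrableOn_exp_neg_mul hs)
    (hv.aestronglyMeasurable measurableSet_Ioi) ?_
  exact (ae_restrict_iff' measurableSet_Ioi).2 (.of_forall hC)

theorem laplaceIntegrable_one : LaplaceIntegrable fun _ => 1 :=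
  laplaceIntegrable_of_bounded continuousOn_const (C := 1) (by simp)

theorem laplaceTransform_one {s : ℝ} (hs : 0 < s) : laplaceTransform (fun _ => 1) s = 1 / s := by
  simp only [laplaceTransform, mul_one, integral_exp_neg_mul hs]

theorem LaplaceIntegrable.add {a b : ℝ → ℝ} (ha : LaplaceIntegrable a)
    (hb : LaplaceIntegrable b) : LaplaceIntegrable fun t => a t + b t := fun s hs => by
  simp only [mul_add]
  exact (ha s hs).add (hb s hs)

theorem LaplaceIntegrable.const_mul {a : ℝ → ℝ} (ha : LaplaceIntegrable a) (c : ℝ) :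
    LaplaceIntegrable fun t => c * a t := fun s hs => by
  simp only [mul_left_comm _ c]
  exact Integrable.const_mul (ha s hs) c

theorem laplaceTransform_add {a b : ℝ → ℝ} (ha : LaplaceIntegrable a)
    (hb : LaplaceIntegrable b) {s : ℝ} (hs : 0 < s) :
    laplaceTransform (fun t => a t + b t) s = laplaceTransform a s + laplaceTransform b s := by
  simp only [laplaceTransform, mul_add]
  exact integral_add (ha s hs) (hb s hs)

theorem laplaceTransform_const_mul (a : ℝ → ℝ) (c s : ℝ) :
    laplaceTransform (fun t => c * a t) s = c * laplaceTransform a s := by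
  simp only [laplaceTransform, mul_left_comm _ c, integral_const_mul]

/-- Continuous functions with the same Laplace transform coincide. -/
theorem eq_of_laplaceTransform_eq {a b : ℝ → ℝ} (ha : LaplaceIntegrable a)
    (hb : LaplaceIntegrable b) (hac : ContinuousOn a (Ioi 0)) (hbc : ContinuousOn b (Ioi 0))
    (h : ∀ s : ℝ, 0 < s → laplaceTransform a s = laplaceTransform b s) {t : ℝ} (ht : 0 < t) :
    a t = b t := by
  have hb' := hb.const_mul (-1)
  have := eq_zero_of_laplace_eq_zero (f := fun t => a t + -1 * b t)
    (hac.add (continuousOn_const.mul hbc)) (ha.add hb') (fun s hs => by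
      rw [laplaceTransform_add ha hb' hs, laplaceTransform_const_mul, h s hs]; ring) t ht
  linarith

end GenDiff
end CausalConvolution

section RelaxationFunction

namespace GenDiff

theorem pow_mul_exp_neg_le (m : ℕ) {r t : ℝ} (hr : 0 ≤ r) (ht : 0 < t) :
    r ^ m * Real.exp (-(r * t)) ≤ ((m : ℝ) / (Real.exp 1 * t)) ^ m := by
  rcases Nat.eq_zero_or_pos m with rfl | hm
  · simpa using mul_nonneg hr ht.le
  have hm' : (0 : ℝ) < m := Nat.cast_pos.2 hm
  have h1 : r * t / m ≤ Real.exp (r * t / m - 1) := by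
    linarith [Real.add_one_le_exp (r * t / m - 1)]
  have h2 : (r * t / m) ^ m ≤ Real.exp (r * t) / Real.exp 1 ^ m := by
    calc (r * t / m) ^ m ≤ Real.exp (r * t / m - 1) ^ m := by gcongr
      _ = Real.exp (r * t) / Real.exp 1 ^ m := by
        rw [← Real.exp_nat_mul, ← Real.exp_nat_mul, ← Real.exp_sub]
        congr 1
        field_simp
  rw [Real.exp_neg, ← div_eq_mul_inv, div_le_iff₀ (Real.exp_pos _)]
  have h3 : r ^ m = (r * t / m) ^ m * ((m : ℝ) / t) ^ m := by
    rw [← mul_pow]; congr 1; field_simp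
  have h4 : ((m : ℝ) / (Real.exp 1 * t)) ^ m * Real.exp (r * t)
      = Real.exp (r * t) / Real.exp 1 ^ m * ((m : ℝ) / t) ^ m := by
    rw [div_pow, div_pow, mul_pow]; field_simp
  rw [h3, h4]
  gcongr

/-- The `m`-th derivative of the Laplace transform of a measure on `[0, ∞)`. -/
noncomputable def expMoment (μ : Measure ℝ≥0) (m : ℕ) (t : ℝ) : ℝ :=
  ∫ r : ℝ≥0, (-(r : ℝ)) ^ m * Real.exp (-(r * t)) ∂μ

theorem abs_neg_pow_mul_exp_le (m : ℕ) (r : ℝ≥0) {t : ℝ} (ht : 0 < t) :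
    ‖(-(r : ℝ)) ^ m * Real.exp (-(r * t))‖ ≤ ((m : ℝ) / (Real.exp 1 * t)) ^ m := by
  rw [norm_mul, norm_pow, norm_neg, Real.norm_eq_abs, Real.norm_eq_abs, Real.abs_exp,
    abs_of_nonneg r.coe_nonneg]
  exact pow_mul_exp_neg_le m r.coe_nonneg ht

variable {μ : Measure ℝ≥0} [IsProbabilityMeasure μ]

theorem abs_expMoment_le (m : ℕ) {t : ℝ} (ht : 0 < t) :
    |expMoment μ m t| ≤ ((m : ℝ) / (Real.exp 1 * t)) ^ m := by
  have := norm_integral_le_of_norm_le_const (μ := μ)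
    (.of_forall fun r => abs_neg_pow_mul_exp_le m r ht)
  simpa [expMoment] using this

theorem hasDerivAt_expMoment (m : ℕ) {t : ℝ} (ht : 0 < t) :
    HasDerivAt (expMoment μ m) (expMoment μ (m + 1) t) t := by
  have hpos : ∀ x ∈ Ioi (t / 2), 0 < x := fun x hx => (half_pos ht).trans hx
  refine (hasDerivAt_integral_of_dominated_loc_of_deriv_le (μ := μ) (s := Ioi (t / 2))
    (F := fun t r => (-(r : ℝ)) ^ m * Real.exp (-(r * t)))
    (F' := fun t r => (-(r : ℝ)) ^ (m + 1) * Real.exp (-(r * t)))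
    (bound := fun _ => (((m + 1 : ℕ) : ℝ) / (Real.exp 1 * (t / 2))) ^ (m + 1))
    (Ioi_mem_nhds (half_lt_self ht)) ?_ ?_ ?_ ?_ (integrable_const _) ?_).2
  · exact .of_forall fun x => Measurable.aestronglyMeasurable (by fun_prop)
  · exact Integrable.of_bound (Measurable.aestronglyMeasurable (by fun_prop)) _
      (.of_forall fun r => abs_neg_pow_mul_exp_le m r ht)
  · exact Measurable.aestronglyMeasurable (by fun_prop)
  · refine .of_forall fun r x hx => (abs_neg_pow_mul_exp_le (m + 1) r (hpos x hx)).trans ?_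
    have h2 := half_pos ht
    have h3 := hpos x hx
    gcongr
    exact le_of_lt (mem_Ioi.1 hx)
  · refine .of_forall fun r x hx => ?_
    have h1 : HasDerivAt (fun x => Real.exp (-(r * x))) (Real.exp (-(r * x)) * -(r * 1)) x :=
      ((hasDerivAt_id x).const_mul (r : ℝ)).neg.exp
    refine (h1.const_mul ((-(r : ℝ)) ^ m)).congr_deriv ?_
    rw [pow_succ]; ring

theorem abs_exp_neg_mul_le_one (r : ℝ≥0) {t : ℝ} (ht : 0 ≤ t) :
    ‖(-(r : ℝ)) ^ 0 * Real.exp (-(r * t))‖ ≤ 1 := by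
  rw [pow_zero, one_mul, Real.norm_eq_abs, Real.abs_exp, Real.exp_le_one_iff]
  exact neg_nonpos.2 (mul_nonneg r.coe_nonneg ht)

theorem abs_expMoment_zero_le {t : ℝ} (ht : 0 ≤ t) : |expMoment μ 0 t| ≤ 1 := by
  have := norm_integral_le_of_norm_le_const (μ := μ)
    (.of_forall fun r => abs_exp_neg_mul_le_one r ht)
  simpa [expMoment] using this

theorem continuousOn_expMoment_zero : ContinuousOn (expMoment μ 0) (Ici 0) := by
  intro t ht
  refine continuousWithinAt_of_dominated (bound := fun _ => 1) ?_ ?_ (integrable_const _) ?_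
  · exact .of_forall fun x => Measurable.aestronglyMeasurable (by fun_prop)
  · filter_upwards [self_mem_nhdsWithin] with x hx
    exact .of_forall fun r => abs_exp_neg_mul_le_one r hx
  · exact .of_forall fun r => by fun_prop

theorem tendsto_expMoment_zero (h0 : μ {0} = 0) : Tendsto (expMoment μ 0) atTop (𝓝 0) := by
  have : Tendsto (expMoment μ 0) atTop (𝓝 (∫ _r : ℝ≥0, (0 : ℝ) ∂μ)) := by
    refine tendsto_integral_filter_of_dominated_convergence (fun _ => 1) ?_ ?_
      (integrable_const _) ?_
    · exact .of_forall fun x => Measurable.aestronglyMeasurable (by fun_prop)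
    · filter_upwards [eventually_ge_atTop 0] with x hx
      exact .of_forall fun r => abs_exp_neg_mul_le_one r hx
    · have hne : ∀ᵐ r ∂μ, r ≠ 0 := by
        rw [ae_iff]; simpa using h0
      filter_upwards [hne] with r hr
      have hr' : (0 : ℝ) < r := NNReal.coe_pos.2 (pos_iff_ne_zero.2 hr)
      simp only [pow_zero, one_mul]
      exact Real.tendsto_exp_neg_atTop_nhds_zero.comp (tendsto_id.const_mul_atTop hr')
  simpa using this

/-- Existence of the relaxation function `W 0` with derivatives `W m`. -/
theorem IsMemoryKernel.exists_relaxation {g : ℝ → ℝ} (hg : IsMemoryKernel g) {lam : ℝ}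
    (hl : 0 < lam) : ∃ W : ℕ → ℝ → ℝ,
      (∀ m t, 0 < t → HasDerivAt (W m) (W (m + 1) t) t) ∧
      (∀ m t, 0 < t → |W m t| ≤ ((m : ℝ) / (Real.exp 1 * t)) ^ m) ∧
      ContinuousOn (W 0) (Ici 0) ∧ W 0 0 = 1 ∧ (∀ t, 0 ≤ t → |W 0 t| ≤ 1) ∧
      Tendsto (W 0) atTop (𝓝 0) ∧
      (∀ s, 0 < s → laplaceTransform (W 0) s
        = laplaceTransform g s / (lam + s * laplaceTransform g s)) ∧
      ∀ t, 0 ≤ t → causalConv g (W 0) t + lam * (∫ τ in (0 : ℝ)..t, W 0 τ)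
        = ∫ τ in (0 : ℝ)..t, g τ := by
  obtain ⟨μ, hμ, hμ0, hst⟩ := hg.exists_relaxation_measure hl
  have hlap : ∀ s, 0 < s → laplaceTransform (expMoment μ 0) s
      = laplaceTransform g s / (lam + s * laplaceTransform g s) := by
    intro s hs
    rw [← hst s hs]
    have := laplaceTransform_mixture (ρ := μ) (h := fun _ => 1) measurable_const
      (fun r => by simp) hs
    rw [← this]
    congr 1
  refine ⟨expMoment μ, fun m t ht => hasDerivAt_expMoment m ht,
    fun m t ht => abs_expMoment_le m ht, continuousOn_expMoment_zero, by simp [expMoment],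
    fun t ht => abs_expMoment_zero_le ht, tendsto_expMoment_zero hμ0, hlap, ?_⟩
  intro t ht
  rcases ht.eq_or_lt with rfl | ht
  · simp [causalConv_zero]
  have hgL : LaplaceIntegrable g := hg.laplace_exists
  have hWc : ContinuousOn (expMoment μ 0) (Ici 0) := continuousOn_expMoment_zero
  have hWL : LaplaceIntegrable (expMoment μ 0) :=
    laplaceIntegrable_of_bounded (hWc.mono Ioi_subset_Ici_self)
      fun t ht => abs_expMoment_zero_le ht.le
  have h1L := laplaceIntegrable_one
  rw [← causalConv_one_left, ← causalConv_one_right g]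
  refine eq_of_laplaceTransform_eq
    (a := fun t => causalConv g (expMoment μ 0) t
      + lam * causalConv (fun _ => 1) (expMoment μ 0) t)
    ((hgL.causalConv hWL).add ((h1L.causalConv hWL).const_mul lam)) (hgL.causalConv h1L)
    ?_ ?_ (fun s hs => ?_) ht
  · refine ContinuousOn.mono ?_ Ioi_subset_Ici_self
    exact (continuousOn_causalConv hgL.integrableOn_Ioc hWc).add
      (continuousOn_const.mul (continuousOn_causalConv h1L.integrableOn_Ioc hWc))
  · exact (continuousOn_causalConv hgL.integrableOn_Ioc continuousOn_const).mono
      Ioi_subset_Ici_self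
  · rw [laplaceTransform_add (hgL.causalConv hWL) ((h1L.causalConv hWL).const_mul lam) hs,
      laplaceTransform_const_mul, laplaceTransform_causalConv hgL hWL hs,
      laplaceTransform_causalConv h1L hWL hs, laplaceTransform_causalConv hgL h1L hs,
      laplaceTransform_one hs, hlap s hs]
    obtain ⟨ρ, hρ, hG, -⟩ := hg.exists_measure
    have hG0 : 0 ≤ laplaceTransform g s := by
      rw [hG s hs]; exact integral_nonneg fun r => by positivity
    have : lam + s * laplaceTransform g s ≠ 0 := by positivity
    field_simp
    ring

/-- Uniqueness for the scalar relaxation equation. -/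
theorem IsMemoryKernel.eq_zero_of_causalConv {g : ℝ → ℝ} (hg : IsMemoryKernel g) {lam : ℝ}
    (hl : 0 < lam) {d : ℝ → ℝ} (hd : ContinuousOn d (Ici 0))
    (h : ∀ t, 0 ≤ t → causalConv g d t + lam * ∫ τ in (0 : ℝ)..t, d τ = 0) :
    ∀ t, 0 ≤ t → d t = 0 := by
  obtain ⟨W, hWd, -, hWc, -, hWb, -, hWlap, -⟩ := hg.exists_relaxation hl
  have hgL : LaplaceIntegrable g := hg.laplace_exists
  have hWL : LaplaceIntegrable (W 0) :=
    laplaceIntegrable_of_bounded (hWc.mono Ioi_subset_Ici_self) fun t ht => hWb t ht.le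
  have h1L := laplaceIntegrable_one
  -- the convolution with `g` vanishes
  have hconv : ∀ t, 0 < t → causalConv g d t = 0 := by
    intro T hT
    let e : ℝ → ℝ := fun t => d (min t T)
    have hec : ContinuousOn e (Ici 0) :=
      hd.comp (by fun_prop) fun t ht => le_min ht hT.le
    have hde : EqOn e d (Icc 0 T) := fun t ht => by simp only [e, min_eq_left ht.2]
    obtain ⟨C, hC⟩ := isCompact_Icc.exists_bound_of_continuousOn
      (hd.mono (Icc_subset_Ici_self : Icc 0 T ⊆ Ici 0))
    have heL : LaplaceIntegrable e :=
      laplaceIntegrable_of_bounded (hec.mono Ioi_subset_Ici_self)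
        fun t ht => hC _ ⟨le_min ht.le hT.le, min_le_right _ _⟩
    let R : ℝ → ℝ := fun t => causalConv g e t + lam * causalConv (fun _ => 1) e t
    have hRL : LaplaceIntegrable R := (hgL.causalConv heL).add ((h1L.causalConv heL).const_mul lam)
    have hNc := continuousOn_causalConv hgL.integrableOn_Ioc hec
    have hRc : ContinuousOn R (Ici 0) :=
      hNc.add (continuousOn_const.mul (continuousOn_causalConv h1L.integrableOn_Ioc hec))
    have hR0 : EqOn R 0 (Icc 0 T) := by
      intro t ht
      have hsub : EqOn e d (Icc 0 t) := hde.mono (Icc_subset_Icc_right ht.2)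
      simp only [R]
      rw [causalConv_congr hsub ht.1, causalConv_congr hsub ht.1, causalConv_one_left]
      exact h t ht.1
    have hkey : ∀ t, 0 < t → causalConv (W 0) R t = ∫ τ in (0 : ℝ)..t, causalConv g e τ := by
      intro t ht
      rw [← causalConv_one_left]
      refine eq_of_laplaceTransform_eq (hWL.causalConv hRL) (h1L.causalConv (hgL.causalConv heL))
        ((continuousOn_causalConv hWL.integrableOn_Ioc hRc).mono Ioi_subset_Ici_self)
        ((continuousOn_causalConv h1L.integrableOn_Ioc hNc).mono Ioi_subset_Ici_self)
        (fun s hs => ?_) ht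
      rw [laplaceTransform_causalConv hWL hRL hs,
        laplaceTransform_causalConv h1L (hgL.causalConv heL) hs,
        laplaceTransform_add (hgL.causalConv heL) ((h1L.causalConv heL).const_mul lam) hs,
        laplaceTransform_const_mul, laplaceTransform_causalConv hgL heL hs,
        laplaceTransform_causalConv h1L heL hs, laplaceTransform_one hs, hWlap s hs]
      obtain ⟨ρ, hρ, hG, -⟩ := hg.exists_measure
      have hG0 : 0 ≤ laplaceTransform g s := by
        rw [hG s hs]; exact integral_nonneg fun r => by positivity
      have : lam + s * laplaceTransform g s ≠ 0 := by positivity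
      field_simp
      ring
    have hint0 : ∀ t ∈ Ioo 0 T, ∫ τ in (0 : ℝ)..t, causalConv g e τ = 0 := by
      intro t ht
      rw [← hkey t ht.1, causalConv_congr (hR0.mono (Icc_subset_Icc_right ht.2.le)) ht.1.le]
      simp [causalConv]
    have hN0 : ∀ t ∈ Ioo 0 T, causalConv g e t = 0 := by
      intro t ht
      have h1 : HasDerivAt (fun t => ∫ τ in (0 : ℝ)..t, causalConv g e τ) (causalConv g e t) t := by
        refine intervalIntegral.integral_hasDerivAt_right ?_ ?_ ?_
        · refine ContinuousOn.intervalIntegrable ?_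
          rw [uIcc_of_le ht.1.le]
          exact hNc.mono Icc_subset_Ici_self
        · exact ContinuousOn.stronglyMeasurableAtFilter isOpen_Ioi
            (hNc.mono Ioi_subset_Ici_self) t ht.1
        · exact hNc.continuousAt (Ici_mem_nhds ht.1)
      have h2 : HasDerivAt (fun t => ∫ τ in (0 : ℝ)..t, causalConv g e τ) 0 t := by
        refine (hasDerivAt_const t (0 : ℝ)).congr_of_eventuallyEq ?_
        filter_upwards [Ioo_mem_nhds ht.1 ht.2] with x hx using hint0 x hx
      exact h1.unique h2
    rw [← causalConv_congr hde hT.le]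
    have hcl : closure (Ioo 0 T) = Icc 0 T := closure_Ioo hT.ne
    have hEq : EqOn (causalConv g e) 0 (closure (Ioo 0 T)) :=
      EqOn.of_subset_closure (fun t ht => hN0 t ht) (hNc.mono Icc_subset_Ici_self)
        continuousOn_const Ioo_subset_Icc_self hcl.ge |>.mono hcl.le
    exact hEq (by rw [hcl]; exact ⟨hT.le, le_rfl⟩)
  have hint : ∀ t, 0 < t → ∫ τ in (0 : ℝ)..t, d τ = 0 := by
    intro t ht
    have := h t ht.le
    rw [hconv t ht, zero_add] at this
    exact (mul_eq_zero.1 this).resolve_left hl.ne'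
  have hpos : ∀ t ∈ Ioi (0 : ℝ), d t = 0 := by
    intro t ht
    have h1 : HasDerivAt (fun t => ∫ τ in (0 : ℝ)..t, d τ) (d t) t := by
      refine intervalIntegral.integral_hasDerivAt_right ?_ ?_ ?_
      · refine ContinuousOn.intervalIntegrable ?_
        rw [uIcc_of_le (le_of_lt ht)]
        exact hd.mono Icc_subset_Ici_self
      · exact ContinuousOn.stronglyMeasurableAtFilter isOpen_Ioi
          (hd.mono Ioi_subset_Ici_self) t ht
      · exact hd.continuousAt (Ici_mem_nhds ht)
    have h2 : HasDerivAt (fun t => ∫ τ in (0 : ℝ)..t, d τ) 0 t := by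
      refine (hasDerivAt_const t (0 : ℝ)).congr_of_eventuallyEq ?_
      filter_upwards [Ioi_mem_nhds ht] with x hx using hint x hx
    exact h1.unique h2
  have hEq : EqOn d 0 (Ici 0) :=
    EqOn.of_subset_closure (s := Ioi 0) (fun t ht => hpos t ht) hd continuousOn_const
      Ioi_subset_Ici_self (closure_Ioi (0 : ℝ)).ge
  intro t ht
  exact hEq ht

end GenDiff
end RelaxationFunction

section Evolution

namespace GenDiff

variable {H : Type*} [NormedAddCommGroup H] [InnerProductSpace ℝ H]

theorem ext_inner_basis {ψ : HilbertBasis ℕ ℝ H} {u v : H}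
    (h : ∀ j, inner ℝ (ψ j) u = inner ℝ (ψ j) v) : u = v := by
  apply ψ.repr.injective
  ext j
  simpa [ψ.repr_apply_apply] using h j

theorem norm_le_of_abs_inner_le {ψ : HilbertBasis ℕ ℝ H} {u w : H} {C : ℝ} (hC : 0 ≤ C)
    (h : ∀ j, |inner ℝ (ψ j) u| ≤ C * |inner ℝ (ψ j) w|) : ‖u‖ ≤ C * ‖w‖ := by
  have h1 := hasSum_inner_sq ψ u
  have h2 := (hasSum_inner_sq ψ w).mul_left (C ^ 2)
  have h3 : ‖u‖ ^ 2 ≤ C ^ 2 * ‖w‖ ^ 2 := by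
    refine hasSum_le (fun j => ?_) h1 h2
    rw [← sq_abs, ← sq_abs (inner ℝ (ψ j) w), ← mul_pow]
    exact pow_le_pow_left₀ (abs_nonneg _) (h j) 2
  rw [← mul_pow] at h3
  exact le_of_sq_le_sq h3 (by positivity)

/-- The image of `w` under the diagonal operator with entries `c j`. -/
noncomputable def diagSum (ψ : HilbertBasis ℕ ℝ H) (c : ℕ → ℝ) (w : H) : H :=
  ∑' j, (c j * inner ℝ (ψ j) w) • ψ j

theorem summable_mul_inner_sq (ψ : HilbertBasis ℕ ℝ H) {c : ℕ → ℝ} {C : ℝ}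
    (hc : ∀ j, |c j| ≤ C) (w : H) : Summable fun j => (c j * inner ℝ (ψ j) w) ^ 2 := by
  refine Summable.of_nonneg_of_le (fun j => sq_nonneg _) (fun j => ?_)
    ((hasSum_inner_sq ψ w).summable.mul_left (C ^ 2))
  rw [mul_pow]
  exact mul_le_mul_of_nonneg_right (sq_le_sq.2 ((hc j).trans (le_abs_self C))) (sq_nonneg _)

variable [CompleteSpace H]

theorem hasSum_diagSum (ψ : HilbertBasis ℕ ℝ H) {c : ℕ → ℝ} {C : ℝ} (hc : ∀ j, |c j| ≤ C) (w : H) :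
    HasSum (fun j => (c j * inner ℝ (ψ j) w) • ψ j) (diagSum ψ c w) := by
  obtain ⟨u, hu⟩ := exists_of_summable_coeff ψ (summable_mul_inner_sq ψ hc w)
  have := ψ.hasSum_repr u
  simp only [ψ.repr_apply_apply, hu] at this
  exact this.summable.hasSum

theorem inner_diagSum (ψ : HilbertBasis ℕ ℝ H) {c : ℕ → ℝ} {C : ℝ} (hc : ∀ j, |c j| ≤ C) (w : H)
    (j : ℕ) : inner ℝ (ψ j) (diagSum ψ c w) = c j * inner ℝ (ψ j) w := by
  obtain ⟨u, hu⟩ := exists_of_summable_coeff ψ (summable_mul_inner_sq ψ hc w)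
  have := ψ.hasSum_repr u
  simp only [ψ.repr_apply_apply, hu] at this
  rw [(hasSum_diagSum ψ hc w).unique this, hu]

theorem norm_diagSum_le (ψ : HilbertBasis ℕ ℝ H) {c : ℕ → ℝ} {C : ℝ} (hc : ∀ j, |c j| ≤ C)
    (w : H) : ‖diagSum ψ c w‖ ≤ C * ‖w‖ := by
  refine norm_le_of_abs_inner_le (ψ := ψ) ((abs_nonneg _).trans (hc 0)) fun j => ?_
  rw [inner_diagSum ψ hc, abs_mul]
  gcongr
  exact hc j

/-- Strong convergence of uniformly bounded diagonal operators. -/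
theorem tendsto_diagSum {ι : Type*} {l : Filter ι} (ψ : HilbertBasis ℕ ℝ H)
    {c : ι → ℕ → ℝ} {c₀ : ℕ → ℝ} {C : ℝ} (hc : ∀ᶠ i in l, ∀ j, |c i j| ≤ C)
    (hc₀ : ∀ j, |c₀ j| ≤ C) (h : ∀ j, Tendsto (fun i => c i j) l (𝓝 (c₀ j))) (w : H) :
    Tendsto (fun i => diagSum ψ (c i) w) l (𝓝 (diagSum ψ c₀ w)) := by
  rw [tendsto_iff_norm_sub_tendsto_zero]
  have h1 : Tendsto (fun i => ∑' j, ((c i j - c₀ j) * inner ℝ (ψ j) w) ^ 2) l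
      (𝓝 (∑' _j : ℕ, 0)) := by
    refine tendsto_tsum_of_dominated_convergence
      (bound := fun j => (2 * C) ^ 2 * (inner ℝ (ψ j) w) ^ 2)
      ((hasSum_inner_sq ψ w).summable.mul_left _) (fun j => ?_) ?_
    · have := (((h j).sub_const (c₀ j)).mul_const (inner ℝ (ψ j) w)).pow 2
      simpa using this
    · filter_upwards [hc] with i hi j
      rw [Real.norm_eq_abs, abs_of_nonneg (sq_nonneg _), mul_pow]
      refine mul_le_mul_of_nonneg_right (sq_le_sq.2 (le_trans ?_ (le_abs_self _))) (sq_nonneg _)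
      linarith [abs_sub (c i j) (c₀ j), hi j, hc₀ j]
  rw [tsum_zero] at h1
  have h2 := h1.sqrt
  rw [Real.sqrt_zero] at h2
  refine h2.congr' ?_
  filter_upwards [hc] with i hi
  have h3 := (hasSum_inner_sq ψ (diagSum ψ (c i) w - diagSum ψ c₀ w)).tsum_eq
  simp only [inner_sub_right, inner_diagSum ψ hi, inner_diagSum ψ hc₀, ← sub_mul] at h3
  rw [h3, Real.sqrt_sq (norm_nonneg _)]

/-- Scalar relaxation functions `W j 0` with their derivatives `W j m`. -/
structure IsRelaxationFamily (g : ℝ → ℝ) (ev : ℕ → ℝ) (W : ℕ → ℕ → ℝ → ℝ) : Prop where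
  deriv : ∀ j m t, 0 < t → HasDerivAt (W j m) (W j (m + 1) t) t
  bound : ∀ m t, 0 < t → ∀ j, |W j m t| ≤ ((m : ℝ) / (Real.exp 1 * t)) ^ m
  cont : ∀ j, ContinuousOn (W j 0) (Ici 0)
  one : ∀ j, W j 0 0 = 1
  bound_zero : ∀ t, 0 ≤ t → ∀ j, |W j 0 t| ≤ 1
  tendsto : ∀ j, Tendsto (W j 0) atTop (𝓝 0)
  eqn : ∀ j t, 0 ≤ t → causalConv g (W j 0) t + ev j * (∫ τ in (0 : ℝ)..t, W j 0 τ)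
        = ∫ τ in (0 : ℝ)..t, g τ

theorem IsMemoryKernel.exists_relaxationFamily {g : ℝ → ℝ} (hg : IsMemoryKernel g) {ev : ℕ → ℝ}
    (hev : ∀ j, 0 < ev j) : ∃ W, IsRelaxationFamily g ev W := by
  choose W h1 h2 h3 h4 h5 h6 _ h7 using fun j => hg.exists_relaxation (hev j)
  exact ⟨W, h1, fun m t ht j => h2 j m t ht, h3, h4, fun t ht j => h5 j t ht, h6, h7⟩

/-- The derivatives of the solution with initial value `w`. -/
noncomputable def evol (ψ : HilbertBasis ℕ ℝ H) (W : ℕ → ℕ → ℝ → ℝ) (m : ℕ) (t : ℝ) (w : H) : H :=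
  diagSum ψ (fun j => W j m t) w

namespace IsRelaxationFamily

variable {g : ℝ → ℝ} {ev : ℕ → ℝ} {W : ℕ → ℕ → ℝ → ℝ}

theorem remainder_le (hW : IsRelaxationFamily g ev W) (j m : ℕ) {t x : ℝ} (ht : 0 < t)
    (hx : x ∈ Ioi (t / 2)) :
    |W j m x - W j m t - (x - t) * W j (m + 1) t|
      ≤ (((m + 2 : ℕ) : ℝ) / (Real.exp 1 * (t / 2))) ^ (m + 2) * |x - t| * |x - t| := by
  have h2 := half_pos ht
  set C := (((m + 2 : ℕ) : ℝ) / (Real.exp 1 * (t / 2))) ^ (m + 2) with hC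
  have hC0 : 0 ≤ C := by positivity
  have htm : t ∈ Ioi (t / 2) := half_lt_self ht
  have h3 : ∀ y ∈ Ioi (t / 2), |W j (m + 1) y - W j (m + 1) t| ≤ C * |y - t| := by
    intro y hy
    refine (convex_Ioi (t / 2)).norm_image_sub_le_of_norm_hasDerivWithin_le
      (f' := fun y => W j (m + 2) y) (fun z hz => ?_) (fun z hz => ?_) htm hy
    · exact (hW.deriv j (m + 1) z (h2.trans hz)).hasDerivWithinAt
    · have hz0 : 0 < z := h2.trans hz
      refine (hW.bound (m + 2) z hz0 j).trans ?_
      rw [hC]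
      gcongr
      exact le_of_lt (mem_Ioi.1 hz)
  have hsub : uIcc t x ⊆ Ioi (t / 2) := (convex_Ioi (t / 2)).ordConnected.uIcc_subset htm hx
  have h4 := (convex_uIcc t x).norm_image_sub_le_of_norm_hasDerivWithin_le
    (f := fun y => W j m y - y * W j (m + 1) t)
    (f' := fun y => W j (m + 1) y - 1 * W j (m + 1) t) (C := C * |x - t|) (fun z hz => ?_)
    (fun z hz => ?_) left_mem_uIcc right_mem_uIcc
  · rw [Real.norm_eq_abs, Real.norm_eq_abs] at h4
    convert h4 using 2
    ring
  · exact ((hW.deriv j m z (h2.trans (hsub hz))).sub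
      ((hasDerivAt_id z).mul_const _)).hasDerivWithinAt
  · rw [one_mul]
    refine (h3 z (hsub hz)).trans ?_
    exact mul_le_mul_of_nonneg_left (abs_sub_left_of_mem_uIcc hz) hC0

theorem inner_evol (hW : IsRelaxationFamily g ev W) (ψ : HilbertBasis ℕ ℝ H) (m : ℕ) {t : ℝ}
    (ht : 0 < t) (w : H) (j : ℕ) : inner ℝ (ψ j) (evol ψ W m t w) = W j m t * inner ℝ (ψ j) w :=
  inner_diagSum ψ (hW.bound m t ht) w j

theorem inner_evol_zero (hW : IsRelaxationFamily g ev W) (ψ : HilbertBasis ℕ ℝ H) {t : ℝ}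
    (ht : 0 ≤ t) (w : H) (j : ℕ) : inner ℝ (ψ j) (evol ψ W 0 t w) = W j 0 t * inner ℝ (ψ j) w :=
  inner_diagSum ψ (hW.bound_zero t ht) w j

theorem norm_evol_le (hW : IsRelaxationFamily g ev W) (ψ : HilbertBasis ℕ ℝ H) (m : ℕ) {t : ℝ}
    (ht : 0 < t) (w : H) : ‖evol ψ W m t w‖ ≤ ((m : ℝ) / (Real.exp 1 * t)) ^ m * ‖w‖ :=
  norm_diagSum_le ψ (hW.bound m t ht) w

theorem norm_evol_zero_le (hW : IsRelaxationFamily g ev W) (ψ : HilbertBasis ℕ ℝ H) {t : ℝ}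
    (ht : 0 ≤ t) (w : H) : ‖evol ψ W 0 t w‖ ≤ ‖w‖ := by
  simpa [evol] using norm_diagSum_le ψ (hW.bound_zero t ht) w

theorem evol_zero_zero (hW : IsRelaxationFamily g ev W) (ψ : HilbertBasis ℕ ℝ H) (w : H) :
    evol ψ W 0 0 w = w :=
  ext_inner_basis (ψ := ψ) fun j => by
    rw [hW.inner_evol_zero ψ le_rfl, hW.one, one_mul]

theorem continuousOn_evol_zero (hW : IsRelaxationFamily g ev W) (ψ : HilbertBasis ℕ ℝ H) (w : H) :
    ContinuousOn (fun t => evol ψ W 0 t w) (Ici 0) := by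
  intro t ht
  refine tendsto_diagSum ψ (C := 1) ?_ (hW.bound_zero t ht) (fun j => hW.cont j t ht) w
  filter_upwards [self_mem_nhdsWithin] with x hx using hW.bound_zero x hx

theorem tendsto_evol_zero (hW : IsRelaxationFamily g ev W) (ψ : HilbertBasis ℕ ℝ H) (w : H) :
    Tendsto (fun t => evol ψ W 0 t w) atTop (𝓝 0) := by
  have h := tendsto_diagSum (l := atTop) ψ (C := 1) (c := fun t j => W j 0 t) (c₀ := fun _ => 0)
    (by filter_upwards [eventually_ge_atTop 0] with x hx using hW.bound_zero x hx)
    (by simp) hW.tendsto w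
  simpa [diagSum, evol] using h

theorem hasDerivAt_evol (hW : IsRelaxationFamily g ev W) (ψ : HilbertBasis ℕ ℝ H) (m : ℕ) {t : ℝ}
    (ht : 0 < t) (w : H) : HasDerivAt (fun x => evol ψ W m x w) (evol ψ W (m + 1) t w) t := by
  rw [hasDerivAt_iff_tendsto]
  set C := (((m + 2 : ℕ) : ℝ) / (Real.exp 1 * (t / 2))) ^ (m + 2) with hC
  have hC0 : 0 ≤ C := by positivity
  have hlim : Tendsto (fun x => C * |x - t| * ‖w‖) (𝓝 t) (𝓝 0) := by
    have : Continuous fun x => C * |x - t| * ‖w‖ := by fun_prop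
    simpa using this.tendsto t
  refine squeeze_zero' (.of_forall fun x => by positivity) ?_ hlim
  filter_upwards [Ioi_mem_nhds (half_lt_self ht)] with x hx
  have hx0 : 0 < x := (half_pos ht).trans hx
  have h1 : ‖evol ψ W m x w - evol ψ W m t w - (x - t) • evol ψ W (m + 1) t w‖
      ≤ C * |x - t| * |x - t| * ‖w‖ := by
    refine norm_le_of_abs_inner_le (ψ := ψ) (by positivity) fun j => ?_
    rw [inner_sub_right, inner_sub_right, inner_smul_right, hW.inner_evol ψ m hx0,
      hW.inner_evol ψ m ht, hW.inner_evol ψ (m + 1) ht, ← sub_mul, ← mul_assoc, ← sub_mul, abs_mul]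
    gcongr
    exact hW.remainder_le j m ht hx
  rw [Real.norm_eq_abs]
  rcases eq_or_ne x t with rfl | hne
  · simp
  · have : 0 < |x - t| := abs_pos.2 (sub_ne_zero.2 hne)
    rw [inv_mul_le_iff₀ this]
    refine h1.trans (le_of_eq (by ring))

theorem iteratedDeriv_evol (hW : IsRelaxationFamily g ev W) (ψ : HilbertBasis ℕ ℝ H) (w : H)
    (m : ℕ) {t : ℝ} (ht : 0 < t) :
    iteratedDeriv m (fun x => evol ψ W 0 x w) t = evol ψ W m t w := by
  induction m generalizing t with
  | zero => simp
  | succ m ih =>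
    rw [iteratedDeriv_succ]
    refine HasDerivAt.deriv ((hW.hasDerivAt_evol ψ m ht w).congr_of_eventuallyEq ?_)
    filter_upwards [Ioi_mem_nhds ht] with x hx using ih hx

theorem contDiffOn_evol (hW : IsRelaxationFamily g ev W) (ψ : HilbertBasis ℕ ℝ H) (w : H) (m : ℕ) :
    ContDiffOn ℝ ∞ (fun x => evol ψ W m x w) (Ioi 0) := by
  rw [contDiffOn_infty]
  intro n
  induction n generalizing m with
  | zero =>
    rw [Nat.cast_zero, contDiffOn_zero]
    exact fun t ht => (hW.hasDerivAt_evol ψ m ht w).continuousAt.continuousWithinAt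
  | succ n ih =>
    rw [Nat.cast_succ, contDiffOn_succ_iff_deriv_of_isOpen isOpen_Ioi]
    refine ⟨fun t ht => (hW.hasDerivAt_evol ψ m ht w).differentiableAt.differentiableWithinAt,
      by simp, ?_⟩
    exact (ih (m + 1)).congr fun t ht => (hW.hasDerivAt_evol ψ m ht w).deriv

/-- The integrated evolution equation. -/
theorem causalConv_evol (hW : IsRelaxationFamily g ev W) (ψ : HilbertBasis ℕ ℝ H)
    (hg : ∀ T, IntegrableOn g (Ioc 0 T)) {f w : H}
    (hw : ∀ j, inner ℝ (ψ j) w = ev j * inner ℝ (ψ j) f) {t : ℝ} (ht : 0 ≤ t) :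
    causalConv g (fun τ => evol ψ W 0 τ f) t
      = (∫ τ in (0 : ℝ)..t, g τ) • f - ∫ τ in (0 : ℝ)..t, evol ψ W 0 τ w := by
  refine ext_inner_basis (ψ := ψ) fun j => ?_
  have hi1 := intervalIntegrable_causalConv hg (hW.continuousOn_evol_zero ψ f) ht
  have hi2 : IntervalIntegrable (fun τ => evol ψ W 0 τ w) volume 0 t := by
    refine ContinuousOn.intervalIntegrable ?_
    rw [uIcc_of_le ht]
    exact (hW.continuousOn_evol_zero ψ w).mono Icc_subset_Ici_self
  have h1 : inner ℝ (ψ j) (causalConv g (fun τ => evol ψ W 0 τ f) t)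
      = inner ℝ (ψ j) f * causalConv g (W j 0) t := by
    have := (innerSL ℝ (ψ j)).intervalIntegral_comp_comm hi1
    rw [causalConv, ← innerSL_apply_apply ℝ, ← this, causalConv,
      ← intervalIntegral.integral_const_mul]
    refine intervalIntegral.integral_congr fun τ hτ => ?_
    rw [uIcc_of_le ht] at hτ
    simp only [innerSL_apply_apply, inner_smul_right, hW.inner_evol_zero ψ hτ.1, smul_eq_mul]
    ring
  have h2 : inner ℝ (ψ j) (∫ τ in (0 : ℝ)..t, evol ψ W 0 τ w)
      = ev j * inner ℝ (ψ j) f * ∫ τ in (0 : ℝ)..t, W j 0 τ := by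
    have := (innerSL ℝ (ψ j)).intervalIntegral_comp_comm hi2
    rw [← innerSL_apply_apply ℝ, ← this, ← intervalIntegral.integral_const_mul]
    refine intervalIntegral.integral_congr fun τ hτ => ?_
    rw [uIcc_of_le ht] at hτ
    simp only [innerSL_apply_apply, hW.inner_evol_zero ψ hτ.1, hw]
    ring
  rw [inner_sub_right, inner_smul_right, h1, h2, ← hW.eqn j t ht]
  ring

end IsRelaxationFamily

theorem hasDerivAt_integral_of_continuousOn {F : Type*} [NormedAddCommGroup F] [NormedSpace ℝ F]
    [CompleteSpace F] {v : ℝ → F} (hi : ∀ T, IntegrableOn v (Ioc 0 T))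
    (hv : ContinuousOn v (Ioi 0)) {t : ℝ} (ht : 0 < t) :
    HasDerivAt (fun t => ∫ τ in (0 : ℝ)..t, v τ) (v t) t := by
  refine intervalIntegral.integral_hasDerivAt_right ?_ ?_ (hv.continuousAt (Ioi_mem_nhds ht))
  · exact (intervalIntegrable_iff_integrableOn_Ioc_of_le ht.le).2 (hi t)
  · exact ContinuousOn.stronglyMeasurableAtFilter isOpen_Ioi hv t ht

theorem integrableOn_Ioc_of_continuousOn {F : Type*} [NormedAddCommGroup F] {v : ℝ → F}
    (hv : ContinuousOn v (Ici 0)) (T : ℝ) : IntegrableOn v (Ioc 0 T) :=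
  ((hv.mono Icc_subset_Ici_self).integrableOn_compact isCompact_Icc).mono_set Ioc_subset_Icc_self

theorem IsMemoryKernel.integrableOn_Ioc {g : ℝ → ℝ} (hg : IsMemoryKernel g) (T : ℝ) :
    IntegrableOn g (Ioc 0 T) :=
  LaplaceIntegrable.integrableOn_Ioc hg.laplace_exists T

/-- The integrated form of `D_g v = -w`. -/
theorem IsMemoryKernel.hasGenCaputoDeriv {F : Type*} [NormedAddCommGroup F] [NormedSpace ℝ F]
    [CompleteSpace F] {g : ℝ → ℝ} (hg : IsMemoryKernel g) {v w : ℝ → F}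
    (hw : ContinuousOn w (Ici 0)) (h : ∀ t, 0 ≤ t →
      causalConv g v t = (∫ τ in (0 : ℝ)..t, g τ) • v 0 - ∫ τ in (0 : ℝ)..t, w τ)
    {t : ℝ} (ht : 0 < t) : HasGenCaputoDeriv g v (-w t) t := by
  have h1 := (hasDerivAt_integral_of_continuousOn hg.integrableOn_Ioc hg.continuousOn ht).smul_const
    (v 0)
  have h2 := hasDerivAt_integral_of_continuousOn (integrableOn_Ioc_of_continuousOn hw)
    (hw.mono Ioi_subset_Ici_self) ht
  have h3 := (h1.sub h2).congr_of_eventuallyEq (f₁ := causalConv g v) (by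
    filter_upwards [Ioi_mem_nhds ht] with x hx using h x (le_of_lt hx))
  rw [HasGenCaputoDeriv, neg_add_eq_sub]
  exact h3

/-- Uniqueness for the scalar equation `D_g d = -lam d`. -/
theorem IsMemoryKernel.eq_of_hasGenCaputoDeriv {g : ℝ → ℝ} (hg : IsMemoryKernel g) {lam : ℝ}
    (hl : 0 < lam) {d v : ℝ → ℝ} {c : ℝ} (hd : ContinuousOn d (Ici 0))
    (hd' : ∀ t, 0 < t → HasDerivAt (causalConv g d) (-(lam * d t) + g t * c) t)
    (hv : ContinuousOn v (Ici 0)) (hv' : ∀ t, 0 ≤ t →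
      causalConv g v t + lam * (∫ τ in (0 : ℝ)..t, v τ) = ∫ τ in (0 : ℝ)..t, g τ) :
    ∀ t, 0 ≤ t → d t = c * v t := by
  have hNd := continuousOn_causalConv hg.integrableOn_Ioc hd
  have hId : ContinuousOn (fun t => ∫ τ in (0 : ℝ)..t, d τ) (Ici 0) := by
    simp only [← causalConv_one_left]
    exact continuousOn_causalConv laplaceIntegrable_one.integrableOn_Ioc hd
  have hIg : ContinuousOn (fun t => ∫ τ in (0 : ℝ)..t, g τ) (Ici 0) := by
    simp only [← causalConv_one_right g]
    exact continuousOn_causalConv hg.integrableOn_Ioc continuousOn_const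
  set Φ : ℝ → ℝ := fun t => causalConv g d t + lam * (∫ τ in (0 : ℝ)..t, d τ)
    - c * ∫ τ in (0 : ℝ)..t, g τ with hΦ
  have hΦc : ContinuousOn Φ (Ici 0) :=
    (hNd.add (continuousOn_const.mul hId)).sub (continuousOn_const.mul hIg)
  have hΦ0 : ∀ t, 0 ≤ t → Φ t = 0 := by
    intro t ht
    have h00 : Φ 0 = 0 := by simp [hΦ, causalConv_zero]
    rcases ht.eq_or_lt with rfl | ht
    · exact h00
    have hder : ∀ x ∈ Ioo 0 t, HasDerivAt Φ 0 x := by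
      intro x hx
      have h1 := hd' x hx.1
      have h2 := (hasDerivAt_integral_of_continuousOn (integrableOn_Ioc_of_continuousOn hd)
        (hd.mono Ioi_subset_Ici_self) hx.1).const_mul lam
      have h3 := (hasDerivAt_integral_of_continuousOn hg.integrableOn_Ioc hg.continuousOn
        hx.1).const_mul c
      refine ((h1.add h2).sub h3).congr_deriv ?_
      ring
    obtain ⟨x, hx, hx'⟩ := exists_hasDerivAt_eq_slope Φ (fun _ => 0) ht
      (hΦc.mono Icc_subset_Ici_self) hder
    rw [h00, sub_zero, sub_zero] at hx'
    rcases div_eq_zero_iff.1 hx'.symm with h | h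
    · exact h
    · exact absurd h ht.ne'
  have key := hg.eq_zero_of_causalConv hl (d := fun t => d t - c * v t)
    (hd.sub (continuousOn_const.mul hv)) fun t ht => ?_
  · exact fun t ht => sub_eq_zero.1 (key t ht)
  · have hi1 := intervalIntegrable_causalConv hg.integrableOn_Ioc hd ht
    have hi2 := intervalIntegrable_causalConv hg.integrableOn_Ioc hv ht
    have hi3 : IntervalIntegrable d volume 0 t :=
      (intervalIntegrable_iff_integrableOn_Ioc_of_le ht).2 (integrableOn_Ioc_of_continuousOn hd t)
    have hi4 : IntervalIntegrable v volume 0 t :=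
      (intervalIntegrable_iff_integrableOn_Ioc_of_le ht).2 (integrableOn_Ioc_of_continuousOn hv t)
    have e1 : causalConv g (fun t => d t - c * v t) t
        = causalConv g d t - c * causalConv g v t := by
      rw [causalConv, causalConv, causalConv, ← intervalIntegral.integral_const_mul,
        ← intervalIntegral.integral_sub hi1 (hi2.const_mul c)]
      congr 1
      ext τ
      simp only [smul_eq_mul]
      ring
    have e2 : ∫ τ in (0 : ℝ)..t, (d τ - c * v τ)
        = (∫ τ in (0 : ℝ)..t, d τ) - c * ∫ τ in (0 : ℝ)..t, v τ := by
      rw [intervalIntegral.integral_sub hi3 (hi4.const_mul c), intervalIntegral.integral_const_mul]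
    have h1 := hΦ0 t ht
    simp only [hΦ] at h1
    rw [← hv' t ht] at h1
    rw [e1, e2]
    linarith

end GenDiff
end Evolution

section JumpForm

namespace GenDiff

/-- Abbreviation for the Euclidean space. -/
abbrev Euc (n : ℕ) := EuclideanSpace ℝ (Fin n)

variable {n : ℕ} {B : Set (Euc n)} {k : Euc n → ℝ}

theorem IsJumpKernel.aestronglyMeasurable (hn : 1 ≤ n) (hk : IsJumpKernel k) :
    AEStronglyMeasurable k volume := by
  have : Nonempty (Fin n) := ⟨⟨0, hn⟩⟩
  have h1 : AEStronglyMeasurable (fun x : Euc n => (min (‖x‖ ^ 2) 1)⁻¹ * (min (‖x‖ ^ 2) 1 * k x))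
      volume :=
    (Measurable.aestronglyMeasurable (by fun_prop)).mul hk.integrable.aestronglyMeasurable
  refine h1.congr ?_
  filter_upwards [Measure.ae_ne volume (0 : Euc n)] with x hx
  have : 0 < min (‖x‖ ^ 2) 1 := lt_min (by have := norm_pos_iff.2 hx; positivity) one_pos
  rw [inv_mul_cancel_left₀ this.ne']

theorem measurable_zeroExt (hB : MeasurableSet B) (u : L2 B) : Measurable (zeroExt B u) :=
  (Lp.stronglyMeasurable u).measurable.indicator hB

theorem zeroExt_congr (hB : MeasurableSet B) {u : L2 B} {f : Euc n → ℝ}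
    (h : u =ᵐ[volume.restrict B] f) : zeroExt B u =ᵐ[volume] B.indicator f :=
  (ae_eq_restrict_iff_indicator_ae_eq hB).1 h

theorem zeroExt_add (hB : MeasurableSet B) (u v : L2 B) :
    zeroExt B (u + v) =ᵐ[volume] fun x => zeroExt B u x + zeroExt B v x := by
  refine (zeroExt_congr hB (Lp.coeFn_add u v)).trans (.of_forall fun x => ?_)
  exact congrFun (indicator_add B u v) x

theorem zeroExt_smul (hB : MeasurableSet B) (c : ℝ) (u : L2 B) :
    zeroExt B (c • u) =ᵐ[volume] fun x => c * zeroExt B u x := by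
  refine (zeroExt_congr hB (Lp.coeFn_smul c u)).trans (.of_forall fun x => ?_)
  exact indicator_const_smul_apply B c u x

theorem zeroExt_of_notMem (u : L2 B) {x : Euc n} (hx : x ∉ B) : zeroExt B u x = 0 :=
  indicator_of_notMem hx _

theorem memLp_zeroExt (hB : MeasurableSet B) (u : L2 B) : MemLp (zeroExt B u) 2 volume :=
  (memLp_indicator_iff_restrict hB).2 (Lp.memLp u)

theorem integral_zeroExt_mul (hB : MeasurableSet B) (u v : L2 B) :
    ∫ x, zeroExt B u x * zeroExt B v x = inner ℝ u v := by
  rw [L2.inner_def, ← integral_indicator hB]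
  congr 1
  ext x
  by_cases hx : x ∈ B
  · simp only [zeroExt, indicator_of_mem hx, RCLike.inner_apply, conj_trivial, mul_comm]
  · simp only [zeroExt, indicator_of_notMem hx, mul_zero]

theorem norm_sq_eq_integral (hB : MeasurableSet B) (u : L2 B) :
    ‖u‖ ^ 2 = ∫ x, zeroExt B u x ^ 2 := by
  rw [← real_inner_self_eq_norm_sq, ← integral_zeroExt_mul hB]
  simp only [sq]

/-- The weighted increment of a function. -/
noncomputable def increment (k : Euc n → ℝ) (f : Euc n → ℝ) (z : Euc n × Euc n) : ℝ :=
  (f z.1 - f z.2) * √(k (z.1 - z.2))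

theorem increment_congr {f f' : Euc n → ℝ} (h : f =ᵐ[volume] f') :
    increment k f =ᵐ[volume.prod volume] increment k f' := by
  have h1 := (Measure.quasiMeasurePreserving_fst (μ := (volume : Measure (Euc n)))
    (ν := (volume : Measure (Euc n)))).ae_eq_comp h
  have h2 := (Measure.quasiMeasurePreserving_snd (μ := (volume : Measure (Euc n)))
    (ν := (volume : Measure (Euc n)))).ae_eq_comp h
  filter_upwards [h1, h2] with z hz1 hz2
  simp only [Function.comp_apply] at hz1 hz2
  rw [increment, increment, hz1, hz2]

theorem increment_mul_increment (hk : IsJumpKernel k) (f f' : Euc n → ℝ) (z : Euc n × Euc n) :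
    increment k f z * increment k f' z = (f z.1 - f z.2) * (f' z.1 - f' z.2) * k (z.1 - z.2) := by
  rcases eq_or_ne z.1 z.2 with h | h
  · simp [increment, h]
  · rw [increment, increment, mul_mul_mul_comm,
      Real.mul_self_sqrt (hk.pos _ (sub_ne_zero.2 h)).le]

theorem aestronglyMeasurable_comp_sub (hkm : AEStronglyMeasurable k volume) :
    AEStronglyMeasurable (fun z : Euc n × Euc n => k (z.1 - z.2)) (volume.prod volume) :=
  hkm.comp_quasiMeasurePreserving (quasiMeasurePreserving_sub _ _)

theorem aestronglyMeasurable_increment (hkm : AEStronglyMeasurable k volume) {f : Euc n → ℝ}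
    (hf : AEStronglyMeasurable f volume) :
    AEStronglyMeasurable (increment k f) (volume.prod volume) := by
  refine AEStronglyMeasurable.mul ?_ ?_
  · exact hf.comp_fst.sub hf.comp_snd
  · exact Real.continuous_sqrt.comp_aestronglyMeasurable (aestronglyMeasurable_comp_sub hkm)

theorem increment_zeroExt_of_mem (u : L2 B) {z : Euc n × Euc n} (hz : z ∈ Bᶜ ×ˢ Bᶜ) :
    increment k (zeroExt B u) z = 0 := by
  rw [increment, zeroExt_of_notMem u hz.1, zeroExt_of_notMem u hz.2, sub_self, zero_mul]

theorem indicator_increment (u : L2 B) :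
    (Bᶜ ×ˢ Bᶜ)ᶜ.indicator (increment k (zeroExt B u)) = increment k (zeroExt B u) := by
  rw [indicator_eq_self]
  intro z hz
  by_contra h
  exact hz (increment_zeroExt_of_mem u (not_not.1 h))

theorem memX0_iff (hB : MeasurableSet B) (u : L2 B) :
    MemX0 B k u ↔ MemLp (increment k (zeroExt B u)) 2 (volume.prod volume) := by
  rw [← indicator_increment u, memLp_indicator_iff_restrict (hB.compl.prod hB.compl).compl]
  rfl

theorem increment_add (hB : MeasurableSet B) (u v : L2 B) :
    increment k (zeroExt B (u + v)) =ᵐ[volume.prod volume]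
      increment k (zeroExt B u) + increment k (zeroExt B v) := by
  refine (increment_congr (zeroExt_add hB u v)).trans (.of_forall fun z => ?_)
  simp only [increment, Pi.add_apply]
  ring

theorem increment_smul (hB : MeasurableSet B) (c : ℝ) (u : L2 B) :
    increment k (zeroExt B (c • u)) =ᵐ[volume.prod volume]
      c • increment k (zeroExt B u) := by
  refine (increment_congr (zeroExt_smul hB c u)).trans (.of_forall fun z => ?_)
  simp only [increment, Pi.smul_apply, smul_eq_mul]
  ring

/-- The energy space as a subspace of `L²(B)`. -/
def energySpace (hB : MeasurableSet B) (k : Euc n → ℝ) : Submodule ℝ (L2 B) where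
  carrier := {u | MemX0 B k u}
  add_mem' {u v} hu hv := by
    rw [mem_ofPred_eq, memX0_iff hB] at *
    exact (hu.add hv).ae_eq (increment_add hB u v).symm
  zero_mem' := by
    rw [mem_ofPred_eq, memX0_iff hB]
    have h := increment_smul (k := k) hB 0 (0 : L2 B)
    rw [zero_smul, zero_smul] at h
    exact MemLp.zero.ae_eq h.symm
  smul_mem' c u hu := by
    rw [mem_ofPred_eq, memX0_iff hB] at *
    exact (hu.const_smul c).ae_eq (increment_smul hB c u).symm

theorem memLp_of_mem_energySpace {hB : MeasurableSet B} (u : energySpace hB k) :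
    MemLp (increment k (zeroExt B u)) 2 (volume.prod volume) :=
  (memX0_iff hB (u : L2 B)).1 u.2

/-- The increment map from the energy space to `L²(ℝⁿ × ℝⁿ)`. -/
noncomputable def incrementMap (hB : MeasurableSet B) (k : Euc n → ℝ) : energySpace hB k →ₗ[ℝ]
    Lp ℝ 2 ((volume : Measure (Euc n)).prod (volume : Measure (Euc n))) where
  toFun u := (memLp_of_mem_energySpace u).toLp
  map_add' u v := by
    rw [← MemLp.toLp_add]
    exact MemLp.toLp_congr _ _ (increment_add hB u v)
  map_smul' c u := by
    rw [RingHom.id_apply, ← MemLp.toLp_const_smul]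
    exact MemLp.toLp_congr _ _ (increment_smul hB c u)

theorem incrementMap_coeFn {hB : MeasurableSet B} (u : energySpace hB k) :
    incrementMap hB k u =ᵐ[volume.prod volume] increment k (zeroExt B u) :=
  (memLp_of_mem_energySpace u).coeFn_toLp

theorem inner_incrementMap (hk : IsJumpKernel k) {hB : MeasurableSet B} (u v : energySpace hB k) :
    inner ℝ (incrementMap hB k u) (incrementMap hB k v) = energyForm B k u v := by
  rw [L2.inner_def, energyForm]
  refine integral_congr_ae ?_
  filter_upwards [incrementMap_coeFn u, incrementMap_coeFn v] with z hu hv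
  rw [hu, hv, ← increment_mul_increment hk]
  simp [mul_comm]

theorem norm_incrementMap_sq {hB : MeasurableSet B} (u : energySpace hB k) :
    ‖incrementMap hB k u‖ ^ 2
      = ∫ z, increment k (zeroExt B u) z ^ 2 ∂((volume : Measure (Euc n)).prod volume) := by
  rw [← real_inner_self_eq_norm_sq, L2.inner_def]
  refine integral_congr_ae ?_
  filter_upwards [incrementMap_coeFn u] with z hu
  rw [hu]
  simp [sq]

theorem friedrichsGraph_iff (hk : IsJumpKernel k) (hB : MeasurableSet B) (u w : L2 B) :
    FriedrichsGraph B k u w ↔ ∃ hu : u ∈ energySpace hB k, ∀ v : energySpace hB k,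
      inner ℝ (incrementMap hB k ⟨u, hu⟩) (incrementMap hB k v) = inner ℝ w (v : L2 B) := by
  constructor
  · rintro ⟨hu, h⟩
    exact ⟨hu, fun v => by rw [inner_incrementMap hk]; exact h v v.2⟩
  · rintro ⟨hu, h⟩
    refine ⟨hu, fun v hv => ?_⟩
    have := h ⟨v, hv⟩
    rwa [inner_incrementMap hk] at this

theorem isClosedForm_incrementMap (hn : 1 ≤ n) (hk : IsJumpKernel k) (hB : MeasurableSet B) :
    IsClosedForm (incrementMap hB k) := by
  intro u x C hux hC
  obtain ⟨ns, -, hns⟩ := (tendstoInMeasure_of_tendsto_Lp hux).exists_seq_tendsto_ae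
  have hkm := hk.aestronglyMeasurable hn
  have hext : ∀ᵐ y, Tendsto (fun i => zeroExt B (u (ns i)) y) atTop (𝓝 (zeroExt B x y)) := by
    rw [ae_restrict_iff' hB] at hns
    filter_upwards [hns] with y hy
    by_cases hyB : y ∈ B
    · simpa only [zeroExt, indicator_of_mem hyB] using hy hyB
    · simp only [zeroExt, indicator_of_notMem hyB]
      exact tendsto_const_nhds
  have hinc : ∀ᵐ z ∂((volume : Measure (Euc n)).prod volume), Tendsto
      (fun i => increment k (zeroExt B (u (ns i))) z) atTop (𝓝 (increment k (zeroExt B x) z)) := by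
    filter_upwards [Measure.quasiMeasurePreserving_fst.ae hext,
      Measure.quasiMeasurePreserving_snd.ae hext] with z h1 h2
    exact (h1.sub h2).mul_const _
  have hle : eLpNorm (increment k (zeroExt B x)) 2 ((volume : Measure (Euc n)).prod volume)
      ≤ ENNReal.ofReal C := by
    refine (Lp.eLpNorm_lim_le_liminf_eLpNorm (fun i => aestronglyMeasurable_increment hkm
      (measurable_zeroExt hB _).aestronglyMeasurable) _ hinc).trans ?_
    refine Filter.liminf_le_of_frequently_le' (Frequently.of_forall fun i => ?_)
    rw [← eLpNorm_congr_ae (incrementMap_coeFn (u (ns i))), ← Lp.enorm_def,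
      ← ofReal_norm]
    exact ENNReal.ofReal_le_ofReal (hC _)
  have hmem : MemLp (increment k (zeroExt B x)) 2 ((volume : Measure (Euc n)).prod volume) :=
    ⟨aestronglyMeasurable_increment hkm (measurable_zeroExt hB x).aestronglyMeasurable,
      hle.trans_lt ENNReal.ofReal_lt_top⟩
  have hC0 : 0 ≤ C := (norm_nonneg _).trans (hC 0)
  refine ⟨(memX0_iff hB x).2 hmem, ?_⟩
  change ‖MemLp.toLp _ hmem‖ ≤ C
  rw [Lp.norm_toLp]
  exact ENNReal.toReal_le_of_le_ofReal hC0 hle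

theorem eq_zero_of_incrementMap_eq_zero (hn : 1 ≤ n) (hk : IsJumpKernel k) (hB : MeasurableSet B)
    (hBb : Bornology.IsBounded B) (u : energySpace hB k) (h : incrementMap hB k u = 0) : u = 0 := by
  have : Nonempty (Fin n) := ⟨⟨0, hn⟩⟩
  have h1 : ∀ᵐ z ∂((volume : Measure (Euc n)).prod (volume : Measure (Euc n))),
      zeroExt B (u : L2 B) z.1 = zeroExt B (u : L2 B) z.2 := by
    have h0 := Lp.coeFn_zero ℝ 2 ((volume : Measure (Euc n)).prod (volume : Measure (Euc n)))
    rw [← h] at h0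
    filter_upwards [h0, incrementMap_coeFn u] with z hz hz'
    rcases eq_or_ne z.1 z.2 with he | he
    · rw [he]
    · rw [hz] at hz'
      have hk0 : √(k (z.1 - z.2)) ≠ 0 := (Real.sqrt_pos.2 (hk.pos _ (sub_ne_zero.2 he))).ne'
      exact sub_eq_zero.1 ((mul_eq_zero.1 hz'.symm).resolve_right hk0)
  have h2 : volume Bᶜ ≠ 0 := by
    intro h0
    have h3 := measure_univ_of_isAddLeftInvariant (volume : Measure (Euc n))
    have h4 : volume (univ : Set (Euc n)) ≤ volume B + volume Bᶜ := by
      rw [← union_compl_self B]; exact measure_union_le _ _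
    rw [h0, add_zero, h3] at h4
    exact absurd h4 (not_le.2 hBb.measure_lt_top)
  have h3 : zeroExt B (u : L2 B) =ᵐ[volume] 0 := by
    filter_upwards [Measure.ae_ae_of_ae_prod h1] with x hx
    by_contra hne
    refine h2 (measure_mono_null (fun y hy => ?_) (ae_iff.1 hx))
    simp only [mem_ofPred_eq]
    rw [zeroExt_of_notMem _ hy]
    exact hne
  have h4 : (u : L2 B) = 0 := by
    rw [← norm_eq_zero, ← sq_eq_zero_iff, norm_sq_eq_integral hB]
    have : (fun x => zeroExt B (u : L2 B) x ^ 2) =ᵐ[volume] fun _ => 0 := by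
      filter_upwards [h3] with x hx
      rw [hx]; simp
    rw [integral_congr_ae this, integral_zero]
  exact Subtype.ext h4

end GenDiff
end JumpForm

section CompactEmbedding

namespace GenDiff

/-- The variance identity on a set of finite measure. -/
theorem setIntegral_sq_eq {α : Type*} [MeasurableSpace α] {μ : Measure α} [SigmaFinite μ]
    {Q : Set α} (hv : 0 < μ.real Q) {f : α → ℝ} (hf : MemLp f 2 μ) :
    IntegrableOn (fun z : α × α => (f z.1 - f z.2) ^ 2) (Q ×ˢ Q) (μ.prod μ) ∧
    ∫ x in Q, f x ^ 2 ∂μ = 1 / (2 * μ.real Q) * (∫ z in Q ×ˢ Q, (f z.1 - f z.2) ^ 2 ∂(μ.prod μ))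
      + 1 / μ.real Q * (∫ x in Q, f x ∂μ) ^ 2 := by
  have hQ : μ Q ≠ ⊤ := fun h => by simp [measureReal_def, h] at hv
  have hfin : IsFiniteMeasure (μ.restrict Q) := ⟨by simpa using hQ.lt_top⟩
  have hfQ : MemLp f 2 (μ.restrict Q) := hf.restrict Q
  have hi1 : Integrable f (μ.restrict Q) := hfQ.integrable (by norm_num)
  have hi2 : Integrable (fun x => f x ^ 2) (μ.restrict Q) := hfQ.integrable_sq
  have e : ∀ z : α × α, (f z.1 - f z.2) ^ 2
      = f z.1 ^ 2 * 1 + 1 * f z.2 ^ 2 - 2 * (f z.1 * f z.2) := fun z => by ring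
  have j1 : Integrable (fun z : α × α => f z.1 ^ 2 * 1) ((μ.restrict Q).prod (μ.restrict Q)) :=
    hi2.mul_prod (integrable_const (1 : ℝ))
  have j2 : Integrable (fun z : α × α => 1 * f z.2 ^ 2) ((μ.restrict Q).prod (μ.restrict Q)) :=
    (integrable_const (1 : ℝ)).mul_prod hi2
  have j3 : Integrable (fun z : α × α => 2 * (f z.1 * f z.2))
      ((μ.restrict Q).prod (μ.restrict Q)) := (hi1.mul_prod hi1).const_mul 2
  rw [IntegrableOn, ← Measure.prod_restrict]
  simp only [e]
  have j12 : Integrable (fun z : α × α => f z.1 ^ 2 * 1 + 1 * f z.2 ^ 2)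
      ((μ.restrict Q).prod (μ.restrict Q)) := j1.add j2
  refine ⟨j12.sub j3, ?_⟩
  rw [integral_sub j12 j3, integral_add j1 j2,
    integral_const_mul (2 : ℝ)]
  rw [integral_prod_mul (fun x => f x ^ 2) (fun _ => (1 : ℝ)),
    integral_prod_mul (fun _ => (1 : ℝ)) (fun x => f x ^ 2), integral_prod_mul f f]
  simp only [integral_const, smul_eq_mul, mul_one, measureReal_restrict_apply_univ]
  field_simp
  ring

variable {n : ℕ} {B : Set (Euc n)} {k : Euc n → ℝ}

/-- Half-open grid cubes of side `δ`. -/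
def gridCell (δ : ℝ) (i : Fin n → ℤ) : Set (Euc n) :=
  {x | ∀ j, x j ∈ Ico (δ * i j) (δ * (i j + 1))}

theorem gridCell_eq (δ : ℝ) (i : Fin n → ℤ) :
    gridCell δ i = (WithLp.ofLp : Euc n → Fin n → ℝ) ⁻¹'
      univ.pi fun j => Ico (δ * i j) (δ * (i j + 1)) := by
  ext x
  simp [gridCell]

theorem measurableSet_gridCell (δ : ℝ) (i : Fin n → ℤ) : MeasurableSet (gridCell (n := n) δ i) := by
  rw [gridCell_eq]
  exact (PiLp.volume_preserving_ofLp (Fin n)).measurable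
    (MeasurableSet.univ_pi fun _ => measurableSet_Ico)

theorem volume_gridCell {δ : ℝ} (hδ : 0 < δ) (i : Fin n → ℤ) :
    volume.real (gridCell (n := n) δ i) = δ ^ n := by
  rw [gridCell_eq, measureReal_def, (PiLp.volume_preserving_ofLp (Fin n)).measure_preimage
    (MeasurableSet.univ_pi fun _ => measurableSet_Ico).nullMeasurableSet, Real.volume_pi_Ico]
  have : ∀ j, δ * ((i j : ℝ) + 1) - δ * i j = δ := fun j => by ring
  simp only [this, Finset.prod_const, Finset.card_univ, Fintype.card_fin]
  rw [ENNReal.toReal_pow, ENNReal.toReal_ofReal hδ.le]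

theorem mem_gridCell_floor {δ : ℝ} (hδ : 0 < δ) (x : Euc n) :
    x ∈ gridCell δ fun j => ⌊x j / δ⌋ := by
  intro j
  constructor
  · have := Int.floor_le (x j / δ)
    rw [le_div_iff₀ hδ] at this
    linarith
  · have := Int.lt_floor_add_one (x j / δ)
    rw [div_lt_iff₀ hδ] at this
    linarith

theorem eq_floor_of_mem_gridCell {δ : ℝ} (hδ : 0 < δ) {x : Euc n} {i : Fin n → ℤ}
    (hx : x ∈ gridCell δ i) : i = fun j => ⌊x j / δ⌋ := by
  ext j
  symm
  rw [Int.floor_eq_iff, le_div_iff₀ hδ, div_lt_iff₀ hδ]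
  have := hx j
  exact ⟨by linarith [this.1], by linarith [this.2]⟩

theorem disjoint_gridCell {δ : ℝ} (hδ : 0 < δ) {i i' : Fin n → ℤ} (h : i ≠ i') :
    Disjoint (gridCell (n := n) δ i) (gridCell δ i') := by
  rw [Set.disjoint_left]
  intro x hx hx'
  exact h ((eq_floor_of_mem_gridCell hδ hx).trans (eq_floor_of_mem_gridCell hδ hx').symm)

theorem norm_sub_le_of_mem_gridCell {δ : ℝ} (hδ : 0 < δ) {i : Fin n → ℤ} {x y : Euc n}
    (hx : x ∈ gridCell δ i) (hy : y ∈ gridCell δ i) : ‖x - y‖ ≤ √n * δ := by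
  rw [EuclideanSpace.norm_eq]
  have : ∀ j, ‖(x - y) j‖ ^ 2 ≤ δ ^ 2 := by
    intro j
    rw [Real.norm_eq_abs]
    refine pow_le_pow_left₀ (abs_nonneg _) ?_ 2
    rw [PiLp.sub_apply, abs_le]
    have h1 := hx j
    have h2 := hy j
    constructor
    · linarith [h1.1, h2.2]
    · linarith [h1.2, h2.1]
  calc √(∑ j, ‖(x - y) j‖ ^ 2) ≤ √(∑ _j : Fin n, δ ^ 2) :=
        Real.sqrt_le_sqrt (Finset.sum_le_sum fun j _ => this j)
    _ = √n * δ := by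
      rw [Finset.sum_const, Finset.card_univ, Fintype.card_fin, nsmul_eq_mul,
        Real.sqrt_mul (Nat.cast_nonneg n), Real.sqrt_sq hδ.le]

/-- A bounded set is covered by finitely many grid cells. -/
theorem exists_finset_gridCell (hBb : Bornology.IsBounded B) {δ : ℝ} (hδ : 0 < δ) :
    ∃ I : Finset (Fin n → ℤ), ∀ x ∈ B, ∃ i ∈ I, x ∈ gridCell δ i := by
  obtain ⟨M, hM⟩ := hBb.exists_norm_le
  refine ⟨Fintype.piFinset fun _ => Finset.Icc ⌊-M / δ⌋ ⌊M / δ⌋, fun x hx =>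
    ⟨_, ?_, mem_gridCell_floor hδ x⟩⟩
  rw [Fintype.mem_piFinset]
  intro j
  have h1 : |x j| ≤ M := (PiLp.norm_apply_le x j).trans (hM x hx)
  rw [abs_le] at h1
  rw [Finset.mem_Icc]
  constructor
  · exact Int.floor_le_floor (by gcongr; exact h1.1)
  · exact Int.floor_le_floor (by gcongr; exact h1.2)

theorem exists_grid_bound (hB : MeasurableSet B) (hBb : Bornology.IsBounded B) {δ κ : ℝ}
    (hδ : 0 < δ) (hκ : 0 < κ) (hlow : ∀ x : Euc n, x ≠ 0 → ‖x‖ ≤ √n * δ → κ ≤ k x)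
    (hk : IsJumpKernel k) :
    ∃ (N : ℕ) (l : Fin N → L2 B →L[ℝ] ℝ), ∀ u : energySpace hB k,
      ‖(u : L2 B)‖ ^ 2 ≤ 1 / (2 * δ ^ n) * (1 / κ) * ‖incrementMap hB k u‖ ^ 2
        + ∑ i, (l i u) ^ 2 := by
  classical
  obtain ⟨I, hI⟩ := exists_finset_gridCell hBb hδ
  set c : ℝ := √(1 / δ ^ n) with hc
  have hc2 : c ^ 2 = 1 / δ ^ n := Real.sq_sqrt (by positivity)
  have hmeas := measurableSet_gridCell (n := n) δ
  have hfin : ∀ i : Fin n → ℤ, (volume.restrict B) (gridCell δ i) ≠ ⊤ := fun i => by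
    refine ne_top_of_le_ne_top ?_ (Measure.restrict_apply_le _ _)
    intro h
    have := volume_gridCell hδ i
    rw [measureReal_def, h] at this
    have h2 := pow_pos hδ n
    simp at this
    linarith
  let L : (Fin n → ℤ) → L2 B →L[ℝ] ℝ := fun i =>
    c • innerSL ℝ (indicatorConstLp 2 (hmeas i) (hfin i) (1 : ℝ))
  have hL : ∀ i (u : L2 B), (L i u) ^ 2
      = 1 / δ ^ n * (∫ x in gridCell δ i, zeroExt B u x) ^ 2 := by
    intro i u
    have : L i u = c * ∫ x in gridCell δ i, zeroExt B u x := by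
      change c * inner ℝ (indicatorConstLp 2 (hmeas i) (hfin i) (1 : ℝ)) u = _
      rw [L2.inner_indicatorConstLp_one, zeroExt, setIntegral_indicator hB,
        Measure.restrict_restrict (hmeas i)]
    rw [this, mul_pow, hc2]
  refine ⟨I.card, fun i => L (I.equivFin.symm i), fun u => ?_⟩
  have hsumL : ∑ i : Fin I.card, (L (I.equivFin.symm i) u) ^ 2
      = ∑ i ∈ I, 1 / δ ^ n * (∫ x in gridCell δ i, zeroExt B (u : L2 B) x) ^ 2 := by
    rw [Equiv.sum_comp I.equivFin.symm (fun i : I => (L i u) ^ 2),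
      Finset.sum_coe_sort I (fun i => (L i u) ^ 2)]
    exact Finset.sum_congr rfl fun i _ => hL i u
  set f := zeroExt B (u : L2 B) with hf
  have hf2 : MemLp f 2 volume := memLp_zeroExt hB u
  have hsplit : ∫ x, f x ^ 2 = ∑ i ∈ I, ∫ x in gridCell δ i, f x ^ 2 := by
    rw [← integral_biUnion_finset I (fun i _ => hmeas i)
      (fun i _ i' _ h => disjoint_gridCell hδ h) fun i _ => hf2.integrable_sq.integrableOn]
    symm
    refine setIntegral_eq_integral_of_forall_compl_eq_zero fun x hx => ?_
    have : x ∉ B := fun hxB => by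
      obtain ⟨i, hi, hxi⟩ := hI x hxB
      exact hx (mem_biUnion hi hxi)
    rw [hf, zeroExt_of_notMem _ this]
    norm_num
  have hcell : ∀ i, 0 < volume.real (gridCell (n := n) δ i) := fun i => by
    rw [volume_gridCell hδ]; positivity
  have hDint : Integrable (fun z => increment k f z ^ 2)
      ((volume : Measure (Euc n)).prod (volume : Measure (Euc n))) :=
    (memLp_of_mem_energySpace u).integrable_sq
  have hcellle : ∀ i, ∫ z in gridCell δ i ×ˢ gridCell δ i, (f z.1 - f z.2) ^ 2
      ∂((volume : Measure (Euc n)).prod (volume : Measure (Euc n)))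
      ≤ 1 / κ * ∫ z in gridCell δ i ×ˢ gridCell δ i, increment k f z ^ 2
        ∂((volume : Measure (Euc n)).prod (volume : Measure (Euc n))) := by
    intro i
    rw [← integral_const_mul]
    refine setIntegral_mono_on (setIntegral_sq_eq (hcell i) hf2).1
      (hDint.integrableOn.const_mul _) ((hmeas i).prod (hmeas i)) fun z hz => ?_
    rcases eq_or_ne z.1 z.2 with h | h
    · simp [increment, h]
    · have h1 := hlow (z.1 - z.2) (sub_ne_zero.2 h) (norm_sub_le_of_mem_gridCell hδ hz.1 hz.2)
      rw [sq (increment k f z), increment_mul_increment hk, ← sq, one_div, ← div_eq_inv_mul,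
        le_div_iff₀ hκ]
      gcongr
  have hunion : ∑ i ∈ I, ∫ z in gridCell δ i ×ˢ gridCell δ i, increment k f z ^ 2
      ∂((volume : Measure (Euc n)).prod (volume : Measure (Euc n)))
      ≤ ‖incrementMap hB k u‖ ^ 2 := by
    rw [norm_incrementMap_sq, ← integral_biUnion_finset I (fun i _ => (hmeas i).prod (hmeas i))
      (fun i _ i' _ h => (disjoint_gridCell hδ h).set_prod_left _ _)
      fun i _ => hDint.integrableOn]
    exact setIntegral_le_integral hDint (.of_forall fun z => sq_nonneg _)
  rw [norm_sq_eq_integral hB, hsumL, hsplit]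
  calc ∑ i ∈ I, ∫ x in gridCell δ i, f x ^ 2
      = ∑ i ∈ I, (1 / (2 * δ ^ n) * (∫ z in gridCell δ i ×ˢ gridCell δ i, (f z.1 - f z.2) ^ 2
          ∂((volume : Measure (Euc n)).prod (volume : Measure (Euc n))))
        + 1 / δ ^ n * (∫ x in gridCell δ i, f x) ^ 2) := by
        refine Finset.sum_congr rfl fun i _ => ?_
        rw [(setIntegral_sq_eq (hcell i) hf2).2, volume_gridCell hδ]
    _ ≤ ∑ i ∈ I, (1 / (2 * δ ^ n) * (1 / κ * ∫ z in gridCell δ i ×ˢ gridCell δ i,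
          increment k f z ^ 2 ∂((volume : Measure (Euc n)).prod (volume : Measure (Euc n))))
        + 1 / δ ^ n * (∫ x in gridCell δ i, f x) ^ 2) := by
        gcongr with i hi
        exact hcellle i
    _ = 1 / (2 * δ ^ n) * (1 / κ) * (∑ i ∈ I, ∫ z in gridCell δ i ×ˢ gridCell δ i,
          increment k f z ^ 2 ∂((volume : Measure (Euc n)).prod (volume : Measure (Euc n))))
        + ∑ i ∈ I, 1 / δ ^ n * (∫ x in gridCell δ i, f x) ^ 2 := by
        rw [Finset.sum_add_distrib, ← Finset.mul_sum, ← Finset.mul_sum, mul_assoc]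
    _ ≤ _ := by gcongr

theorem isCompactForm_incrementMap (hn : 1 ≤ n) (hk : IsJumpKernel k) (hBo : IsOpen B)
    (hBne : B.Nonempty) (hBb : Bornology.IsBounded B) (hl : LowerBound B k) :
    IsCompactForm (incrementMap hBo.measurableSet k) := by
  obtain ⟨θ, β, hθ, hβ, -, hlow⟩ := hl
  have : Nonempty (Fin n) := ⟨⟨0, hn⟩⟩
  have hn0 : (0 : ℝ) < n := Nat.cast_pos.2 hn
  set R : ℝ := 2 * sSup ((fun y => ‖y‖) '' B) with hR
  have hRpos : 0 < R := by
    obtain ⟨x, hx⟩ := hBne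
    have : ∃ y ∈ B, y ≠ 0 := by
      by_contra! h
      have hsub : B ⊆ {0} := fun y hy => h y hy
      have h1 := hBo.measure_pos volume ⟨x, hx⟩
      have h2 := (measure_mono hsub).trans_eq (measure_singleton (μ := volume) (0 : Euc n))
      exact absurd h1 (not_lt.2 h2)
    obtain ⟨y, hy, hy0⟩ := this
    obtain ⟨M, hM⟩ := hBb.exists_norm_le
    have hbd : BddAbove ((fun y => ‖y‖) '' B) := ⟨M, by rintro _ ⟨z, hz, rfl⟩; exact hM z hz⟩
    have := le_csSup hbd ⟨y, hy, rfl⟩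
    have := norm_pos_iff.2 hy0
    simp only at *
    linarith
  intro η hη
  -- choose the side of the cubes
  have hlim : Tendsto (fun δ : ℝ => 1 / (2 * θ) * √n ^ ((n : ℝ) + 2 * β) * δ ^ (2 * β)) (𝓝[>] 0)
      (𝓝 0) := by
    have h1 : Tendsto (fun δ : ℝ => δ ^ (2 * β)) (𝓝[>] 0) (𝓝 0) := by
      have := (Real.continuousAt_rpow_const (0 : ℝ) (2 * β) (Or.inr (by positivity))).tendsto
      rw [Real.zero_rpow (by positivity)] at this
      exact this.mono_left nhdsWithin_le_nhds
    simpa using h1.const_mul (1 / (2 * θ) * √n ^ ((n : ℝ) + 2 * β))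
  have hlim2 : Tendsto (fun δ : ℝ => √n * δ) (𝓝[>] 0) (𝓝 0) := by
    have : Tendsto (fun δ : ℝ => √n * δ) (𝓝 0) (𝓝 (√n * 0)) := tendsto_id.const_mul _
    rw [mul_zero] at this
    exact this.mono_left nhdsWithin_le_nhds
  obtain ⟨δ, ⟨h1, h2⟩, h3⟩ := ((hlim.eventually (gt_mem_nhds hη)).and
    (hlim2.eventually (gt_mem_nhds hRpos))).and self_mem_nhdsWithin |>.exists
  have hδ : 0 < δ := h3
  have hd : 0 < √n * δ := mul_pos (Real.sqrt_pos.2 hn0) hδ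
  set κ : ℝ := θ * (√n * δ) ^ (-((n : ℝ) + 2 * β)) with hκ
  have hκpos : 0 < κ := mul_pos hθ (Real.rpow_pos_of_pos hd _)
  have hκk : ∀ x : Euc n, x ≠ 0 → ‖x‖ ≤ √n * δ → κ ≤ k x := fun x hx hxd => by
    refine le_trans ?_ (hlow x hx fun i => ?_)
    · rw [hκ]
      gcongr θ * ?_
      exact Real.rpow_le_rpow_of_nonpos (norm_pos_iff.2 hx) hxd (by linarith)
    · exact (PiLp.norm_apply_le x i).trans (hxd.trans h2.le)
  obtain ⟨N, l, hl⟩ := exists_grid_bound hBo.measurableSet hBb hδ hκpos hκk hk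
  refine ⟨N, l, fun u => (hl u).trans ?_⟩
  gcongr
  refine le_of_eq_of_le ?_ h1.le
  rw [hκ, Real.rpow_neg hd.le, Real.mul_rpow (Real.sqrt_nonneg _) hδ.le, Real.rpow_add hδ,
    Real.rpow_natCast]
  field_simp

end GenDiff
end CompactEmbedding

section TestFunctions

namespace GenDiff

variable {n : ℕ} {B : Set (Euc n)} {k : Euc n → ℝ}

/-- First and second differences of a smooth compactly supported function. -/
theorem exists_difference_bounds {φ : Euc n → ℝ} (hφ : ContDiff ℝ ∞ φ) (hc : HasCompactSupport φ) :
    ∃ C, 0 ≤ C ∧ (∀ x y, |φ x - φ y| ≤ C * min ‖x - y‖ 1) ∧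
      ∀ x y, |φ (x + y) + φ (x - y) - 2 * φ x| ≤ C * min (‖y‖ ^ 2) 1 := by
  obtain ⟨L, hL⟩ := ContDiff.lipschitzWith_of_hasCompactSupport hc hφ (by simp)
  obtain ⟨M, hM⟩ := hc.exists_bound_of_continuous hφ.continuous
  have hd : ContDiff ℝ ∞ (fderiv ℝ φ) := hφ.fderiv_right (by simp)
  obtain ⟨L', hL'⟩ := ContDiff.lipschitzWith_of_hasCompactSupport (hc.fderiv ℝ) hd (by simp)
  have hM0 : 0 ≤ M := (norm_nonneg _).trans (hM 0)
  have hdf : Differentiable ℝ φ := hφ.differentiable (by simp)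
  simp only [Real.norm_eq_abs] at hM
  have key : ∀ x y, |φ (x + y) + φ (x - y) - 2 * φ x| ≤ L' * ‖y‖ ^ 2 := fun x y => by
    have h := Convex.norm_image_sub_le_of_norm_hasFDerivWithin_le (𝕜 := ℝ)
      (f := fun z => φ (z + y) - φ z) (f' := fun z => fderiv ℝ φ (z + y) - fderiv ℝ φ z)
      (C := L' * ‖y‖) (s := univ) (x := x - y) (y := x) (fun z _ => ?_) (fun z _ => ?_)
      convex_univ (mem_univ _) (mem_univ _)
    · simp only [sub_add_cancel, sub_sub_cancel, Real.norm_eq_abs] at h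
      calc _ = |φ (x + y) - φ x - (φ x - φ (x - y))| := by congr 1; ring
        _ ≤ _ := h
        _ = _ := by ring
    · exact (((hasFDerivAt_comp_add_right y).2 (hdf (z + y)).hasFDerivAt).sub
        (hdf z).hasFDerivAt).hasFDerivWithinAt
    · have := hL'.dist_le_mul (z + y) z
      rwa [dist_eq_norm, dist_eq_norm, add_sub_cancel_left] at this
  refine ⟨L + L' + 4 * M, by positivity, fun x y => ?_, fun x y => ?_⟩
  · rcases le_total ‖x - y‖ 1 with h | h
    · rw [min_eq_left h]
      have := hL.dist_le_mul x y
      rw [dist_eq_norm, dist_eq_norm, Real.norm_eq_abs] at this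
      refine this.trans ?_
      gcongr
      nlinarith [L'.coe_nonneg]
    · rw [min_eq_right h]
      have := abs_sub (φ x) (φ y)
      linarith [hM x, hM y, L.coe_nonneg, L'.coe_nonneg]
  · rcases le_total (‖y‖ ^ 2) 1 with h | h
    · rw [min_eq_left h]
      refine (key x y).trans ?_
      gcongr
      nlinarith [L.coe_nonneg]
    · rw [min_eq_right h]
      have h1 := abs_sub (φ (x + y) + φ (x - y)) (2 * φ x)
      have h2 := abs_add_le (φ (x + y)) (φ (x - y))
      rw [abs_mul, abs_two] at h1
      linarith [hM x, hM (x + y), hM (x - y), L.coe_nonneg, L'.coe_nonneg]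

theorem measurePreserving_prod_sub_right :
    MeasurePreserving (fun z : Euc n × Euc n => (z.1, z.1 - z.2)) (volume.prod volume)
      (volume.prod volume) := by
  have := (measurePreserving_prod_add (volume : Measure (Euc n)) (volume : Measure (Euc n))).comp
    ((MeasurePreserving.id (volume : Measure (Euc n))).prod
      (Measure.measurePreserving_neg (volume : Measure (Euc n))))
  simpa only [sub_eq_add_neg, Function.comp_def, Prod.map, id_eq] using this

theorem measurePreserving_add_prod_fst :
    MeasurePreserving (fun z : Euc n × Euc n => (z.1 + z.2, z.1)) (volume.prod volume)
      (volume.prod volume) :=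
  Measure.measurePreserving_swap.comp
    (measurePreserving_prod_add (volume : Measure (Euc n)) (volume : Measure (Euc n)))

theorem _root_.MeasureTheory.MeasurePreserving.integral_comp_of_aestronglyMeasurable
    {α β F : Type*} [MeasurableSpace α] [MeasurableSpace β] [NormedAddCommGroup F]
    [NormedSpace ℝ F] {μ : Measure α} {ν : Measure β} {T : α → β} (hT : MeasurePreserving T μ ν)
    {f : β → F} (hf : AEStronglyMeasurable f ν) : ∫ x, f (T x) ∂μ = ∫ y, f y ∂ν := by
  have := integral_map hT.aemeasurable (f := f) (by rwa [hT.map_eq])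
  rw [← this, hT.map_eq]

theorem min_mul_nonneg (hk : IsJumpKernel k) (x : Euc n) : 0 ≤ min (‖x‖ ^ 2) 1 * k x := by
  rcases eq_or_ne x 0 with rfl | h
  · simp
  · exact mul_nonneg (by positivity) (hk.pos x h).le

theorem memX0_of_difference_bound (hn : 1 ≤ n) (hk : IsJumpKernel k) (hB : MeasurableSet B)
    (hBb : Bornology.IsBounded B) {φ : Euc n → ℝ} (hφm : AEStronglyMeasurable φ volume)
    (hφ0 : ∀ x ∉ B, φ x = 0) {C : ℝ} (hC : ∀ x y, |φ x - φ y| ≤ C * min ‖x - y‖ 1) :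
    MemLp (increment k φ) 2 (volume.prod volume) := by
  have hkm := hk.aestronglyMeasurable hn
  rw [memLp_two_iff_integrable_sq (aestronglyMeasurable_increment hkm hφm)]
  have h1B : Integrable (B.indicator fun _ => (1 : ℝ)) (volume : Measure (Euc n)) :=
    (integrable_indicator_iff hB).2 (integrableOn_const hBb.measure_lt_top.ne)
  have hmW : AEStronglyMeasurable (fun z : Euc n × Euc n => min (‖z.1 - z.2‖ ^ 2) 1 * k (z.1 - z.2))
      (volume.prod volume) := aestronglyMeasurable_comp_sub hk.integrable.aestronglyMeasurable
  have i1 : Integrable (fun z : Euc n × Euc n => B.indicator (fun _ => (1 : ℝ)) z.1 *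
      (min (‖z.1 - z.2‖ ^ 2) 1 * k (z.1 - z.2))) (volume.prod volume) := by
    refine (measurePreserving_prod_sub_right.integrable_comp
      (h1B.aestronglyMeasurable.comp_fst.mul hmW)).1 ?_
    simpa only [Function.comp_def, Pi.mul_apply, sub_sub_cancel] using h1B.mul_prod hk.integrable
  have i2 : Integrable (fun z : Euc n × Euc n => B.indicator (fun _ => (1 : ℝ)) z.2 *
      (min (‖z.1 - z.2‖ ^ 2) 1 * k (z.1 - z.2))) (volume.prod volume) := by
    refine (measurePreserving_add_prod_fst.integrable_comp
      (h1B.aestronglyMeasurable.comp_snd.mul hmW)).1 ?_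
    simpa only [Function.comp_def, Pi.mul_apply, add_sub_cancel_left] using h1B.mul_prod hk.integrable
  refine ((i1.add i2).const_mul (C ^ 2)).mono'
    ((aestronglyMeasurable_increment hkm hφm).pow 2) (.of_forall fun z => ?_)
  have hw := min_mul_nonneg hk (z.1 - z.2)
  rw [Real.norm_eq_abs, abs_of_nonneg (sq_nonneg _), sq, increment_mul_increment hk, Pi.add_apply,
    ← add_mul]
  by_cases hz : z.1 ∈ B ∨ z.2 ∈ B
  · have h1 : 1 ≤ B.indicator (fun _ => (1 : ℝ)) z.1 + B.indicator (fun _ => (1 : ℝ)) z.2 := by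
      rcases hz with hz | hz
      · rw [indicator_of_mem hz]
        exact le_add_of_nonneg_right (indicator_nonneg (fun _ _ => zero_le_one) _)
      · rw [indicator_of_mem hz]
        exact le_add_of_nonneg_left (indicator_nonneg (fun _ _ => zero_le_one) _)
    calc _ ≤ C ^ 2 * (min (‖z.1 - z.2‖ ^ 2) 1 * k (z.1 - z.2)) := by
          rcases eq_or_ne z.1 z.2 with h | h
          · simp [h]
          · rw [← mul_assoc]
            refine mul_le_mul_of_nonneg_right ?_ (hk.pos _ (sub_ne_zero.2 h)).le
            have hmin : min (‖z.1 - z.2‖ ^ 2) 1 = min ‖z.1 - z.2‖ 1 ^ 2 := by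
              rcases le_total ‖z.1 - z.2‖ 1 with h' | h'
              · rw [min_eq_left h', min_eq_left (pow_le_one₀ (norm_nonneg _) h')]
              · rw [min_eq_right h', min_eq_right (one_le_pow₀ h'), one_pow]
            rw [hmin, ← mul_pow, ← sq, ← sq_abs]
            exact pow_le_pow_left₀ (abs_nonneg _) (hC _ _) 2
      _ ≤ _ := by
          exact mul_le_mul_of_nonneg_left (le_mul_of_one_le_left hw h1) (sq_nonneg C)
  · rw [not_or] at hz
    simp [hφ0 _ hz.1, hφ0 _ hz.2, hz.1, hz.2]

theorem aestronglyMeasurable_second_difference (hn : 1 ≤ n) (hk : IsJumpKernel k) {φ : Euc n → ℝ}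
    (hφ : Continuous φ) : AEStronglyMeasurable (fun z : Euc n × Euc n =>
      (φ (z.1 + z.2) + φ (z.1 - z.2) - 2 * φ z.1) * k z.2) (volume.prod volume) :=
  (Continuous.aestronglyMeasurable (by fun_prop)).mul (hk.aestronglyMeasurable hn).comp_snd

theorem memLp_genLaplacian (hn : 1 ≤ n) (hk : IsJumpKernel k) (hBb : Bornology.IsBounded B)
    {φ : Euc n → ℝ} (hφ : Continuous φ) {C : ℝ}
    (hC : ∀ x y, |φ (x + y) + φ (x - y) - 2 * φ x| ≤ C * min (‖y‖ ^ 2) 1) :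
    MemLp (fun x => -genLaplacian k φ x) 2 (volume.restrict B) := by
  have : IsFiniteMeasure (volume.restrict B) := ⟨by simpa using hBb.measure_lt_top⟩
  have hm : AEStronglyMeasurable (genLaplacian k φ) volume :=
    (aestronglyMeasurable_second_difference hn hk hφ).integral_prod_right'
  refine MemLp.of_bound hm.neg.restrict (∫ y, C * (min (‖y‖ ^ 2) 1 * k y))
    (.of_forall fun x => ?_)
  rw [norm_neg, genLaplacian]
  refine norm_integral_le_of_norm_le (hk.integrable.const_mul C) (.of_forall fun y => ?_)
  rcases eq_or_ne y 0 with rfl | h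
  · simp [two_mul]
  · rw [norm_mul, Real.norm_eq_abs, Real.norm_eq_abs, abs_of_pos (hk.pos y h), ← mul_assoc]
    exact mul_le_mul_of_nonneg_right (hC x y) (hk.pos y h).le

end GenDiff
end TestFunctions

section FriedrichsExtension

namespace GenDiff

variable {n : ℕ} {B : Set (Euc n)} {k : Euc n → ℝ}

/-- The kernel with the jumps shorter than `ε` removed. -/
noncomputable def truncKernel (k : Euc n → ℝ) (ε : ℝ) : Euc n → ℝ :=
  {z | ε ≤ ‖z‖}.indicator k

theorem measurableSet_le_norm (ε : ℝ) : MeasurableSet {z : Euc n | ε ≤ ‖z‖} :=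
  measurableSet_le measurable_const measurable_norm

theorem integrable_truncKernel (hn : 1 ≤ n) (hk : IsJumpKernel k) {ε : ℝ} (hε : 0 < ε)
    (hε1 : ε ≤ 1) : Integrable (truncKernel k ε) := by
  refine (hk.integrable.const_mul (ε ^ 2)⁻¹).mono'
    ((hk.aestronglyMeasurable hn).indicator (measurableSet_le_norm ε)) (.of_forall fun z => ?_)
  by_cases hz : ε ≤ ‖z‖
  · have hz0 : z ≠ 0 := norm_pos_iff.1 (hε.trans_le hz)
    have hmin : ε ^ 2 ≤ min (‖z‖ ^ 2) 1 :=
      le_min (pow_le_pow_left₀ hε.le hz 2) (pow_le_one₀ hε.le hε1)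
    rw [truncKernel, indicator_of_mem (by exact hz), Real.norm_eq_abs, abs_of_pos (hk.pos z hz0),
      ← mul_assoc]
    refine le_mul_of_one_le_left (hk.pos z hz0).le ?_
    rw [inv_mul_eq_div, one_le_div (by positivity)]
    exact hmin
  · rw [truncKernel, indicator_of_notMem (by exact hz), norm_zero]
    have := min_mul_nonneg hk z
    positivity

theorem truncKernel_eventuallyEq {z : Euc n} (hz : z ≠ 0) :
    ∀ᶠ m : ℕ in atTop, truncKernel k (1 / ((m : ℝ) + 1)) z = k z := by
  filter_upwards [tendsto_one_div_add_atTop_nhds_zero_nat.eventually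
    (gt_mem_nhds (norm_pos_iff.2 hz))] with m hm
  exact indicator_of_mem (show z ∈ {z : Euc n | _ ≤ ‖z‖} from hm.le) _

theorem abs_truncKernel_le (ε : ℝ) (z : Euc n) : |truncKernel k ε z| ≤ |k z| := by
  by_cases hz : ε ≤ ‖z‖
  · rw [truncKernel, indicator_of_mem (by exact hz)]
  · rw [truncKernel, indicator_of_notMem (by exact hz), abs_zero]
    exact abs_nonneg _

/-- The energy form on a bounded function, for an integrable kernel. -/
theorem integral_difference_mul {κ φ f : Euc n → ℝ} (hκ : Integrable κ) (hf : Integrable f)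
    (hφ : Continuous φ) {M : ℝ} (hM : ∀ x, ‖φ x‖ ≤ M) :
    ∫ z : Euc n × Euc n, (φ z.1 - φ z.2) * (f z.1 - f z.2) * κ (z.1 - z.2) ∂(volume.prod volume)
      = ∫ z : Euc n × Euc n, -(f z.1 * ((φ (z.1 + z.2) + φ (z.1 - z.2) - 2 * φ z.1) * κ z.2))
          ∂(volume.prod volume) := by
  have hκm := aestronglyMeasurable_comp_sub hκ.aestronglyMeasurable
  have hD : AEStronglyMeasurable (fun z : Euc n × Euc n => φ z.1 - φ z.2) (volume.prod volume) :=
    Continuous.aestronglyMeasurable (by fun_prop)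
  have m1 : AEStronglyMeasurable (fun z : Euc n × Euc n =>
      (φ z.1 - φ z.2) * (f z.1 * κ (z.1 - z.2))) (volume.prod volume) :=
    hD.mul (hf.aestronglyMeasurable.comp_fst.mul hκm)
  have m2 : AEStronglyMeasurable (fun z : Euc n × Euc n =>
      (φ z.1 - φ z.2) * (f z.2 * κ (z.1 - z.2))) (volume.prod volume) :=
    hD.mul (hf.aestronglyMeasurable.comp_snd.mul hκm)
  have hbd : ∀ x y, ‖φ x - φ y‖ ≤ 2 * M := fun x y =>
    (norm_sub_le _ _).trans (by linarith [hM x, hM y])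
  have i1' : Integrable (fun z : Euc n × Euc n => (φ z.1 - φ (z.1 - z.2)) * (f z.1 * κ z.2))
      (volume.prod volume) := (hf.mul_prod hκ).bdd_mul
        (Continuous.aestronglyMeasurable (by fun_prop)) (.of_forall fun z => hbd _ _)
  have i2' : Integrable (fun z : Euc n × Euc n => (φ (z.1 + z.2) - φ z.1) * (f z.1 * κ z.2))
      (volume.prod volume) := (hf.mul_prod hκ).bdd_mul
        (Continuous.aestronglyMeasurable (by fun_prop)) (.of_forall fun z => hbd _ _)
  have i1 : Integrable (fun z : Euc n × Euc n => (φ z.1 - φ z.2) * (f z.1 * κ (z.1 - z.2)))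
      (volume.prod volume) := by
    refine (measurePreserving_prod_sub_right.integrable_comp m1).1 ?_
    simpa only [Function.comp_def, sub_sub_cancel] using i1'
  have i2 : Integrable (fun z : Euc n × Euc n => (φ z.1 - φ z.2) * (f z.2 * κ (z.1 - z.2)))
      (volume.prod volume) := by
    refine (measurePreserving_add_prod_fst.integrable_comp m2).1 ?_
    simpa only [Function.comp_def, add_sub_cancel_left] using i2'
  have e1 := measurePreserving_prod_sub_right.integral_comp_of_aestronglyMeasurable m1
  have e2 := measurePreserving_add_prod_fst.integral_comp_of_aestronglyMeasurable m2
  simp only [sub_sub_cancel, add_sub_cancel_left] at e1 e2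
  calc _ = ∫ z : Euc n × Euc n, ((φ z.1 - φ z.2) * (f z.1 * κ (z.1 - z.2))
          - (φ z.1 - φ z.2) * (f z.2 * κ (z.1 - z.2))) ∂(volume.prod volume) := by
        congr 1; ext z; ring
    _ = ∫ z : Euc n × Euc n, ((φ z.1 - φ (z.1 - z.2)) * (f z.1 * κ z.2)
          - (φ (z.1 + z.2) - φ z.1) * (f z.1 * κ z.2)) ∂(volume.prod volume) := by
        rw [integral_sub i1 i2, integral_sub i1' i2', e1, e2]
    _ = _ := by congr 1; ext z; ring

theorem integral_increment_mul (hn : 1 ≤ n) (hk : IsJumpKernel k) {φ f : Euc n → ℝ}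
    (hφ : Continuous φ) {M : ℝ} (hM : ∀ x, ‖φ x‖ ≤ M) {C : ℝ}
    (hC : ∀ x y, |φ (x + y) + φ (x - y) - 2 * φ x| ≤ C * min (‖y‖ ^ 2) 1) (hf : Integrable f)
    (h1 : MemLp (increment k φ) 2 (volume.prod volume))
    (h2 : MemLp (increment k f) 2 (volume.prod volume)) :
    ∫ z, increment k φ z * increment k f z ∂(volume.prod volume)
      = ∫ x, f x * -genLaplacian k φ x := by
  have hkm := hk.aestronglyMeasurable hn
  have hε : ∀ m : ℕ, 0 < 1 / ((m : ℝ) + 1) ∧ 1 / ((m : ℝ) + 1) ≤ 1 := fun m =>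
    ⟨by positivity, by rw [div_le_one (by positivity)]; linarith [m.cast_nonneg (α := ℝ)]⟩
  have hκ : ∀ m : ℕ, Integrable (truncKernel k (1 / ((m : ℝ) + 1))) := fun m =>
    integrable_truncKernel hn hk (hε m).1 (hε m).2
  have hL : Integrable (fun z => increment k φ z * increment k f z)
      ((volume : Measure (Euc n)).prod (volume : Measure (Euc n))) := h1.integrable_mul h2
  have hgm : AEStronglyMeasurable (fun z : Euc n × Euc n => -(f z.1 *
      ((φ (z.1 + z.2) + φ (z.1 - z.2) - 2 * φ z.1) * k z.2))) (volume.prod volume) :=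
    (hf.aestronglyMeasurable.comp_fst.mul (aestronglyMeasurable_second_difference hn hk hφ)).neg
  have hbound : Integrable (fun z : Euc n × Euc n => ‖f z.1‖ * (C * (min (‖z.2‖ ^ 2) 1 * k z.2)))
      (volume.prod volume) := hf.norm.mul_prod (hk.integrable.const_mul C)
  have hle : ∀ (c : ℝ) (z : Euc n × Euc n), |c| ≤ |k z.2| →
      ‖-(f z.1 * ((φ (z.1 + z.2) + φ (z.1 - z.2) - 2 * φ z.1) * c))‖
        ≤ ‖f z.1‖ * (C * (min (‖z.2‖ ^ 2) 1 * k z.2)) := fun c z hc => by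
    rw [norm_neg, norm_mul]
    refine mul_le_mul_of_nonneg_left ?_ (norm_nonneg _)
    rcases eq_or_ne z.2 0 with h | h
    · simp [h, two_mul]
    · rw [abs_of_pos (hk.pos _ h)] at hc
      rw [norm_mul, Real.norm_eq_abs, Real.norm_eq_abs, ← mul_assoc]
      exact mul_le_mul (hC _ _) hc (abs_nonneg _) ((abs_nonneg _).trans (hC z.1 z.2))
  have hR : Integrable (fun z : Euc n × Euc n => -(f z.1 *
      ((φ (z.1 + z.2) + φ (z.1 - z.2) - 2 * φ z.1) * k z.2))) (volume.prod volume) :=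
    hbound.mono' hgm (.of_forall fun z => hle _ z le_rfl)
  have t1 : Tendsto (fun m : ℕ => ∫ z : Euc n × Euc n, (φ z.1 - φ z.2) * (f z.1 - f z.2) *
      truncKernel k (1 / ((m : ℝ) + 1)) (z.1 - z.2) ∂(volume.prod volume)) atTop
      (𝓝 (∫ z, increment k φ z * increment k f z ∂(volume.prod volume))) := by
    refine tendsto_integral_of_dominated_convergence
      (fun z => ‖increment k φ z * increment k f z‖) (fun m => ?_) hL.norm
      (fun m => .of_forall fun z => ?_) (.of_forall fun z => ?_)
    · exact ((Continuous.aestronglyMeasurable (by fun_prop)).mul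
        (hf.aestronglyMeasurable.comp_fst.sub hf.aestronglyMeasurable.comp_snd)).mul
        (aestronglyMeasurable_comp_sub (hκ m).aestronglyMeasurable)
    · rw [increment_mul_increment hk, norm_mul, norm_mul _ (k _)]
      exact mul_le_mul_of_nonneg_left (abs_truncKernel_le _ _) (norm_nonneg _)
    · rw [increment_mul_increment hk]
      rcases eq_or_ne z.1 z.2 with h | h
      · simp [h]
      · refine tendsto_nhds_of_eventually_eq ?_
        filter_upwards [truncKernel_eventuallyEq (k := k) (sub_ne_zero.2 h)] with m hm
        rw [hm]
  have t2 : Tendsto (fun m : ℕ => ∫ z : Euc n × Euc n, -(f z.1 * ((φ (z.1 + z.2) + φ (z.1 - z.2)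
      - 2 * φ z.1) * truncKernel k (1 / ((m : ℝ) + 1)) z.2)) ∂(volume.prod volume)) atTop
      (𝓝 (∫ z : Euc n × Euc n, -(f z.1 * ((φ (z.1 + z.2) + φ (z.1 - z.2) - 2 * φ z.1) * k z.2))
        ∂(volume.prod volume))) := by
    refine tendsto_integral_of_dominated_convergence _ (fun m => ?_) hbound
      (fun m => .of_forall fun z => hle _ z (abs_truncKernel_le _ _)) (.of_forall fun z => ?_)
    · exact (hf.aestronglyMeasurable.comp_fst.mul
        ((Continuous.aestronglyMeasurable (by fun_prop)).mul
          (hκ m).aestronglyMeasurable.comp_snd)).neg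
    · rcases eq_or_ne z.2 0 with h | h
      · simp [h, two_mul]
      · refine tendsto_nhds_of_eventually_eq ?_
        filter_upwards [truncKernel_eventuallyEq (k := k) h] with m hm
        rw [hm]
  simp only [fun m => integral_difference_mul (hκ m) hf hφ hM] at t1
  rw [tendsto_nhds_unique t1 t2, integral_prod _ hR]
  refine integral_congr_ae (.of_forall fun x => ?_)
  simp only [genLaplacian]
  rw [integral_neg, integral_const_mul, mul_neg]

theorem integrable_zeroExt (hB : MeasurableSet B) (hBb : Bornology.IsBounded B) (u : L2 B) :
    Integrable (zeroExt B u) := by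
  have : IsFiniteMeasure (volume.restrict B) := ⟨by simpa using hBb.measure_lt_top⟩
  exact (integrable_indicator_iff hB).2 ((Lp.memLp u).integrable (by norm_num))

/-- The form operator extends minus the general Laplacian on test functions. -/
theorem exists_friedrichsGraph_of_contDiff (hn : 1 ≤ n) (hk : IsJumpKernel k)
    (hB : MeasurableSet B) (hBb : Bornology.IsBounded B) {φ : Euc n → ℝ} (hφ : ContDiff ℝ ∞ φ)
    (hc : HasCompactSupport φ) (hs : tsupport φ ⊆ B) :
    ∃ u w : L2 B, u =ᵐ[volume.restrict B] φ ∧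
      w =ᵐ[volume.restrict B] (fun x => -genLaplacian k φ x) ∧ FriedrichsGraph B k u w := by
  have : IsFiniteMeasure (volume.restrict B) := ⟨by simpa using hBb.measure_lt_top⟩
  obtain ⟨C, -, hC1, hC2⟩ := exists_difference_bounds hφ hc
  obtain ⟨M, hM⟩ := hc.exists_bound_of_continuous hφ.continuous
  have hφ0 : ∀ x ∉ B, φ x = 0 := fun x hx => by
    by_contra h
    exact hx (hs (subset_tsupport _ h))
  have hφ2 : MemLp φ 2 (volume.restrict B) :=
    MemLp.of_bound hφ.continuous.aestronglyMeasurable M (.of_forall hM)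
  have hw2 := memLp_genLaplacian hn hk hBb hφ.continuous hC2
  have hu : zeroExt B hφ2.toLp =ᵐ[volume] φ := by
    refine (zeroExt_congr hB hφ2.coeFn_toLp).trans (.of_forall fun x => ?_)
    by_cases hx : x ∈ B
    · rw [indicator_of_mem hx]
    · rw [indicator_of_notMem hx, hφ0 x hx]
  have hinc := memX0_of_difference_bound hn hk hB hBb hφ.continuous.aestronglyMeasurable hφ0 hC1
  refine ⟨hφ2.toLp, hw2.toLp, hφ2.coeFn_toLp, hw2.coeFn_toLp,
    (memX0_iff hB _).2 (hinc.ae_eq (increment_congr hu).symm), fun v hv => ?_⟩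
  have hv' := (memX0_iff hB v).1 hv
  calc energyForm B k hφ2.toLp v
      = ∫ z, increment k φ z * increment k (zeroExt B v) z ∂(volume.prod volume) := by
        rw [energyForm]
        refine integral_congr_ae ?_
        filter_upwards [increment_congr (k := k) hu] with z hz
        rw [← increment_mul_increment hk, hz]
    _ = ∫ x, zeroExt B v x * -genLaplacian k φ x :=
        integral_increment_mul hn hk hφ.continuous hM hC2 (integrable_zeroExt hB hBb v) hinc hv'
    _ = ∫ x, zeroExt B hw2.toLp x * zeroExt B v x := by
        refine integral_congr_ae ?_
        filter_upwards [zeroExt_congr hB hw2.coeFn_toLp] with x hx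
        rw [hx, mul_comm]
        by_cases hxB : x ∈ B
        · rw [indicator_of_mem hxB]
        · rw [zeroExt_of_notMem v hxB, mul_zero, mul_zero]
    _ = _ := integral_zeroExt_mul hB _ _

theorem dense_energySpace (hn : 1 ≤ n) (hk : IsJumpKernel k) (hBo : IsOpen B)
    (hBb : Bornology.IsBounded B) :
    Dense (energySpace hBo.measurableSet k : Set (L2 B)) := by
  have hB := hBo.measurableSet
  rw [Submodule.dense_iff_topologicalClosure_eq_top, Submodule.topologicalClosure_eq_top_iff,
    Submodule.eq_bot_iff]
  intro w hw
  have h0 : ∀ᵐ x, x ∈ B → zeroExt B w x = 0 := by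
    refine hBo.ae_eq_zero_of_integral_contDiff_smul_eq_zero
      ((integrable_zeroExt hB hBb w).locallyIntegrable.locallyIntegrableOn B)
      fun φ hφ hc hs => ?_
    obtain ⟨u, w', hu, -, hu0, -⟩ := exists_friedrichsGraph_of_contDiff hn hk hB hBb hφ hc hs
    rw [← (Submodule.mem_orthogonal _ _).1 hw u hu0, ← integral_zeroExt_mul hB]
    refine integral_congr_ae ?_
    filter_upwards [zeroExt_congr hB hu] with x hx
    rw [hx, smul_eq_mul]
    by_cases hxB : x ∈ B
    · rw [indicator_of_mem hxB]
    · rw [zeroExt_of_notMem w hxB, mul_zero, mul_zero]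
  have h1 : (fun x => zeroExt B w x ^ 2) =ᵐ[volume] 0 := by
    filter_upwards [h0] with x hx
    by_cases hxB : x ∈ B
    · simp [hx hxB]
    · simp [zeroExt_of_notMem w hxB]
  rw [← norm_eq_zero, ← sq_eq_zero_iff, norm_sq_eq_integral hB, integral_congr_ae h1]
  simp

theorem not_finiteDimensional_L2 (hn : 1 ≤ n) (hBo : IsOpen B) (hBne : B.Nonempty)
    (hBb : Bornology.IsBounded B) : ¬FiniteDimensional ℝ (L2 B) := by
  intro hfd
  have : Nonempty (Fin n) := ⟨⟨0, hn⟩⟩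
  have : Infinite B := Set.infinite_coe_iff.2 fun hfin =>
    (hBo.measure_pos volume hBne).ne' (hfin.measure_zero volume)
  obtain ⟨U, hU1, hU2, hU3⟩ := exists_seq_infinite_isOpen_pairwise_disjoint B
  set V : ℕ → Set (Euc n) := fun i => Subtype.val '' U i with hV
  have hVo : ∀ i, IsOpen (V i) := fun i => hBo.isOpenMap_subtype_val _ (hU2 i)
  have hVB : ∀ i, V i ⊆ B := fun i => Subtype.coe_image_subset B (U i)
  have hμ : ∀ i, volume.restrict B (V i) = volume (V i) := fun i =>
    Measure.restrict_eq_self _ (hVB i)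
  have hfin : ∀ i, volume.restrict B (V i) ≠ ⊤ := fun i => by
    rw [hμ]
    exact ((measure_mono (hVB i)).trans_lt hBb.measure_lt_top).ne
  have hpos : ∀ i, volume.restrict B (V i) ≠ 0 := fun i => by
    rw [hμ]
    exact ((hVo i).measure_pos volume ((hU1 i).nonempty.image _)).ne'
  have hli : LinearIndependent ℝ fun i : ℕ =>
      (indicatorConstLp 2 (hVo i).measurableSet (hfin i) (1 : ℝ) : L2 B) := by
    refine linearIndependent_of_ne_zero_of_inner_eq_zero (fun i h => ?_) fun i j hij => ?_
    · have := L2.inner_indicatorConstLp_indicatorConstLp (𝕜 := ℝ) (hVo i).measurableSet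
        (hVo i).measurableSet (hfin i) (hfin i) (1 : ℝ) (1 : ℝ)
      rw [h, inner_zero_left, inter_self] at this
      simp only [real_inner_self_eq_norm_sq, norm_one, one_pow, smul_eq_mul, mul_one] at this
      exact (ENNReal.toReal_pos (hpos i) (hfin i)).ne this
    · refine (L2.inner_indicatorConstLp_indicatorConstLp (𝕜 := ℝ) (hVo i).measurableSet
        (hVo j).measurableSet (hfin i) (hfin j) (1 : ℝ) (1 : ℝ)).trans ?_
      rw [((disjoint_image_iff Subtype.val_injective).2 (hU3 hij)).inter_eq, measureReal_empty,
        zero_smul]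
  exact not_finite_iff_infinite.2 inferInstance hli.finite

/-- The form operator has a complete orthonormal system of eigenfunctions. -/
theorem exists_isEigensystem (hn : 1 ≤ n) (hk : IsJumpKernel k) (hBo : IsOpen B)
    (hBne : B.Nonempty) (hBb : Bornology.IsBounded B) (hl : LowerBound B k) :
    ∃ (ψ : HilbertBasis ℕ ℝ (L2 B)) (ev : ℕ → ℝ), IsEigensystem B k ψ ev := by
  obtain ⟨ψ, ev, h1, h2, h3, h4⟩ := exists_hilbertBasis_eigen
    (isClosedForm_incrementMap hn hk hBo.measurableSet)
    (isCompactForm_incrementMap hn hk hBo hBne hBb hl) (dense_energySpace hn hk hBo hBb)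
    (not_finiteDimensional_L2 hn hBo hBne hBb)
    (eq_zero_of_incrementMap_eq_zero hn hk hBo.measurableSet hBb)
  refine ⟨ψ, ev, fun j => ?_, h2, h3, h4⟩
  obtain ⟨hj, hj'⟩ := h1 j
  refine (friedrichsGraph_iff hk hBo.measurableSet _ _).2 ⟨hj, fun v => ?_⟩
  rw [hj' v, inner_smul_left]
  rfl

end GenDiff
end FriedrichsExtension

section Solution

namespace GenDiff

variable {n : ℕ} {B : Set (Euc n)} {k : Euc n → ℝ} {ψ : HilbertBasis ℕ ℝ (L2 B)} {ev : ℕ → ℝ}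

theorem eventually_add_pos {t : ℝ} (ht : 0 < t) : ∀ᶠ h : ℝ in 𝓝[≠] 0, 0 < t + h := by
  refine Filter.Eventually.filter_mono nhdsWithin_le_nhds ?_
  filter_upwards [Ioi_mem_nhds (neg_lt_zero.2 ht)] with h hh
  rw [mem_Ioi] at hh
  linarith

namespace IsEigensystem

theorem form_eigen (h : IsEigensystem B k ψ ev) (hk : IsJumpKernel k) (hB : MeasurableSet B)
    (j : ℕ) : ∃ hj : ψ j ∈ energySpace hB k, ∀ v : energySpace hB k,
      inner ℝ (incrementMap hB k ⟨ψ j, hj⟩) (incrementMap hB k v)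
        = ev j * inner ℝ (ψ j) (v : L2 B) := by
  obtain ⟨hj, hj'⟩ := (friedrichsGraph_iff hk hB _ _).1 (h.eigen j)
  refine ⟨hj, fun v => ?_⟩
  rw [hj' v, inner_smul_left]
  rfl

/-- The form operator is diagonal in the eigensystem. -/
theorem friedrichsGraph_iff_inner (h : IsEigensystem B k ψ ev) (hn : 1 ≤ n) (hk : IsJumpKernel k)
    (hB : MeasurableSet B) {u w : L2 B} :
    FriedrichsGraph B k u w ↔ ∀ j, inner ℝ (ψ j) w = ev j * inner ℝ (ψ j) u := by
  rw [friedrichsGraph_iff hk hB]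
  constructor
  · rintro ⟨hu, huw⟩ j
    exact coeff_of_form_eq (h.form_eigen hk hB) huw j
  · intro hw
    exact form_eq_of_summable (isClosedForm_incrementMap hn hk hB) h.pos (h.form_eigen hk hB) hw

theorem mem_friedrichsDomain_iff (h : IsEigensystem B k ψ ev) (hn : 1 ≤ n) (hk : IsJumpKernel k)
    (hB : MeasurableSet B) {u : L2 B} : u ∈ friedrichsDomain B k ↔
      Summable (fun j => (ev j * inner ℝ (ψ j) u) ^ 2) := by
  constructor
  · rintro ⟨w, hw⟩
    have := (hasSum_inner_sq ψ w).summable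
    simpa only [(h.friedrichsGraph_iff_inner hn hk hB).1 hw] using this
  · intro hs
    obtain ⟨w, hw⟩ := exists_of_summable_coeff ψ hs
    exact ⟨w, (h.friedrichsGraph_iff_inner hn hk hB).2 hw⟩

end IsEigensystem

theorem domNorm_eq_norm {u w : L2 B} (hw : ∀ j, inner ℝ (ψ j) w = ev j * inner ℝ (ψ j) u) :
    domNorm ψ ev u = ‖w‖ := by
  have := (hasSum_inner_sq ψ w).tsum_eq
  simp only [hw] at this
  rw [domNorm, this, Real.sqrt_sq (norm_nonneg _)]

theorem IsEigensystem.norm_le_domNorm (h : IsEigensystem B k ψ ev) {u : L2 B}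
    (hu : Summable (fun j => (ev j * inner ℝ (ψ j) u) ^ 2)) :
    ‖u‖ ≤ (ev 0)⁻¹ * domNorm ψ ev u := by
  obtain ⟨w, hw⟩ := exists_of_summable_coeff ψ hu
  rw [domNorm_eq_norm hw]
  refine norm_le_of_abs_inner_le (ψ := ψ) (inv_nonneg.2 (h.pos 0).le) fun j => ?_
  rw [hw, abs_mul, abs_of_pos (h.pos j), ← mul_assoc]
  refine le_mul_of_one_le_left (abs_nonneg _) ?_
  rw [inv_mul_eq_div, one_le_div (h.pos 0)]
  exact h.mono (Nat.zero_le j)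

namespace IsSolution

variable {g : ℝ → ℝ} {f : L2 B} {q : ℝ → L2 B}

theorem continuousOn (hq : IsSolution B k g ψ ev f q) (h : IsEigensystem B k ψ ev) (hn : 1 ≤ n)
    (hk : IsJumpKernel k) (hB : MeasurableSet B) : ContinuousOn q (Ici 0) := by
  intro t₀ ht₀
  rw [ContinuousWithinAt, tendsto_iff_norm_sub_tendsto_zero]
  have hlim := (hq.cont t₀ ht₀).const_mul (ev 0)⁻¹
  rw [mul_zero] at hlim
  refine squeeze_zero' (.of_forall fun t => norm_nonneg _) ?_ hlim
  filter_upwards [self_mem_nhdsWithin] with t ht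
  refine h.norm_le_domNorm ?_
  obtain ⟨w, hw⟩ := hq.mem t ht
  obtain ⟨w₀, hw₀⟩ := hq.mem t₀ ht₀
  have := (hasSum_inner_sq ψ (w - w₀)).summable
  simpa only [inner_sub_right, (h.friedrichsGraph_iff_inner hn hk hB).1 hw,
    (h.friedrichsGraph_iff_inner hn hk hB).1 hw₀, mul_sub] using this

theorem hasDerivAt_inner (hq : IsSolution B k g ψ ev f q) (hg : IsMemoryKernel g)
    (h : IsEigensystem B k ψ ev) (hn : 1 ≤ n) (hk : IsJumpKernel k) (hB : MeasurableSet B) (j : ℕ)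
    {t : ℝ} (ht : 0 < t) : HasDerivAt (causalConv g fun τ => inner ℝ (ψ j) (q τ))
      (-(ev j * inner ℝ (ψ j) (q t)) + g t * inner ℝ (ψ j) f) t := by
  obtain ⟨w, hw, hd⟩ := hq.eqn t ht
  have h1 := ((innerSL ℝ (ψ j)).hasFDerivAt.comp_hasDerivAt t hd)
  simp only [innerSL_apply_apply, inner_add_right, inner_neg_right, inner_smul_right,
    (h.friedrichsGraph_iff_inner hn hk hB).1 hw, hq.init] at h1
  refine h1.congr_of_eventuallyEq ?_
  filter_upwards [Ioi_mem_nhds ht] with s hs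
  have hi := intervalIntegrable_causalConv hg.integrableOn_Ioc (hq.continuousOn h hn hk hB)
    (le_of_lt hs)
  have := (innerSL ℝ (ψ j)).intervalIntegral_comp_comm hi
  simp only [innerSL_apply_apply, inner_smul_right] at this
  simpa only [causalConv, smul_eq_mul, Function.comp_apply, innerSL_apply_apply] using this

end IsSolution

namespace IsRelaxationFamily

variable {g : ℝ → ℝ} {W : ℕ → ℕ → ℝ → ℝ} {f w : L2 B}

theorem inner_evol_eq (hW : IsRelaxationFamily g ev W)
    (hw : ∀ j, inner ℝ (ψ j) w = ev j * inner ℝ (ψ j) f) (m : ℕ) {t : ℝ} (ht : 0 < t) (j : ℕ) :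
    inner ℝ (ψ j) (evol ψ W m t w) = ev j * inner ℝ (ψ j) (evol ψ W m t f) := by
  rw [hW.inner_evol ψ m ht, hW.inner_evol ψ m ht, hw, mul_left_comm]

theorem inner_evol_zero_eq (hW : IsRelaxationFamily g ev W)
    (hw : ∀ j, inner ℝ (ψ j) w = ev j * inner ℝ (ψ j) f) {t : ℝ} (ht : 0 ≤ t) (j : ℕ) :
    inner ℝ (ψ j) (evol ψ W 0 t w) = ev j * inner ℝ (ψ j) (evol ψ W 0 t f) := by
  rw [hW.inner_evol_zero ψ ht, hW.inner_evol_zero ψ ht, hw, mul_left_comm]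

theorem domNorm_evol_sub (hW : IsRelaxationFamily g ev W)
    (hw : ∀ j, inner ℝ (ψ j) w = ev j * inner ℝ (ψ j) f) {t s : ℝ} (ht : 0 ≤ t) (hs : 0 ≤ s) :
    domNorm ψ ev (evol ψ W 0 t f - evol ψ W 0 s f) = ‖evol ψ W 0 t w - evol ψ W 0 s w‖ :=
  domNorm_eq_norm fun j => by
    rw [inner_sub_right, inner_sub_right, hW.inner_evol_zero_eq hw ht,
      hW.inner_evol_zero_eq hw hs, mul_sub]

theorem tendsto_domNorm_evol_sub (hW : IsRelaxationFamily g ev W)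
    (hw : ∀ j, inner ℝ (ψ j) w = ev j * inner ℝ (ψ j) f) {t₀ : ℝ} (ht₀ : 0 ≤ t₀) :
    Tendsto (fun t => domNorm ψ ev (evol ψ W 0 t f - evol ψ W 0 t₀ f)) (𝓝[Ici 0] t₀) (𝓝 0) := by
  refine (tendsto_iff_norm_sub_tendsto_zero.1 (hW.continuousOn_evol_zero ψ w t₀ ht₀)).congr' ?_
  filter_upwards [self_mem_nhdsWithin] with t ht
  rw [hW.domNorm_evol_sub hw ht ht₀]

theorem hasGenCaputoDeriv_evol (hW : IsRelaxationFamily g ev W) (hg : IsMemoryKernel g)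
    (hw : ∀ j, inner ℝ (ψ j) w = ev j * inner ℝ (ψ j) f) {t : ℝ} (ht : 0 < t) :
    HasGenCaputoDeriv g (fun t => evol ψ W 0 t f) (-evol ψ W 0 t w) t :=
  hg.hasGenCaputoDeriv (w := fun t => evol ψ W 0 t w) (hW.continuousOn_evol_zero ψ w)
    (fun t ht => by
      rw [hW.evol_zero_zero, hW.causalConv_evol ψ hg.integrableOn_Ioc hw ht]) ht

theorem hasGenCaputoDeriv_coeff (hW : IsRelaxationFamily g ev W) (hg : IsMemoryKernel g) (j : ℕ)
    (a : ℝ) {t : ℝ} (ht : 0 < t) :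
    HasGenCaputoDeriv g (fun t => W j 0 t * a) (-(ev j * (W j 0 t * a))) t := by
  refine hg.hasGenCaputoDeriv (w := fun t => ev j * (W j 0 t * a))
    (continuousOn_const.mul ((hW.cont j).mul continuousOn_const)) (fun t ht => ?_) ht
  have h1 := hW.eqn j t ht
  have h2 : causalConv g (fun t => W j 0 t * a) t = causalConv g (W j 0) t * a := by
    rw [causalConv, causalConv, ← intervalIntegral.integral_mul_const]
    simp only [smul_eq_mul, mul_assoc]
  rw [h2, intervalIntegral.integral_const_mul, intervalIntegral.integral_mul_const, hW.one,
    smul_eq_mul, ← h1]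
  ring

theorem isSolution_evol (hW : IsRelaxationFamily g ev W) (hg : IsMemoryKernel g)
    (h : IsEigensystem B k ψ ev) (hn : 1 ≤ n) (hk : IsJumpKernel k) (hB : MeasurableSet B)
    (hw : ∀ j, inner ℝ (ψ j) w = ev j * inner ℝ (ψ j) f) :
    IsSolution B k g ψ ev f fun t => evol ψ W 0 t f where
  mem t ht := ⟨evol ψ W 0 t w,
    (h.friedrichsGraph_iff_inner hn hk hB).2 (hW.inner_evol_zero_eq hw ht)⟩
  cont _ ht₀ := hW.tendsto_domNorm_evol_sub hw ht₀
  eqn t ht := ⟨evol ψ W 0 t w,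
    (h.friedrichsGraph_iff_inner hn hk hB).2 (hW.inner_evol_zero_eq hw ht.le),
    hW.hasGenCaputoDeriv_evol hg hw ht⟩
  init := hW.evol_zero_zero ψ f

theorem eq_evol_of_isSolution (hW : IsRelaxationFamily g ev W) (hg : IsMemoryKernel g)
    (h : IsEigensystem B k ψ ev) (hn : 1 ≤ n) (hk : IsJumpKernel k) (hB : MeasurableSet B)
    {q : ℝ → L2 B} (hq : IsSolution B k g ψ ev f q) {t : ℝ} (ht : 0 ≤ t) :
    q t = evol ψ W 0 t f :=
  ext_inner_basis (ψ := ψ) fun j => by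
    rw [hW.inner_evol_zero ψ ht, mul_comm]
    exact hg.eq_of_hasGenCaputoDeriv (h.pos j)
      ((innerSL ℝ (ψ j)).continuous.comp_continuousOn (hq.continuousOn h hn hk hB))
      (fun t ht => hq.hasDerivAt_inner hg h hn hk hB j ht) (hW.cont j) (hW.eqn j) t ht

theorem tendsto_domNorm_slope (hW : IsRelaxationFamily g ev W)
    (hw : ∀ j, inner ℝ (ψ j) w = ev j * inner ℝ (ψ j) f) (m : ℕ) {t : ℝ} (ht : 0 < t) :
    Tendsto (fun h : ℝ => domNorm ψ ev
      (h⁻¹ • (evol ψ W m (t + h) f - evol ψ W m t f) - evol ψ W (m + 1) t f)) (𝓝[≠] 0) (𝓝 0) := by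
  have h1 := hasDerivAt_iff_tendsto_slope_zero.1 (hW.hasDerivAt_evol ψ m ht w)
  refine (tendsto_iff_norm_sub_tendsto_zero.1 h1).congr' ?_
  filter_upwards [eventually_add_pos ht] with h hh
  refine (domNorm_eq_norm fun j => ?_).symm
  simp only [inner_sub_right, inner_smul_right, hW.inner_evol_eq hw _ ht,
    hW.inner_evol_eq hw _ hh]
  ring

end IsRelaxationFamily

end GenDiff
end Solution

theorem mainTheorem2 {n : ℕ} (hn : 1 ≤ n)
    (B : Set (EuclideanSpace ℝ (Fin n))) (hB_open : IsOpen B) (hB_ne : B.Nonempty)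
    (hB_bdd : Bornology.IsBounded B) (hB_smooth : GenDiff.HasSmoothBoundary B)
    (k : EuclideanSpace ℝ (Fin n) → ℝ) (hk : GenDiff.IsJumpKernel k)
    (hk_lower : GenDiff.LowerBound B k)
    (g : ℝ → ℝ) (hg : GenDiff.IsMemoryKernel g) :
    -- the form operator extends minus the general Laplacian on smooth compactly supported functions
    (∀ φ : EuclideanSpace ℝ (Fin n) → ℝ, ContDiff ℝ ∞ φ → HasCompactSupport φ → tsupport φ ⊆ B →
      ∃ u w : GenDiff.L2 B, u =ᵐ[volume.restrict B] φ ∧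
        w =ᵐ[volume.restrict B] (fun x => -GenDiff.genLaplacian k φ x) ∧
        GenDiff.FriedrichsGraph B k u w) ∧
    -- eigensystems exist
    (∃ (ψ : HilbertBasis ℕ ℝ (GenDiff.L2 B)) (ev : ℕ → ℝ), GenDiff.IsEigensystem B k ψ ev) ∧
    ∀ (ψ : HilbertBasis ℕ ℝ (GenDiff.L2 B)) (ev : ℕ → ℝ), GenDiff.IsEigensystem B k ψ ev →
      -- the domain in terms of the eigensystem
      (∀ u : GenDiff.L2 B, u ∈ GenDiff.friedrichsDomain B k ↔
        Summable (fun j => (ev j * inner ℝ (ψ j) u) ^ 2)) ∧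
      ∀ f ∈ GenDiff.friedrichsDomain B k, ∃ p : ℝ → GenDiff.L2 B,
        -- existence and uniqueness
        GenDiff.IsSolution B k g ψ ev f p ∧
        (∀ q : ℝ → GenDiff.L2 B, GenDiff.IsSolution B k g ψ ev f q → ∀ t, 0 ≤ t → q t = p t) ∧
        -- eigenfunction expansion
        (∃ c : ℕ → ℝ → ℝ,
          (∀ j, ContinuousOn (c j) (Ici 0) ∧ c j 0 = inner ℝ (ψ j) f ∧
            ∀ t, 0 < t → GenDiff.HasGenCaputoDeriv g (c j) (-(ev j * c j t)) t) ∧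
          ∀ t, 0 ≤ t → HasSum (fun j => c j t • ψ j) (p t)) ∧
        -- bounds for `p` and its general Caputo-type derivative
        (∀ t, 0 ≤ t → ‖p t‖ ≤ ‖f‖) ∧
        (∀ t, 0 ≤ t → GenDiff.domNorm ψ ev (p t) ≤ GenDiff.domNorm ψ ev f) ∧
        (∀ t, 0 < t → ∃ w, GenDiff.HasGenCaputoDeriv g p w t ∧ ‖w‖ ≤ GenDiff.domNorm ψ ev f) ∧
        -- `p` is smooth on `(0, ∞)` with values in `L²(B)` and with values in the domain
        ContDiffOn ℝ ∞ p (Ioi 0) ∧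
        (∀ (m : ℕ) (t : ℝ), 0 < t → iteratedDeriv m p t ∈ GenDiff.friedrichsDomain B k ∧
          Tendsto (fun h : ℝ => GenDiff.domNorm ψ ev
              (h⁻¹ • (iteratedDeriv m p (t + h) - iteratedDeriv m p t) - iteratedDeriv (m + 1) p t))
            (𝓝[≠] 0) (𝓝 0)) ∧
        -- bounds for the time derivatives
        (∀ (m : ℕ) (t : ℝ), 0 < t →
          ‖iteratedDeriv m p t‖ ≤ ((m : ℝ) / (Real.exp 1 * t)) ^ m * ‖f‖) ∧
        (∀ (m : ℕ) (t : ℝ), 0 < t →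
          GenDiff.domNorm ψ ev (iteratedDeriv m p t) ≤
            ((m : ℝ) / (Real.exp 1 * t)) ^ m * GenDiff.domNorm ψ ev f) ∧
        -- behaviour as `t → 0` and as `t → ∞`
        Tendsto (fun t => GenDiff.domNorm ψ ev (p t - f)) (𝓝[>] 0) (𝓝 0) ∧
        Tendsto (fun t => GenDiff.domNorm ψ ev (p t)) atTop (𝓝 0) := by

  have hB := hB_open.measurableSet
  refine ⟨fun φ hφ hc hs =>
      GenDiff.exists_friedrichsGraph_of_contDiff hn hk hB hB_bdd hφ hc hs,
    GenDiff.exists_isEigensystem hn hk hB_open hB_ne hB_bdd hk_lower, fun ψ ev h =>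
    ⟨fun u => h.mem_friedrichsDomain_iff hn hk hB, fun f hf => ?_⟩⟩
  obtain ⟨w, hw⟩ := hf
  rw [h.friedrichsGraph_iff_inner hn hk hB] at hw
  obtain ⟨W, hW⟩ := hg.exists_relaxationFamily h.pos
  have hfw := GenDiff.domNorm_eq_norm hw
  refine ⟨fun t => GenDiff.evol ψ W 0 t f, hW.isSolution_evol hg h hn hk hB hw,
    fun q hq t ht => hW.eq_evol_of_isSolution hg h hn hk hB hq ht,
    ⟨fun j t => W j 0 t * inner ℝ (ψ j) f, fun j => ⟨(hW.cont j).mul continuousOn_const,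
      by simp only [hW.one, one_mul], fun t ht => hW.hasGenCaputoDeriv_coeff hg j _ ht⟩,
      fun t ht => GenDiff.hasSum_diagSum ψ (hW.bound_zero t ht) f⟩,
    fun t ht => hW.norm_evol_zero_le ψ ht f, fun t ht => ?_,
    fun t ht => ⟨_, hW.hasGenCaputoDeriv_evol hg hw ht, ?_⟩, hW.contDiffOn_evol ψ f 0,
    fun m t ht => ⟨?_, ?_⟩, fun m t ht => ?_, fun m t ht => ?_, ?_, ?_⟩
  · rw [GenDiff.domNorm_eq_norm (hW.inner_evol_zero_eq hw ht), hfw]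
    exact hW.norm_evol_zero_le ψ ht w
  · rw [norm_neg, hfw]
    exact hW.norm_evol_zero_le ψ ht.le w
  · rw [hW.iteratedDeriv_evol ψ f m ht]
    exact ⟨_, (h.friedrichsGraph_iff_inner hn hk hB).2 (hW.inner_evol_eq hw m ht)⟩
  · refine (hW.tendsto_domNorm_slope hw m ht).congr' ?_
    filter_upwards [GenDiff.eventually_add_pos ht] with s hs
    rw [hW.iteratedDeriv_evol ψ f m ht, hW.iteratedDeriv_evol ψ f m hs,
      hW.iteratedDeriv_evol ψ f (m + 1) ht]
  · rw [hW.iteratedDeriv_evol ψ f m ht]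
    exact hW.norm_evol_le ψ m ht f
  · rw [hW.iteratedDeriv_evol ψ f m ht, hfw, GenDiff.domNorm_eq_norm (hW.inner_evol_eq hw m ht)]
    exact hW.norm_evol_le ψ m ht w
  · have := hW.tendsto_domNorm_evol_sub hw le_rfl
    simp only [hW.evol_zero_zero] at this
    exact this.mono_left (nhdsWithin_mono 0 Ioi_subset_Ici_self)
  · refine (tendsto_norm_zero.comp (hW.tendsto_evol_zero ψ w)).congr' ?_
    filter_upwards [eventually_ge_atTop 0] with t ht
    exact (GenDiff.domNorm_eq_norm (hW.inner_evol_zero_eq hw ht)).symm
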